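/- **Setting.** Let $X$ be a measurable space and $\mathcal C$ a class of measurable functions $X\to\{\pm1\}$ of finite VC dimension $d$. Distributions $\mathcal D$ on $X$ are assumed to satisfy the usual measurability proviso: for all $m$ and $v\in\{\pm1\}^m$ the set $\{x\in X^m:\exists c\in\mathcal C\ \forall i\ c(x_i)=v_i\}$ is $\mathcal D^m$-measurable up to null sets (automatic if $\mathcal D$ is discrete or $\mathcal C$ is countable). For $\bar h:X\to[-1,1]$ let $\mathbf h=\mathrm{Rad}(\bar h)$ be the randomized hypothesis with $\Pr[\mathbf h(x)=\pm1]=\frac{1\pm\bar h(x)}2$, and let $\mathrm{error}_{\mathcal D}(\mathbf h,c)=\Pr_{x\sim\mathcal D,\mathbf h}[\mathbf h(x)\ne c(x)]$. *Noise.* The target is $c^\star\in\mathcal C$ and the distribution is $\mathcal D$. In $\eta$-nasty noise a clean sample of $n$ i.i.d. examples $(x,c^\star(x))$, $x\sim\mathcal D$, is drawn; having seen it, the adversary picks a set $J$ of indices such that $|J|$ has distribution $\mathrm{Bin}(n,\eta)$, and replaces the examples with indices in $J$ arbitrarily. In $\eta$-malicious noise the $n$ examples are generated one after the other, each being, independently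 of the past, a clean example with probability $1-\eta$ and any example chosen by the adversary with probability $\eta$. A $(\tau,\delta)$ learner is one that, for every $c^\star\in\mathcal C$, every $\mathcal D$ and every adversary, with probability at least $1-\delta$ returns $\mathbf h$ with $\mathrm{error}_{\mathcal D}(\mathbf h,c^\star)\le\tau$. *The learner.* For a dataset $S$ let $\ell_S(c,\bar h)=\mathbb E_{(x,y)\sim\mathrm{Unif}(S)}[c(x)y(2-\bar h(x)y)-\bar h(x)y]$, and let $g(t)=\frac{16}{19}M_7(t)+\frac3{19}t$, where $M_7(t)=\mathbb E[\mathrm{sign}(z_1+\dots+z_7)]$ for i.i.d. $z_i\sim\mathrm{Rad}(t)$. The learner with accuracy parameter $\varepsilon'$ starts with any $\mu_1\in\mathcal C$. In iteration $t=1,2,\dots$ it finds any $c_t\in\mathcal C$ with $\ell_S(c_t,g\circ\mu_t)\ge\sup_{c\in\mathcal C}\ell_S(c,g\circ\mu_t)-\varepsilon'/20$; if $\ell_S(c_t,g\circ\mu_t)\le\frac{19}{20}\varepsilon'$ it returns $\mathrm{Rad}(g\circ\mu_t)$, and otherwise it sets $\mu_{t+1}=(1-\gamma)\mu_t+\gamma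 c_t$ with $\gamma=\frac2{t+2}$. **Theorem.** There are universal constants $A,K$ such that for all such $X,\mathcal C,d$, all $\varepsilon,\delta\in(0,1)$ and $\alpha\in[0,1)$, and all $$n\ \ge\ K\cdot\frac{d\log(2+\alpha/\varepsilon)+\log(1/\delta)}{\varepsilon(\alpha+\varepsilon)},$$ the learner on $n$ examples with accuracy parameter $\varepsilon'=1/(A\lceil1/\varepsilon\rceil)$ has the following properties, whatever its choices. 1. It is an $\bigl((\tfrac12+\alpha)\tfrac{\eta}{1-\eta}+\varepsilon,\ \delta\bigr)$ learner for $\mathcal C$ with $\eta$-malicious noise, for every $\eta\in[0,1)$. 2. The same learner is a $\bigl((\tfrac32+\alpha)\eta+\varepsilon,\ \delta\bigr)$ learner for $\mathcal C$ with $\eta$-nasty noise, for every $\eta\in[0,1]$. 3. It is efficiently implementable: a single program (a random access machine with logarithmic costs that accesses points and concepts only through the labels of its examples, values of returned concepts at its points, and calls to an ERM oracle for $\mathcal C$), not depending on $X,\mathcal C,\varepsilon,\delta,\alpha,n$, that is given $n$ and $\lceil1/\varepsilon\rceil$, returns on every dataset of $n$ examples and with every ERM oracle for $\mathcal C$ an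 output of the learner, described by weights of the returned concepts in $\mu_t$, after at most $K/\varepsilon$ oracle calls and at most $K(n+1/\varepsilon)^K$ steps. Here an ERM oracle returns, for a dataset $((x_i,y_i))_i$, any $c\in\mathcal C$ maximizing $\sum_ic(x_i)y_i$. -/

import Mathlib

universe u v

namespace RobustLearning

open MeasureTheory ProbabilityTheory
open scoped unitInterval

/-! ### Concept classes -/

section Concepts

variable {X : Type*}

/-- The two labels `+1` and `-1` are the Booleans `true` and `false`. -/
def pm (b : Bool) : ℝ := if b then 1 else -1

/-- `C` takes on all labelings of the finite set `s`. -/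
def Shatters (C : Set (X → Bool)) (s : Finset X) : Prop :=
  ∀ f : X → Bool, ∃ c ∈ C, ∀ x ∈ s, c x = f x

/-- The VC dimension of `C` is the natural number `d`. -/
def HasVCDim (C : Set (X → Bool)) (d : ℕ) : Prop :=
  IsGreatest {k : ℕ | ∃ s : Finset X, s.card = k ∧ Shatters C s} d

/-- The usual measurability proviso for uniform convergence over a class `C` of concepts: for every
`m` and every labeling `v`, the event that `m` independent draws from `D` can be labeled by `v`
using a concept of `C` is measurable up to null sets. It holds for every class if `D` is discrete,
and for every countable or pointwise separable class of measurable concepts. -/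
def TraceMeasurable [MeasurableSpace X] (C : Set (X → Bool)) (D : Measure X) : Prop :=
  ∀ (m : ℕ) (v : Fin m → Bool),
    NullMeasurableSet {x : Fin m → X | ∃ c ∈ C, ∀ i, c (x i) = v i} (Measure.pi fun _ => D)

end Concepts

/-! ### Randomized hypotheses and their error -/

section Hypotheses

variable {X : Type*}

/-- The Rademacher distribution on labels with mean `t ∈ [-1, 1]`:
`+1` with probability `(1 + t) / 2` and `-1` with probability `(1 - t) / 2`. -/
noncomputable def rad (t : ℝ) : Measure Bool :=
  bernoulliMeasure true false (Set.projIcc 0 1 zero_le_one ((1 + t) / 2))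

/-- A mean function `h : X → ℝ` describes the randomized hypothesis `Rad (h)`. -/
def IsHypothesis [MeasurableSpace X] (h : X → ℝ) : Prop :=
  Measurable h ∧ ∀ x, h x ∈ Set.Icc (-1 : ℝ) 1

/-- The error rate `Pr [𝐡(x) ≠ c(x)]` of the randomized hypothesis `𝐡 = Rad (h)`,
over `x ∼ D` and the randomness of `𝐡`. -/
noncomputable def error [MeasurableSpace X] (D : Measure X) (h : X → ℝ) (c : X → Bool) : ℝ :=
  ∫ x, (rad (h x)).real {y | y ≠ c x} ∂D

end Hypotheses

/-! ### Noise models -/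

section Noise

variable {X Ω : Type*} [MeasurableSpace X] [MeasurableSpace Ω] {n : ℕ}

/-- `S` is a dataset with `η`-nasty noise: `x` is an i.i.d. sample from `D`; having seen it, the
adversary selects the set `J` of indices so that `|J|` is `Bin (n, η)`, and
replaces the clean examples with indices in `J` arbitrarily. -/
structure IsNasty (P : Measure Ω) (D : Measure X) (c : X → Bool) (η : I)
    (x : Ω → Fin n → X) (J : Ω → Finset (Fin n)) (S : Ω → Fin n → X × Bool) : Prop where
  measurable_x : Measurable x
  law_x : P.map x = Measure.pi fun _ => D
  measurable_card : Measurable fun ω => (J ω).card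
  law_card : (P.map fun ω => (J ω).card) = binomial n η
  clean : ∀ ω, ∀ i ∉ J ω, S ω i = (x ω i, c (x ω i))

/-- `S` is a dataset with `η`-malicious noise, generated sequentially. The `σ`-algebra `F i` is what
is known before round `i`. In round `i` a coin `B i`, which is `true` with probability `η`, and a
point `x i` drawn from `D` are generated, independently of each other and of `F i`; if the coin is
`false` the clean example is used, and otherwise the adversary chooses any example. -/
structure IsMalicious (P : Measure Ω) (D : Measure X) (c : X → Bool) (η : I)
    (F : Filtration ℕ (inferInstance : MeasurableSpace Ω))
    (x : Ω → Fin n → X) (B : Ω → Fin n → Bool) (S : Ω → Fin n → X × Bool) : Prop where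
  measurable_x : ∀ i : Fin n, Measurable[F (i.val + 1)] fun ω => x ω i
  measurable_B : ∀ i : Fin n, Measurable[F (i.val + 1)] fun ω => B ω i
  measurable_S : ∀ i : Fin n, Measurable[F (i.val + 1)] fun ω => S ω i
  law : ∀ i : Fin n, (P.map fun ω => (x ω i, B ω i)) = D.prod (bernoulliMeasure true false η)
  indep : ∀ i : Fin n,
    Indep (MeasurableSpace.comap (fun ω => (x ω i, B ω i)) inferInstance) (F i.val) P
  clean : ∀ ω i, B ω i = false → S ω i = (x ω i, c (x ω i))

end Noise

/-! ### Learners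

A learner on `n` examples is given by the set `L S` of the (mean functions of the) hypotheses that
it may return on the dataset `S`; whichever of them it returns has to be good. "With probability at
least `1 - δ`" says that the failure event has outer measure at most `δ`. -/

section Learners

variable {X : Type*} [MeasurableSpace X] {n : ℕ}

/-- `L` is a distribution-independent `(τ, δ)`-learner for `C` with `η`-nasty noise. -/
def LearnsNasty.{w} (C : Set (X → Bool)) (L : (Fin n → X × Bool) → Set (X → ℝ))
    (η : I) (τ δ : ℝ) : Prop :=
  ∀ c ∈ C, ∀ (D : Measure X) [IsProbabilityMeasure D], TraceMeasurable C D →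
  ∀ (Ω : Type w) [MeasurableSpace Ω] (P : Measure Ω) [IsProbabilityMeasure P]
    (x : Ω → Fin n → X) (J : Ω → Finset (Fin n)) (S : Ω → Fin n → X × Bool),
    IsNasty P D c η x J S →
    P {ω | ∃ h ∈ L (S ω), ¬ (IsHypothesis h ∧ error D h c ≤ τ)} ≤ ENNReal.ofReal δ

/-- `L` is a distribution-independent `(τ, δ)`-learner for `C` with `η`-malicious noise. -/
def LearnsMalicious.{w} (C : Set (X → Bool)) (L : (Fin n → X × Bool) → Set (X → ℝ))
    (η : I) (τ δ : ℝ) : Prop :=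
  ∀ c ∈ C, ∀ (D : Measure X) [IsProbabilityMeasure D], TraceMeasurable C D →
  ∀ (Ω : Type w) [MeasurableSpace Ω] (P : Measure Ω) [IsProbabilityMeasure P]
    (F : Filtration ℕ (inferInstance : MeasurableSpace Ω))
    (x : Ω → Fin n → X) (B : Ω → Fin n → Bool) (S : Ω → Fin n → X × Bool),
    IsMalicious P D c η F x B S →
    P {ω | ∃ h ∈ L (S ω), ¬ (IsHypothesis h ∧ error D h c ≤ τ)} ≤ ENNReal.ofReal δ

end Learners

/-! ### The learner -/

section LearnMal

variable {X : Type*} {n : ℕ}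

/-- The loss `ℓ_S(c, h) = 𝔼 [c(x) y (2 - h(x) y) - h(x) y]` over a uniform example `(x, y)` of `S`. -/
noncomputable def loss (S : Fin n → X × Bool) (c : X → Bool) (h : X → ℝ) : ℝ :=
  (∑ i, (pm (c (S i).1) * pm (S i).2 * (2 - h (S i).1 * pm (S i).2)
    - h (S i).1 * pm (S i).2)) / n

/-- `M_k(t)`, the expectation of `sign (z₁ + ⋯ + z_k)` for `z₁, …, z_k` i.i.d. from `Rad (t)`,
where `sign 0 = 1`. -/
noncomputable def majMean (k : ℕ) (t : ℝ) : ℝ :=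
  ∑ z : Fin k → Bool, (∏ i, (1 + t * pm (z i)) / 2) * (if 0 ≤ ∑ i, pm (z i) then 1 else -1)

/-- `g(t) = (16 / 19) M₇(t) + (3 / 19) t`. -/
noncomputable def gMaj (t : ℝ) : ℝ := 16 / 19 * majMean 7 t + 3 / 19 * t

/-- `c` maximizes `ℓ_S(·, h)` over the class `C` up to `ε / 20`. -/
def ApproxMax (C : Set (X → Bool)) (S : Fin n → X × Bool) (ε : ℝ) (h : X → ℝ)
    (c : X → Bool) : Prop :=
  c ∈ C ∧ ∀ c' ∈ C, loss S c' h - ε / 20 ≤ loss S c h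

/-- `LearnIter C S ε t μ`: the learner, run on the dataset `S` with accuracy parameter `ε`, can reach
iteration `t` with the mixture `μ` of concepts. It starts with any `μ₁ ∈ C`; in iteration `t` it
finds any `c_t` that maximizes `ℓ_S(·, g ∘ μ_t)` up to `ε / 20`, and unless
`ℓ_S(c_t, g ∘ μ_t) ≤ (19 / 20) ε` it sets `μ_{t+1} = (1 - γ) μ_t + γ c_t` with `γ = 2 / (t + 2)`. -/
inductive LearnIter (C : Set (X → Bool)) (S : Fin n → X × Bool) (ε : ℝ) : ℕ → (X → ℝ) → Prop
  | init (c : X → Bool) : c ∈ C → LearnIter C S ε 1 (fun x => pm (c x))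
  | step (t : ℕ) (μ : X → ℝ) (c : X → Bool) :
      LearnIter C S ε t μ → ApproxMax C S ε (gMaj ∘ μ) c →
      19 / 20 * ε < loss S c (gMaj ∘ μ) →
      LearnIter C S ε (t + 1)
        (fun x => (1 - 2 / ((t : ℝ) + 2)) * μ x + 2 / ((t : ℝ) + 2) * pm (c x))

/-- The hypotheses `g ∘ μ_t` that the learner may return: the run stops at iteration `t` because
`ℓ_S(c_t, g ∘ μ_t) ≤ (19 / 20) ε`. -/
def learnMal (C : Set (X → Bool)) (ε : ℝ) (S : Fin n → X × Bool) : Set (X → ℝ) :=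
  {h | ∃ t μ c, LearnIter C S ε t μ ∧ ApproxMax C S ε (gMaj ∘ μ) c ∧
    loss S c (gMaj ∘ μ) ≤ 19 / 20 * ε ∧ h = gMaj ∘ μ}

end LearnMal

/-! ### ERM oracles -/

section Oracle

variable {X : Type*}

/-- `c` is a possible answer of an ERM oracle for `C` to the dataset `Q`. -/
def IsERM (C : Set (X → Bool)) (Q : List (X × Bool)) (c : X → Bool) : Prop :=
  c ∈ C ∧ ∀ c' ∈ C,
    (Q.map fun e => pm (c' e.1) * pm e.2).sum ≤ (Q.map fun e => pm (c e.1) * pm e.2).sum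

/-- An ERM oracle for `C`; `E j Q` is the answer to `Q` if this is call number `j`, so that ties
may be broken in different ways in different calls. -/
def IsERMOracle (C : Set (X → Bool)) (E : ℕ → List (X × Bool) → X → Bool) : Prop :=
  ∀ j Q, IsERM C Q (E j Q)

end Oracle

/-! ### Programs with an ERM oracle

A random access machine over the natural numbers with logarithmic costs. It sees the points of the
dataset and the concepts returned by the oracle only through their indices: it can read the label of
an example, evaluate a returned concept at an example, and assemble datasets for the oracle from
the points of its input with labels of its choice. -/

/-- Expressions. `label i` is the label of example number `i` and `app k i` is the value of the
concept returned in call number `k` at the point of example number `i` (as `1` or `0`). -/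
inductive Expr : Type
  | const : ℕ → Expr
  | read : Expr → Expr
  | add : Expr → Expr → Expr
  | sub : Expr → Expr → Expr
  | mul : Expr → Expr → Expr
  | div : Expr → Expr → Expr
  | label : Expr → Expr
  | app : Expr → Expr → Expr

/-- Programs. `push i b` appends example number `i`, relabeled by `b`, to the pending query, `erm`
sends that query to the oracle, and `emit k w` gives weight `w` to concept number `k` in the
output. Conditions are true if they are not `0`. -/
inductive Prog : Type
  | skip : Prog
  | assign : Expr → Expr → Prog
  | push : Expr → Expr → Prog
  | erm : Prog
  | emit : Expr → Expr → Prog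
  | seq : Prog → Prog → Prog
  | ite : Expr → Prog → Prog → Prog
  | loop : Expr → Prog → Prog

section Machine

variable {X : Type*} {n : ℕ}

/-- The memory, the pending query, the concepts returned so far, and the output so far. -/
structure Config (X : Type*) where
  mem : ℕ → ℕ
  query : List (X × Bool)
  concepts : List (X → Bool)
  out : List ((X → Bool) × ℕ)

/-- The value of an expression (`0` if an index is out of range). -/
def Expr.val (S : Fin n → X × Bool) (s : Config X) : Expr → ℕ
  | .const k => k
  | .read a => s.mem (a.val S s)
  | .add a b => a.val S s + b.val S s
  | .sub a b => a.val S s - b.val S s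
  | .mul a b => a.val S s * b.val S s
  | .div a b => a.val S s / b.val S s
  | .label a => if h : a.val S s < n then (S ⟨a.val S s, h⟩).2.toNat else 0
  | .app a b =>
      if h : a.val S s < s.concepts.length ∧ b.val S s < n then
        ((s.concepts[a.val S s]'h.1) (S ⟨b.val S s, h.2⟩).1).toNat
      else 0

/-- The cost of evaluating an expression: every node costs `1` plus the bit length of its value. -/
def Expr.cost (S : Fin n → X × Bool) (s : Config X) (e : Expr) : ℕ :=
  1 + (e.val S s).size + match e with
    | .const _ => 0
    | .read a => a.cost S s
    | .add a b => a.cost S s + b.cost S s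
    | .sub a b => a.cost S s + b.cost S s
    | .mul a b => a.cost S s + b.cost S s
    | .div a b => a.cost S s + b.cost S s
    | .label a => a.cost S s
    | .app a b => a.cost S s + b.cost S s

/-- Write `v` at address `a`. -/
def Config.write (s : Config X) (a v : ℕ) : Config X :=
  { s with mem := Function.update s.mem a v }

/-- Append the point of example number `i` with label `b` to the pending query. -/
def Config.pushQuery (S : Fin n → X × Bool) (s : Config X) (i : ℕ) (b : Bool) : Config X :=
  if h : i < n then { s with query := s.query ++ [((S ⟨i, h⟩).1, b)] } else s

/-- Call the oracle on the pending query, and clear it. -/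
def Config.call (E : ℕ → List (X × Bool) → X → Bool) (s : Config X) : Config X :=
  { s with query := [], concepts := s.concepts ++ [E s.concepts.length s.query] }

/-- Output concept number `k` with weight `w`. -/
def Config.emitOut (s : Config X) (k w : ℕ) : Config X :=
  if h : k < s.concepts.length then { s with out := s.out ++ [(s.concepts[k]'h, w)] } else s

/-- `Exec S E p s s' T`: started in the configuration `s` on the dataset `S` with the oracle `E`, the
program `p` halts in the configuration `s'` after `T` steps. -/
inductive Exec (S : Fin n → X × Bool) (E : ℕ → List (X × Bool) → X → Bool) :
    Prog → Config X → Config X → ℕ → Prop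
  | skip (s) : Exec S E .skip s s 1
  | assign (a v : Expr) (s) :
      Exec S E (.assign a v) s (s.write (a.val S s) (v.val S s)) (1 + a.cost S s + v.cost S s)
  | push (i b : Expr) (s) :
      Exec S E (.push i b) s (s.pushQuery S (i.val S s) (decide (b.val S s ≠ 0)))
        (1 + i.cost S s + b.cost S s)
  | erm (s) : Exec S E .erm s (s.call E) 1
  | emit (k w : Expr) (s) :
      Exec S E (.emit k w) s (s.emitOut (k.val S s) (w.val S s)) (1 + k.cost S s + w.cost S s)
  | seq (p q : Prog) (s₁ s₂ s₃) (T₁ T₂ : ℕ) :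
      Exec S E p s₁ s₂ T₁ → Exec S E q s₂ s₃ T₂ → Exec S E (.seq p q) s₁ s₃ (1 + T₁ + T₂)
  | ite_true (e : Expr) (p q : Prog) (s s') (T : ℕ) :
      e.val S s ≠ 0 → Exec S E p s s' T → Exec S E (.ite e p q) s s' (1 + e.cost S s + T)
  | ite_false (e : Expr) (p q : Prog) (s s') (T : ℕ) :
      e.val S s = 0 → Exec S E q s s' T → Exec S E (.ite e p q) s s' (1 + e.cost S s + T)
  | loop_done (e : Expr) (p : Prog) (s) :
      e.val S s = 0 → Exec S E (.loop e p) s s (1 + e.cost S s)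
  | loop_step (e : Expr) (p : Prog) (s₁ s₂ s₃) (T₁ T₂ : ℕ) :
      e.val S s₁ ≠ 0 → Exec S E p s₁ s₂ T₁ → Exec S E (.loop e p) s₂ s₃ T₂ →
      Exec S E (.loop e p) s₁ s₃ (1 + e.cost S s₁ + T₁ + T₂)

/-- The initial configuration on `n` examples with the input number `q`. -/
def Config.start (X : Type*) (n q : ℕ) : Config X where
  mem a := if a = 0 then n else if a = 1 then q else 0
  query := []
  concepts := []
  out := []

/-- The mixture `μ` of concepts that is described by the output. -/
noncomputable def Config.mixture (s : Config X) (x : X) : ℝ :=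
  (s.out.map fun e => (e.2 : ℝ) * pm (e.1 x)).sum / (s.out.map fun e => (e.2 : ℝ)).sum

end Machine

end RobustLearning

namespace RobustLearning

open Finset

/-! ### Growth of concept classes -/

section Growth

variable {X ι κ : Type*}

/-! The learner is Frank–Wolfe on the empirical average of the potential `primG (μ(x) y)`, where
`primG` is a primitive of `g - 2`. Since `g` is increasing with slope at most 2 on `[-1, 1]`, the
potential is convex and smooth there (`primG_sub_le`, `primG_le_quadratic`). The part of the loss
that depends on `c` is linear in `c`, so `ApproxMax` is an approximate linear maximization. The
inequality `t (2 - g t) ≤ g t` (`mul_two_sub_gMaj_le`) bounds the loss by the Frank–Wolfe gap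
(`loss_le_gap`). Hence the gap exceeds `19 ε' / 20` in every iteration that continues, and the usual
analysis allows only `O(1 / ε')` of them (`LearnIter.le_div`).

When the run stops, the target itself has loss at most `ε'`. A clean example contributes to that
loss four times the probability that the hypothesis errs on it, and any other example contributes at
least `-2`. So the errors on the clean examples sum to at most half the number of corrupted ones, up
to `ε' n / 4` (`sum_pointErr_compl_le`). With nasty noise each erased clean point may cost one more
unit, which gives `3/2`. With malicious noise it suffices to count the uncorrupted rounds, which
gives `1/2` and a division by `1 - η`.

To pass from the sample to the distribution, the hypothesis is written as a mixture of majority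
votes of 7 concepts (`gMaj_mixture`), whose error indicators have growth at most `(e m / d) ^ (7
d)`. For such a class `measure_exists_deviation_le` gives relative uniform convergence by
symmetrization with a second sample, random swaps, and chaining over Hamming nets
(`HasGrowth.card_signs_le`), with packing numbers from `HasGrowth.log_card_le`. The chain starts at
resolution `ε / (α + ε)`, where the multiplicative slack `α` already absorbs the error of
approximation. This is why only `log (2 + α / ε)` is paid.

For the implementation, the step sizes give the concepts of `μ_t` weights proportional to `1, 2, …,
t`, so all quantities are ratios of integers. Rounding the weights `2 - g(μ) y` to multiples of `1 /
(320 q)`, with `q = ⌈1 / ε⌉`, turns the linear maximization into an ERM query with repeated examples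
(`approxMax_of_isERM`). A Hoare-style calculus (`Runs`) verifies the program; its running time is
polynomial in a bound on the memory contents that also bounds the loop counts. -/

/-- The labelings of the points `x` by members of `C`. -/
def traces (C : Set (X → Bool)) (x : ι → X) : Set (ι → Bool) := (fun c i => c (x i)) '' C

/-- As `d / m ≤ 1`, replacing `(d / m) ^ d` by `(d / m) ^ i` for `i ≤ d` only increases terms, and
the result is part of the binomial expansion of `(1 + d / m) ^ m ≤ exp d`. -/
lemma sum_choose_le_exp_pow {m d : ℕ} (hd : 1 ≤ d) (hm : d ≤ m) :
    ∑ i ∈ Iic d, (m.choose i : ℝ) ≤ (Real.exp 1 * m / d) ^ d := by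
  have hd0 : (0 : ℝ) < d := by exact_mod_cast hd
  have hm0 : (0 : ℝ) < m := by exact_mod_cast (hd.trans hm)
  have hle : (d : ℝ) / m ≤ 1 := by
    rw [div_le_one hm0]; exact_mod_cast hm
  have h1 : (∑ i ∈ Iic d, (m.choose i : ℝ)) * (d / m) ^ d ≤ Real.exp d := by
    calc (∑ i ∈ Iic d, (m.choose i : ℝ)) * (d / m) ^ d
        ≤ ∑ i ∈ Iic d, (m.choose i : ℝ) * (d / m) ^ i := by
          rw [sum_mul]
          refine sum_le_sum fun i hi => ?_
          exact mul_le_mul_of_nonneg_left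
            (pow_le_pow_of_le_one (by positivity) hle (mem_Iic.1 hi)) (by positivity)
      _ ≤ ∑ i ∈ range (m + 1), (m.choose i : ℝ) * (d / m) ^ i := by
          refine sum_le_sum_of_subset_of_nonneg (fun i hi => ?_) fun _ _ _ => by positivity
          rw [mem_range]; have := mem_Iic.1 hi; omega
      _ = (d / m + 1) ^ m := by
          rw [add_pow]; exact sum_congr rfl fun i _ => by simp [mul_comm]
      _ ≤ (Real.exp (d / m)) ^ m := by
          gcongr; exact Real.add_one_le_exp _
      _ = Real.exp d := by
          rw [← Real.exp_nat_mul]; congr 1; field_simp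
  have h2 : (Real.exp 1 * m / d) ^ d * ((d : ℝ) / m) ^ d = Real.exp d := by
    rw [← mul_pow]
    have : Real.exp 1 * m / d * (d / m) = Real.exp 1 := by field_simp
    rw [this, ← Real.exp_nat_mul, mul_one]
  rw [← h2] at h1
  exact le_of_mul_le_mul_right h1 (by positivity)

/-- The Sauer–Shelah bound on the number of labelings. -/
lemma HasVCDim.ncard_traces_le {C : Set (X → Bool)} {d : ℕ} (h : HasVCDim C d) (hd : 1 ≤ d)
    {m : ℕ} (hm : d ≤ m) (x : Fin m → X) :
    ((traces C x).ncard : ℝ) ≤ (Real.exp 1 * m / d) ^ d := by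
  classical
  let φ : (Fin m → Bool) → Finset (Fin m) := fun v => univ.filter fun i => v i = true
  have hφ : Function.Injective φ := by
    intro v w hvw
    funext i
    have := congrArg (fun s => i ∈ s) hvw
    simp only [φ, mem_filter, mem_univ, true_and, eq_iff_iff] at this
    cases h1 : v i <;> cases h2 : w i <;> simp_all
  let T : Finset (Fin m → Bool) := (Set.toFinite (traces C x)).toFinset
  let 𝒜 : Finset (Finset (Fin m)) := T.image φ
  have hcard : (traces C x).ncard = 𝒜.card := by
    rw [Set.ncard_eq_toFinset_card _ (Set.toFinite _), card_image_of_injective _ hφ]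
  have hvc : 𝒜.vcDim ≤ d := by
    refine Finset.sup_le fun s hs => ?_
    rw [mem_shatterer] at hs
    have key : ∀ t ⊆ s, ∃ c ∈ C, ∀ i ∈ s, (c (x i) = true ↔ i ∈ t) := by
      intro t ht
      obtain ⟨u, hu, hut⟩ := hs ht
      obtain ⟨v, hv, rfl⟩ := mem_image.1 hu
      obtain ⟨c, hc, rfl⟩ := (Set.Finite.mem_toFinset _).1 hv
      refine ⟨c, hc, fun i hi => ?_⟩
      rw [← hut]; simp [φ, hi]
    -- The points may repeat, but two indices of the same point always get equal labels and cannot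
    -- both lie in a shattered set. So shattered indices give equally many shattered points.
    have hinj : Set.InjOn x s := by
      intro i hi j hj hij
      by_contra hne
      obtain ⟨c, -, hc⟩ := key {i} (by simpa using hi)
      have h1 := hc i hi
      have h2 := hc j hj
      rw [← hij, h1] at h2
      simp only [mem_singleton, true_iff] at h2
      exact hne h2.symm
    refine h.2 ⟨s.image x, card_image_of_injOn hinj, fun f => ?_⟩
    obtain ⟨c, hc, hcf⟩ := key (s.filter fun i => f (x i) = true) (filter_subset _ _)
    refine ⟨c, hc, fun y hy => ?_⟩
    obtain ⟨i, hi, rfl⟩ := mem_image.1 hy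
    have := hcf i hi
    rw [mem_filter] at this
    cases h1 : c (x i) <;> cases h2 : f (x i) <;> simp_all
  have hle : 𝒜.card ≤ ∑ k ∈ Iic d, m.choose k := by
    refine (card_le_card_shatterer 𝒜).trans (card_shatterer_le_sum_vcDim.trans ?_)
    rw [Fintype.card_fin]
    exact sum_le_sum_of_subset (Iic_subset_Iic.2 hvc)
  rw [hcard]
  refine le_trans ?_ (sum_choose_le_exp_pow hd hm)
  exact_mod_cast hle

/-- The number of restrictions of members of `T` to `m` coordinates is at most `(e m / d) ^ (7 d)`. -/
def HasGrowth (T : Finset (κ → Bool)) (d : ℕ) : Prop :=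
  ∀ (m : ℕ) (j : Fin m → κ), d ≤ m →
    ((traces (T : Set (κ → Bool)) j).ncard : ℝ) ≤ (Real.exp 1 * m / d) ^ (7 * d)

lemma HasGrowth.mono {S T : Finset (κ → Bool)} {d : ℕ} (hT : HasGrowth T d) (h : S ⊆ T) :
    HasGrowth S d := by
  intro m j hm
  refine le_trans ?_ (hT m j hm)
  exact_mod_cast Set.ncard_le_ncard (Set.image_mono (by exact_mod_cast h)) (Set.toFinite _)

end Growth

/-! ### Packing numbers -/

section Packing

variable {κ : Type*} [Fintype κ]

lemma card_agree (f g : κ → Bool) (k : ℕ) :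
    (univ.filter fun j : Fin k → κ => ∀ i, f (j i) = g (j i)).card
      = (Fintype.card κ - hammingDist f g) ^ k := by
  classical
  have h1 : (univ.filter fun j : Fin k → κ => ∀ i, f (j i) = g (j i))
      = Fintype.piFinset fun _ : Fin k => univ.filter fun a => f a = g a := by
    ext j; simp [Fintype.mem_piFinset]
  rw [h1, Fintype.card_piFinset]
  simp only [prod_const, card_univ, Fintype.card_fin]
  congr 1
  have := card_filter_add_card_filter_not (s := (univ : Finset κ)) (p := fun a => f a = g a)
  simp only [hammingDist, card_univ, ne_eq] at *
  omega

/-- Random coordinates separate the members of a packing. -/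
lemma exists_separating [Nonempty κ] (T : Finset (κ → Bool)) {r : ℝ} (hr1 : r ≤ 1)
    (hsep : ∀ f ∈ T, ∀ g ∈ T, f ≠ g → r * Fintype.card κ < hammingDist f g) (hT : T.Nonempty) {k : ℕ}
    (hk : 2 * Real.log T.card < r * k) :
    ∃ j : Fin k → κ, Set.InjOn (fun (f : κ → Bool) i => f (j i)) T := by
  classical
  by_contra! hcon
  have hN : (0 : ℝ) < Fintype.card κ := by exact_mod_cast Fintype.card_pos
  have hT0 : (0 : ℝ) < T.card := by exact_mod_cast hT.card_pos
  -- Union bound over pairs: a fixed pair agrees on `k` uniform coordinates with probability at most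
  -- `(1 - r) ^ k ≤ exp (-r k)`, and there are at most `|T| ^ 2` pairs.
  have hcover : (univ : Finset (Fin k → κ)) ⊆
      (T.offDiag).biUnion fun p => univ.filter fun j => ∀ i, p.1 (j i) = p.2 (j i) := by
    intro j _
    have := hcon j
    simp only [Set.InjOn, not_forall] at this
    obtain ⟨f, hf, g, hg, hfg, hne⟩ := this
    simp only [mem_biUnion, mem_offDiag, mem_filter, mem_univ, true_and]
    exact ⟨(f, g), ⟨hf, hg, hne⟩, fun i => congrFun hfg i⟩
  have h1 : ((Fintype.card κ : ℝ)) ^ k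
      ≤ (T.card : ℝ) ^ 2 * ((1 - r) * Fintype.card κ) ^ k := by
    have h2 := (card_le_card hcover).trans card_biUnion_le
    rw [card_univ, Fintype.card_fun, Fintype.card_fin] at h2
    have h3 : ((Fintype.card κ : ℝ)) ^ k ≤ ∑ p ∈ T.offDiag,
        ((univ.filter fun j : Fin k → κ => ∀ i, p.1 (j i) = p.2 (j i)).card : ℝ) := by
      exact_mod_cast h2
    refine h3.trans ?_
    calc _ ≤ ∑ p ∈ T.offDiag, ((1 - r) * Fintype.card κ) ^ k := by
          refine sum_le_sum fun p hp => ?_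
          rw [card_agree, Nat.cast_pow]
          obtain ⟨hf, hg, hne⟩ := mem_offDiag.1 hp
          have h4 := hsep _ hf _ hg hne
          have h5 : hammingDist p.1 p.2 ≤ Fintype.card κ := hammingDist_le_card_fintype
          rw [Nat.cast_sub h5]
          gcongr
          · have : (hammingDist p.1 p.2 : ℝ) ≤ Fintype.card κ := by exact_mod_cast h5
            linarith
          · linarith
      _ ≤ _ := by
          rw [sum_const, nsmul_eq_mul]
          have h6 : ((T.offDiag.card : ℕ) : ℝ) ≤ (T.card : ℝ) ^ 2 := by
            have : T.offDiag.card ≤ T.card ^ 2 := by rw [offDiag_card, sq]; omega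
            exact_mod_cast this
          exact mul_le_mul_of_nonneg_right h6
            (pow_nonneg (mul_nonneg (by linarith) hN.le) _)
  rw [mul_pow, ← mul_assoc] at h1
  have h2 : 1 ≤ (T.card : ℝ) ^ 2 * (1 - r) ^ k := by
    by_contra! hlt
    have := mul_lt_mul_of_pos_right hlt (pow_pos hN k)
    linarith
  have h3 : (1 - r) ^ k ≤ Real.exp (-(r * k)) := by
    calc (1 - r) ^ k ≤ (Real.exp (-r)) ^ k := by
          refine pow_le_pow_left₀ (by linarith) ?_ k
          have := Real.add_one_le_exp (-r)
          linarith
      _ = _ := by rw [← Real.exp_nat_mul]; congr 1; ring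
  have h4 : (T.card : ℝ) ^ 2 = Real.exp (2 * Real.log T.card) := by
    rw [two_mul, Real.exp_add, Real.exp_log hT0, sq]
  have h5 : (T.card : ℝ) ^ 2 * (1 - r) ^ k < 1 := by
    calc _ ≤ Real.exp (2 * Real.log T.card) * Real.exp (-(r * k)) := by
          rw [h4]; gcongr
      _ = Real.exp (2 * Real.log T.card - r * k) := by rw [← Real.exp_add]; rfl
      _ < 1 := by rw [Real.exp_lt_one_iff]; linarith
  linarith

/-- A bound of the form `(C / r) ^ (C d)` on packing numbers. -/
lemma HasGrowth.log_card_le [Nonempty κ] {T : Finset (κ → Bool)} {d : ℕ} (hT : HasGrowth T d)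
    (hd : 1 ≤ d) {r : ℝ} (hr : 0 < r) (hr1 : r ≤ 1) (hne : T.Nonempty)
    (hsep : ∀ f ∈ T, ∀ g ∈ T, f ≠ g → r * Fintype.card κ < hammingDist f g) :
    Real.log T.card ≤ 14 * d * Real.log (80 / r) := by
  classical
  set L := Real.log T.card with hL
  have hT1 : (1 : ℝ) ≤ T.card := by exact_mod_cast hne.card_pos
  have hL0 : 0 ≤ L := Real.log_nonneg hT1
  have hd0 : (1 : ℝ) ≤ d := by exact_mod_cast hd
  have hd1 : (0 : ℝ) < d := by linarith
  set k : ℕ := ⌊2 * L / r⌋₊ + 1 + d with hk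
  have hk1 : 2 * L < r * k := by
    have := Nat.lt_floor_add_one (2 * L / r)
    have h2 : 2 * L / r < k := by rw [hk]; push_cast; linarith
    rw [div_lt_iff₀ hr] at h2; linarith
  have hk2 : (k : ℝ) ≤ 2 * L / r + 1 + d := by
    rw [hk]; push_cast
    have := Nat.floor_le (show 0 ≤ 2 * L / r by positivity)
    linarith
  obtain ⟨j, hj⟩ := exists_separating T hr1 hsep hne hk1
  have h1 := hT k j (by omega)
  have h2 : (traces (T : Set (κ → Bool)) j).ncard = T.card := by
    rw [traces, hj.ncard_image, Set.ncard_coe_finset]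
  rw [h2] at h1
  have hkpos : (0 : ℝ) < k := by
    have : 0 < k := by omega
    exact_mod_cast this
  have h3 : L ≤ 7 * d * Real.log (Real.exp 1 * k / d) := by
    have := Real.log_le_log (by linarith) h1
    rw [Real.log_pow] at this
    push_cast at this
    exact this
  set l := L / d with hl
  have hLl : L = l * d := by rw [hl]; field_simp
  have hl0 : 0 ≤ l := by positivity
  have h4 : Real.exp 1 * k / d ≤ (2 * Real.exp 1 / r) * (14 * ((l + 1) / 14)) := by
    have : (k : ℝ) / d ≤ 2 * (l + 1) / r := by
      rw [div_le_div_iff₀ hd1 hr]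
      have h5 : (2 * L / r + 1 + d) * r = 2 * L + (1 + d) * r := by
          field_simp; ring
      calc (k : ℝ) * r ≤ (2 * L / r + 1 + d) * r := by gcongr
        _ = 2 * L + (1 + d) * r := h5
        _ ≤ 2 * L + (1 + d) * 1 := by gcongr
        _ ≤ 2 * (l + 1) * d := by rw [hLl]; nlinarith
    calc Real.exp 1 * k / d = Real.exp 1 * (k / d) := by ring
      _ ≤ Real.exp 1 * (2 * (l + 1) / r) := by gcongr
      _ = _ := by ring
  have h5 : Real.log (Real.exp 1 * k / d) ≤ Real.log (80 / r) + l / 14 := by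
    -- The self-reference is resolved by scaling with 14: against the exponent `7 d` the term `l /
    -- 14` costs only half of `L`, which moves to the left. The remaining constant is `28 e ≤ 80`.
    have hx : Real.log ((l + 1) / 14) ≤ (l + 1) / 14 - 1 :=
      Real.log_le_sub_one_of_pos (by positivity)
    calc _ ≤ Real.log ((2 * Real.exp 1 / r) * (14 * ((l + 1) / 14))) :=
          Real.log_le_log (by positivity) h4
      _ = Real.log (28 * Real.exp 1 / r) + Real.log ((l + 1) / 14) := by
          rw [← Real.log_mul (by positivity) (by positivity)]; congr 1; ring
      _ ≤ Real.log (80 / r) + l / 14 := by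
          have : Real.log (28 * Real.exp 1 / r) ≤ Real.log (80 / r) := by
            apply Real.log_le_log (by positivity)
            gcongr
            have := Real.exp_one_lt_d9
            linarith
          linarith
  have h6 : l * d ≤ 7 * d * (Real.log (80 / r) + l / 14) := by
    rw [← hLl]; exact h3.trans (by gcongr)
  rw [hLl]
  nlinarith

/-- A separated subset of maximal cardinality is a net, since an uncovered member could be added to
it. -/
lemma exists_hamming_net (T : Finset (κ → Bool)) (ρ : ℝ) (hρ : 0 ≤ ρ) :
    ∃ S ⊆ T, (∀ f ∈ S, ∀ g ∈ S, f ≠ g → ρ < hammingDist f g) ∧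
      ∀ f ∈ T, ∃ g ∈ S, (hammingDist f g : ℝ) ≤ ρ := by
  classical
  let 𝒮 := T.powerset.filter fun S => ∀ f ∈ S, ∀ g ∈ S, f ≠ g → ρ < hammingDist f g
  obtain ⟨S, hS, hmax⟩ := exists_max_image 𝒮 card ⟨∅, by simp [𝒮]⟩
  simp only [𝒮, mem_filter, mem_powerset] at hS hmax
  refine ⟨S, hS.1, hS.2, fun f hf => ?_⟩
  by_contra! hcon
  have hfS : f ∉ S := fun h => by
    have := hcon f h
    simp only [hammingDist_self, Nat.cast_zero] at this
    linarith
  have := hmax (insert f S) ⟨insert_subset hf hS.1, fun a ha b hb hab => ?_⟩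
  · rw [card_insert_of_notMem hfS] at this; omega
  · rcases mem_insert.1 ha with rfl | ha' <;> rcases mem_insert.1 hb with rfl | hb'
    · exact absurd rfl hab
    · exact hcon b hb'
    · rw [hammingDist_comm]; exact hcon a ha'
    · exact hS.2 a ha' b hb' hab

end Packing

/-! ### Random signs -/

section Signs

variable {ι : Type*} [Fintype ι] [DecidableEq ι]

lemma sum_exp_signs (a : ι → ℝ) :
    ∑ s : ι → Bool, Real.exp (∑ i, pm (s i) * a i) = ∏ i, (2 * Real.cosh (a i)) := by
  have h : ∀ i, 2 * Real.cosh (a i) = ∑ b : Bool, Real.exp (pm b * a i) := by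
    intro i
    simp [pm, Real.cosh_eq]
    ring
  simp_rw [h, Real.exp_sum]
  rw [Finset.prod_univ_sum, Fintype.piFinset_univ]

/-- Hoeffding's inequality for random signs. -/
lemma card_signs_le (a : ι → ℝ) {V t E : ℝ} (ht : 0 < t) (hV : ∑ i, a i ^ 2 ≤ V)
    (hE : 2 * V * E ≤ t ^ 2) :
    ((univ.filter fun s : ι → Bool => t ≤ ∑ i, pm (s i) * a i).card : ℝ)
      ≤ 2 ^ Fintype.card ι * Real.exp (-E) := by
  have hV0 : 0 ≤ V := (sum_nonneg fun i _ => sq_nonneg (a i)).trans hV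
  rcases hV0.eq_or_lt with h0 | hVpos
  · have ha : ∀ i, a i = 0 := by
      intro i
      have h1 : a i ^ 2 ≤ ∑ i, a i ^ 2 :=
        single_le_sum (f := fun i => a i ^ 2) (fun i _ => sq_nonneg (a i)) (mem_univ i)
      have h2 : a i ^ 2 = 0 := le_antisymm (by linarith) (sq_nonneg _)
      simpa using h2
    have : (univ.filter fun s : ι → Bool => t ≤ ∑ i, pm (s i) * a i) = ∅ := by
      rw [filter_eq_empty_iff]
      intro s _
      simp [ha, ht]
    rw [this]
    simp only [card_empty, Nat.cast_zero]
    positivity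
  -- Exponential Markov inequality with the optimal parameter `t / V`; the case `V = 0` had to be
  -- split off because of this quotient.
  · have h1 : ((univ.filter fun s : ι → Bool => t ≤ ∑ i, pm (s i) * a i).card : ℝ)
        * Real.exp (t ^ 2 / V) ≤ ∑ s : ι → Bool, Real.exp (∑ i, pm (s i) * (t / V * a i)) := by
      rw [← nsmul_eq_mul, ← sum_const]
      refine le_trans (sum_le_sum fun s hs => ?_)
        (sum_le_sum_of_subset_of_nonneg (filter_subset _ _) fun _ _ _ => (Real.exp_pos _).le)
      rw [mem_filter] at hs
      apply Real.exp_le_exp.2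
      calc t ^ 2 / V = t / V * t := by ring
        _ ≤ t / V * ∑ i, pm (s i) * a i := by gcongr; exact hs.2
        _ = _ := by rw [mul_sum]; exact sum_congr rfl fun i _ => by ring
    rw [sum_exp_signs] at h1
    have h2 : ∏ i, (2 * Real.cosh (t / V * a i)) ≤ 2 ^ Fintype.card ι * Real.exp (t ^ 2 / (2 * V)) := by
      calc _ ≤ ∏ i, (2 * Real.exp ((t / V * a i) ^ 2 / 2)) := by
            refine prod_le_prod (fun i _ => by positivity) fun i _ => ?_
            gcongr; exact Real.cosh_le_exp_half_sq _
        _ = 2 ^ Fintype.card ι * Real.exp (∑ i, (t / V * a i) ^ 2 / 2) := by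
            rw [prod_mul_distrib, Real.exp_sum]; simp
        _ ≤ _ := by
            gcongr
            calc ∑ i, (t / V * a i) ^ 2 / 2 = (t / V) ^ 2 / 2 * ∑ i, a i ^ 2 := by
                  rw [mul_sum]; exact sum_congr rfl fun i _ => by ring
              _ ≤ (t / V) ^ 2 / 2 * V := by gcongr
              _ = _ := by field_simp
    have h3 := h1.trans h2
    have h4 : Real.exp (t ^ 2 / (2 * V)) = Real.exp (-(t ^ 2 / (2 * V))) * Real.exp (t ^ 2 / V) := by
      rw [← Real.exp_add]; congr 1; field_simp; ring
    rw [h4, ← mul_assoc] at h3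
    have h5 := le_of_mul_le_mul_right h3 (Real.exp_pos _)
    refine h5.trans ?_
    gcongr
    rw [le_div_iff₀ (by positivity)]; linarith

end Signs

/-! ### Chaining -/

section Chaining

variable {n : ℕ}

/-- The indicator of `true`. -/
def ind (b : Bool) : ℝ := if b then 1 else 0

/-- The difference between the two halves of a vector of labels. -/
def halfDiff (f : Fin n ⊕ Fin n → Bool) (i : Fin n) : ℝ := ind (f (.inr i)) - ind (f (.inl i))

/-- The number of coordinates that are `true`. -/
def weight (f : Fin n ⊕ Fin n → Bool) : ℝ := ∑ j, ind (f j)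

/-- The difference between the two halves after swapping by the signs `s`. -/
def signedDiff (s : Fin n → Bool) (f : Fin n ⊕ Fin n → Bool) : ℝ := ∑ i, pm (s i) * halfDiff f i

lemma weight_nonneg (f : Fin n ⊕ Fin n → Bool) : 0 ≤ weight f :=
  sum_nonneg fun j _ => by unfold ind; split <;> norm_num

lemma weight_le (f : Fin n ⊕ Fin n → Bool) : weight f ≤ 2 * n := by
  calc weight f ≤ ∑ _j : Fin n ⊕ Fin n, (1 : ℝ) :=
        sum_le_sum fun j _ => by unfold ind; split <;> norm_num
    _ = 2 * n := by simp; ring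

lemma hammingDist_eq_sum (f g : Fin n ⊕ Fin n → Bool) :
    (hammingDist f g : ℝ) = ∑ j, (ind (f j) - ind (g j)) ^ 2 := by
  rw [hammingDist, card_filter]
  push_cast
  refine sum_congr rfl fun j _ => ?_
  cases f j <;> cases g j <;> simp [ind]

lemma weight_le_add_hammingDist (f g : Fin n ⊕ Fin n → Bool) :
    weight g ≤ weight f + hammingDist f g := by
  rw [hammingDist_eq_sum, weight, weight, ← sum_add_distrib]
  refine sum_le_sum fun j _ => ?_
  cases f j <;> cases g j <;> norm_num [ind]

/-- The variance proxy of the swapped difference is controlled by the weight and not merely by `n`.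
This makes a deviation bound relative to the weight possible. -/
lemma sum_halfDiff_sq_le (f : Fin n ⊕ Fin n → Bool) : ∑ i, halfDiff f i ^ 2 ≤ weight f := by
  rw [weight, Fintype.sum_sum_type, ← sum_add_distrib]
  refine sum_le_sum fun i _ => ?_
  unfold halfDiff
  cases f (.inl i) <;> cases f (.inr i) <;> norm_num [ind]

lemma sum_halfDiff_sub_sq_le (f g : Fin n ⊕ Fin n → Bool) :
    ∑ i, (halfDiff f i - halfDiff g i) ^ 2 ≤ 2 * hammingDist f g := by
  rw [hammingDist_eq_sum, Fintype.sum_sum_type, ← sum_add_distrib, mul_sum]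
  refine sum_le_sum fun i _ => ?_
  unfold halfDiff
  nlinarith [sq_nonneg ((ind (f (.inr i)) - ind (g (.inr i))) +
    (ind (f (.inl i)) - ind (g (.inl i))))]

lemma signedDiff_sub (s : Fin n → Bool) (f g : Fin n ⊕ Fin n → Bool) :
    signedDiff s f - signedDiff s g = ∑ i, pm (s i) * (halfDiff f i - halfDiff g i) := by
  rw [signedDiff, signedDiff, ← sum_sub_distrib]
  exact sum_congr rfl fun i _ => by ring

lemma sum_geom_le {q : ℝ} (h0 : 0 ≤ q) (h1 : q ≤ 1 / 2) (m : ℕ) :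
    ∑ k ∈ range m, q ^ (k + 1) ≤ 2 * q := by
  have : ∀ m : ℕ, ∑ k ∈ range m, q ^ (k + 1) + q ^ (m + 1) * 2 ≤ 2 * q := by
    intro m
    induction m with
    | zero => simp; linarith
    | succ m ih =>
      rw [sum_range_succ]
      have : q ^ (m + 1 + 1) ≤ q ^ (m + 1) * (1 / 2) := by
        rw [pow_succ]; gcongr
      linarith
  have h2 := this m
  have : 0 ≤ q ^ (m + 1) := by positivity
  linarith

/-- Members of the scale-`k` nets: a bound on the logarithm of the number of them. -/
lemma log_scale_le {α ε : ℝ} (hα : 0 ≤ α) (hε : 0 < ε) (k : ℕ) :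
    Real.log (80 / (ε / (α + ε) / 16 ^ k)) ≤ 10 * (k + 1) * Real.log (2 + α / ε) := by
  have hx : 0 ≤ α / ε := by positivity
  have hl2 : (1 : ℝ) / 2 ≤ Real.log (2 + α / ε) := by
    have h1 := Real.log_two_gt_d9
    have := Real.log_le_log (by norm_num) (show (2 : ℝ) ≤ 2 + α / ε by linarith)
    linarith
  have h16 : Real.log 16 ≤ 2.8 := by
    have : (16 : ℝ) = 2 ^ 4 := by norm_num
    rw [this, Real.log_pow]
    have := Real.log_two_lt_d9
    push_cast; linarith
  have h80 : Real.log 80 ≤ 4.4 := by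
    have h1 : Real.log ((80 : ℝ) ^ 3) ≤ Real.log ((2 : ℝ) ^ 19) :=
      Real.log_le_log (by positivity) (by norm_num)
    rw [Real.log_pow, Real.log_pow] at h1
    have := Real.log_two_lt_d9
    push_cast at h1
    linarith
  have h1 : 80 / (ε / (α + ε) / 16 ^ k) = 80 * 16 ^ k * (1 + α / ε) := by
    field_simp
    ring
  rw [h1, Real.log_mul (by positivity) (by positivity), Real.log_mul (by positivity) (by positivity),
    Real.log_pow]
  have h2 : Real.log (1 + α / ε) ≤ Real.log (2 + α / ε) :=
    Real.log_le_log (by positivity) (by linarith)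
  have hk : (0 : ℝ) ≤ k := by positivity
  nlinarith

set_option maxHeartbeats 1000000 in
/-- The chaining bound: after random swaps the difference of the two halves is small, relative to the
weight, simultaneously for all members of `T`. -/
lemma HasGrowth.card_signs_le {T : Finset (Fin n ⊕ Fin n → Bool)} {d : ℕ} (hT : HasGrowth T d)
    (hd : 1 ≤ d) (hn : 1 ≤ n) {α ε δ : ℝ} (hα : 0 ≤ α) (hε : 0 < ε) (hδ : 0 < δ) (hδ1 : δ ≤ 1)
    (hL : 10000000 * (d * Real.log (2 + α / ε) + Real.log (1 / δ)) ≤ n * (ε * (α + ε))) :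
    ((univ.filter fun s : Fin n → Bool =>
      ∃ f ∈ T, α / 16 * weight f + ε / 4 * n < signedDiff s f).card : ℝ) ≤ δ / 4 * 2 ^ n := by
  classical
  have : Nonempty (Fin n ⊕ Fin n) := ⟨.inl ⟨0, hn⟩⟩
  rcases T.eq_empty_or_nonempty with rfl | hTne
  · simp; positivity
  have hn0 : (1 : ℝ) ≤ n := by exact_mod_cast hn
  have hnpos : (0 : ℝ) < n := by linarith
  have hcardκ : (Fintype.card (Fin n ⊕ Fin n) : ℝ) = 2 * n := by simp; ring
  set Λ := Real.log (2 + α / ε) with hΛ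
  set D : ℝ := d * Λ with hD
  set L : ℝ := n * (ε * (α + ε)) with hLdef
  -- The resolution of the coarsest net, chosen so that `α ν ≤ ε`: replacing a vector by its net
  -- point changes `α · weight` by at most a multiple of `ε n`.
  set ν : ℝ := ε / (α + ε) with hν
  have hαε : 0 < α + ε := by linarith
  have hν0 : 0 < ν := by positivity
  have hν1 : ν ≤ 1 := by rw [hν, div_le_one hαε]; linarith
  have hΛ2 : (1 : ℝ) / 2 ≤ Λ := by
    have h1 := Real.log_two_gt_d9
    have hx : 0 ≤ α / ε := by positivity
    have := Real.log_le_log (by norm_num) (show (2 : ℝ) ≤ 2 + α / ε by linarith)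
    linarith
  have hd1 : (1 : ℝ) ≤ d := by exact_mod_cast hd
  have hD2 : (1 : ℝ) / 2 ≤ D := by rw [hD]; nlinarith
  have hlδ : 0 ≤ Real.log (1 / δ) := Real.log_nonneg (by rw [le_div_iff₀ hδ]; linarith)
  -- the nets
  have hr0 : ∀ k : ℕ, 0 < ν / 16 ^ k := fun k => by positivity
  have hr1 : ∀ k : ℕ, ν / 16 ^ k ≤ 1 := fun k => by
    rw [div_le_one (by positivity)]; exact hν1.trans (one_le_pow₀ (by norm_num))
  have hnets : ∀ k : ℕ, ∃ S ⊆ T, (∀ f ∈ S, ∀ g ∈ S, f ≠ g →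
      ν / 16 ^ k * Fintype.card (Fin n ⊕ Fin n) < hammingDist f g) ∧
      ∀ f ∈ T, ∃ g ∈ S, (hammingDist f g : ℝ) ≤ ν / 16 ^ k * Fintype.card (Fin n ⊕ Fin n) :=
    fun k => exists_hamming_net T _ (mul_nonneg (hr0 k).le (by positivity))
  choose S hST hSsep hSnet using hnets
  have hScard : ∀ k : ℕ, ((S k).card : ℝ) ≤ Real.exp (140 * (k + 1) * D) := by
    intro k
    have hne : (S k).Nonempty := by
      obtain ⟨f, hf⟩ := hTne
      obtain ⟨g, hg, -⟩ := hSnet k f hf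
      exact ⟨g, hg⟩
    have h1 := (hT.mono (hST k)).log_card_le hd (hr0 k) (hr1 k) hne (hSsep k)
    have h2 := log_scale_le hα hε k
    have hpos : (0 : ℝ) < (S k).card := by exact_mod_cast hne.card_pos
    rw [← Real.log_le_iff_le_exp hpos]
    calc _ ≤ 14 * d * Real.log (80 / (ν / 16 ^ k)) := h1
      _ ≤ 14 * d * (10 * (k + 1) * Λ) := by gcongr
      _ = _ := by rw [hD]; ring
  choose! π hπS hπd using hSnet
  -- the bad events
  let E₀ : Finset (Fin n → Bool) := (S 0).biUnion fun g => univ.filter fun s =>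
    α / 16 * weight g + ε / 16 * n ≤ ∑ i, pm (s i) * halfDiff g i
  -- From one scale to the next the variance falls by a factor 16 and the squared threshold by only
  -- 4. The exponent therefore grows like `4 ^ k`, while the logarithm of the number of pairs grows
  -- linearly in `k`.
  let Ek : ℕ → Finset (Fin n → Bool) := fun k =>
    (((S k) ×ˢ (S (k + 1))).filter fun p =>
      (hammingDist p.2 p.1 : ℝ) ≤ 4 * n * (ν / 16 ^ k)).biUnion fun p => univ.filter fun s =>
    ε / 16 * n * (1 / 2) ^ (k + 1) ≤ ∑ i, pm (s i) * (halfDiff p.2 i - halfDiff p.1 i)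
  -- At scale `m` the radius is below 1, so the net point equals the vector and the chain is finite.
  obtain ⟨m, hm⟩ : ∃ m : ℕ, 2 * n * ν < 16 ^ m := pow_unbounded_of_one_lt _ (by norm_num)
  have hcover : (univ.filter fun s : Fin n → Bool =>
      ∃ f ∈ T, α / 16 * weight f + ε / 4 * n < signedDiff s f) ⊆
      E₀ ∪ (range m).biUnion Ek := by
    intro s hs
    obtain ⟨f, hf, hfs⟩ := (mem_filter.1 hs).2
    by_contra hcon
    simp only [mem_union, not_or, E₀, Ek, mem_biUnion, mem_filter, mem_univ, true_and, not_exists,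
      not_and, not_le, mem_range, mem_product] at hcon
    obtain ⟨hc0, hck⟩ := hcon
    have hb := hc0 _ (hπS 0 f hf)
    have hinc : ∀ k ∈ range m, signedDiff s (π (k + 1) f) - signedDiff s (π k f)
        ≤ ε / 16 * n * (1 / 2) ^ (k + 1) := by
      intro k hk
      rw [signedDiff_sub]
      refine (hck k (mem_range.1 hk) (π k f, π (k + 1) f)
        ⟨⟨hπS k f hf, hπS (k + 1) f hf⟩, ?_⟩).le
      have h1 := hπd k f hf
      have h2 := hπd (k + 1) f hf
      have h3 : (hammingDist (π (k + 1) f) (π k f) : ℝ)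
          ≤ hammingDist f (π (k + 1) f) + hammingDist f (π k f) := by
        have := hammingDist_triangle (π (k + 1) f) f (π k f)
        rw [hammingDist_comm (π (k + 1) f) f] at this
        exact_mod_cast this
      rw [hcardκ] at h1 h2
      have h4 : ν / 16 ^ (k + 1) ≤ ν / 16 ^ k := by
        gcongr
        · norm_num
        · omega
      nlinarith
    have hsum := sum_le_sum hinc
    rw [sum_range_sub (fun k => signedDiff s (π k f)), ← mul_sum] at hsum
    have hgeo := sum_geom_le (q := 1 / 2) (by norm_num) le_rfl m
    have hfm : π m f = f := by
      have h1 := hπd m f hf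
      rw [hcardκ] at h1
      have h2 : (hammingDist f (π m f) : ℝ) < 1 := by
        refine h1.trans_lt ?_
        rw [div_mul_eq_mul_div, div_lt_one (by positivity)]
        linarith
      have h3 : hammingDist f (π m f) = 0 := by
        have : hammingDist f (π m f) < 1 := by exact_mod_cast h2
        omega
      exact (hammingDist_eq_zero.1 h3).symm
    rw [hfm] at hsum
    have hw := weight_le_add_hammingDist f (π 0 f)
    have h0 := hπd 0 f hf
    rw [hcardκ, pow_zero, div_one] at h0
    have hαν : α * ν ≤ ε := by
      rw [hν, mul_div_assoc', div_le_iff₀ hαε]; nlinarith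
    have h5 : α / 16 * weight (π 0 f) ≤ α / 16 * weight f + ε / 8 * n := by
      calc _ ≤ α / 16 * (weight f + ν * (2 * n)) := by gcongr; linarith
        _ = α / 16 * weight f + (α * ν) / 8 * n := by ring
        _ ≤ _ := by gcongr
    have h6 : ε / 16 * n * ∑ k ∈ range m, (1 / 2 : ℝ) ^ (k + 1) ≤ ε / 16 * n * 1 := by
      gcongr; linarith
    have h7 : signedDiff s (π 0 f) < α / 16 * weight (π 0 f) + ε / 16 * n := hb
    linarith
  -- the probabilities of the bad events
  set M : ℝ := L / 16384 - 420 * D with hM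
  have hM10 : 20 * D + Real.log (1 / δ) ≤ M := by
    rw [hM]; linarith
  have hE₀ : (E₀.card : ℝ) ≤ 2 ^ n * Real.exp (-M) := by
    calc (E₀.card : ℝ) ≤ ∑ g ∈ S 0, ((univ.filter fun s : Fin n → Bool =>
            α / 16 * weight g + ε / 16 * n ≤ ∑ i, pm (s i) * halfDiff g i).card : ℝ) := by
          exact_mod_cast card_biUnion_le
      _ ≤ ∑ g ∈ S 0, 2 ^ n * Real.exp (-(L / 1024)) := by
          refine sum_le_sum fun g _ => ?_
          have hw0 := weight_nonneg g
          have hw1 := weight_le g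
          -- The squared threshold contains both `weight · α ε n` and `(ε n) ^ 2`, the latter at
          -- least `weight · ε ^ 2 n / 2` because `weight ≤ 2 n`. Dividing by the variance `weight`
          -- leaves a multiple of `n ε (α + ε)`.
          have := RobustLearning.card_signs_le (halfDiff g) (V := weight g)
            (t := α / 16 * weight g + ε / 16 * n) (E := L / 1024) (by positivity)
            (sum_halfDiff_sq_le g) (by
              have h1 : 0 ≤ (α / 16 * weight g) ^ 2 := sq_nonneg _
              have h2 : ε ^ 2 * n * weight g ≤ ε ^ 2 * n * (2 * n) := by gcongr
              have h3 : 0 ≤ α * ε * n * weight g := by positivity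
              rw [hLdef]
              nlinarith)
          rwa [Fintype.card_fin] at this
      _ ≤ Real.exp (140 * D) * (2 ^ n * Real.exp (-(L / 1024))) := by
          rw [sum_const, nsmul_eq_mul]
          have := hScard 0
          simp only [Nat.cast_zero, zero_add, mul_one] at this
          gcongr
      _ = 2 ^ n * Real.exp (140 * D - L / 1024) := by
          rw [sub_eq_add_neg, Real.exp_add]; ring
      _ ≤ _ := by
          gcongr; rw [hM]; linarith
  have hEk : ∀ k ∈ range m, ((Ek k).card : ℝ) ≤ 2 ^ n * Real.exp (-M) ^ (k + 1) := by
    intro k _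
    calc ((Ek k).card : ℝ) ≤ ∑ p ∈ ((S k) ×ˢ (S (k + 1))).filter fun p =>
            (hammingDist p.2 p.1 : ℝ) ≤ 4 * n * (ν / 16 ^ k),
          ((univ.filter fun s : Fin n → Bool => ε / 16 * n * (1 / 2) ^ (k + 1)
            ≤ ∑ i, pm (s i) * (halfDiff p.2 i - halfDiff p.1 i)).card : ℝ) :=
          (Nat.cast_le.2 card_biUnion_le).trans_eq (Nat.cast_sum _ _)
      _ ≤ ∑ p ∈ ((S k) ×ˢ (S (k + 1))).filter fun p =>
            (hammingDist p.2 p.1 : ℝ) ≤ 4 * n * (ν / 16 ^ k),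
            2 ^ n * Real.exp (-(L * 4 ^ k / 16384)) := by
          refine sum_le_sum fun p hp => ?_
          have hp2 := (mem_filter.1 hp).2
          have := RobustLearning.card_signs_le (fun i => halfDiff p.2 i - halfDiff p.1 i)
            (V := 8 * n * (ν / 16 ^ k))
            (t := ε / 16 * n * (1 / 2) ^ (k + 1)) (E := L * 4 ^ k / 16384) (by positivity)
            ((sum_halfDiff_sub_sq_le p.2 p.1).trans (by linarith)) (by
              apply le_of_eq
              have h16 : (16 : ℝ) ^ k = 4 ^ k * 4 ^ k := by rw [← mul_pow]; norm_num
              have h4 : ((1 / 2 : ℝ) ^ (k + 1)) ^ 2 = 1 / (4 * 4 ^ k) := by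
                rw [← pow_mul, mul_comm (k + 1) 2, pow_mul, pow_succ, div_pow, div_pow]
                norm_num
              rw [mul_pow, mul_pow, h4, hLdef, hν, h16]
              field_simp
              norm_num)
          rwa [Fintype.card_fin] at this
      _ ≤ (Real.exp (140 * (k + 1) * D) * Real.exp (140 * ((k + 1 : ℕ) + 1) * D)) *
            (2 ^ n * Real.exp (-(L * 4 ^ k / 16384))) := by
          rw [sum_const, nsmul_eq_mul]
          gcongr
          refine (Nat.cast_le.2 (card_filter_le _ _)).trans ?_
          rw [card_product]
          push_cast
          have h1 := hScard k
          have h2 := hScard (k + 1)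
          push_cast at h2
          gcongr
      _ = 2 ^ n * Real.exp (140 * (2 * k + 3) * D - L * 4 ^ k / 16384) := by
          rw [← Real.exp_add, mul_left_comm, ← Real.exp_add]
          congr 2
          push_cast
          ring
      _ ≤ 2 ^ n * Real.exp (-M) ^ (k + 1) := by
          rw [← Real.exp_nat_mul]
          gcongr
          -- With this and `140 (2 k + 3) ≤ 420 (k + 1)` the exponent is at most `-(k + 1) M`, so
          -- the bounds over all scales form a geometric series. The constant `420` in `M` is the
          -- case `k = 0`.
          have h4 : (k : ℝ) + 1 ≤ 4 ^ k := by
            have : k + 1 ≤ 4 ^ k := Nat.lt_pow_self (by norm_num)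
            exact_mod_cast this
          have hL0 : 0 ≤ L := by positivity
          have hk0 : (0 : ℝ) ≤ k := by positivity
          have h5 : L * (k + 1) ≤ L * 4 ^ k := by gcongr
          have h6 : 0 ≤ k * D := by positivity
          rw [hM]
          push_cast
          nlinarith
  have hq0 : 0 ≤ Real.exp (-M) := (Real.exp_pos _).le
  have hq : Real.exp (-M) ≤ δ / 12 := by
    calc Real.exp (-M) ≤ Real.exp (Real.log δ + -10) := by
          apply Real.exp_le_exp.2
          rw [one_div, Real.log_inv] at hM10
          linarith
      _ = δ * Real.exp (-10) := by rw [Real.exp_add, Real.exp_log hδ]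
      _ ≤ δ / 12 := by
          rw [div_eq_mul_inv, Real.exp_neg]
          gcongr
          have h1 : (1 : ℝ) + 5 ≤ Real.exp 5 := by linarith [Real.add_one_le_exp (5 : ℝ)]
          have h2 : Real.exp 10 = Real.exp 5 * Real.exp 5 := by rw [← Real.exp_add]; norm_num
          nlinarith
  calc _ ≤ ((E₀ ∪ (range m).biUnion Ek).card : ℝ) := by exact_mod_cast card_le_card hcover
    _ ≤ E₀.card + ∑ k ∈ range m, ((Ek k).card : ℝ) := by
        exact_mod_cast (card_union_le _ _).trans (Nat.add_le_add_left card_biUnion_le _)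
    _ ≤ 2 ^ n * Real.exp (-M) + ∑ k ∈ range m, 2 ^ n * Real.exp (-M) ^ (k + 1) :=
        add_le_add hE₀ (sum_le_sum hEk)
    _ ≤ 2 ^ n * (3 * Real.exp (-M)) := by
        rw [← mul_sum]
        have := sum_geom_le hq0 (by linarith) m
        have h2 : (0 : ℝ) < 2 ^ n := by positivity
        nlinarith
    _ ≤ 2 ^ n * (δ / 4) := by gcongr; linarith
    _ = _ := by ring

end Chaining

open MeasureTheory ProbabilityTheory
open scoped ENNReal

/-! ### Uniform convergence -/

section UniformConvergence

lemma measurePreserving_comp_equiv {Z ι ι' : Type*} [MeasurableSpace Z] [Fintype ι] [Fintype ι']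
    (ν : Measure Z) [SigmaFinite ν] (σ : ι' ≃ ι) :
    MeasurePreserving (fun (z : ι → Z) i => z (σ i))
      (Measure.pi fun _ => ν) (Measure.pi fun _ => ν) where
  measurable := measurable_pi_lambda _ fun i => measurable_pi_apply _
  map_eq := by
    refine (Measure.pi_eq fun s hs => ?_).symm
    have hm : Measurable fun (z : ι → Z) i => z (σ i) :=
      measurable_pi_lambda _ fun i => measurable_pi_apply _
    rw [Measure.map_apply hm (MeasurableSet.univ_pi hs)]
    have : (fun (z : ι → Z) i => z (σ i)) ⁻¹' (Set.univ.pi s)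
        = Set.univ.pi fun i => s (σ.symm i) := by
      ext z
      simp only [Set.mem_preimage, Set.mem_univ_pi]
      exact ⟨fun h i => by simpa using h (σ.symm i), fun h i => by simpa using h (σ i)⟩
    rw [this, Measure.pi_pi]
    exact Fintype.prod_equiv σ.symm _ _ fun i => rfl

lemma measurable_ind {Z : Type*} [MeasurableSpace Z] {f : Z → Bool} (hf : Measurable f) : Measurable fun z => ind (f z) :=
  (measurable_of_finite ind).comp hf

lemma integral_ind {Z : Type*} [MeasurableSpace Z] {ν : Measure Z} {f : Z → Bool} (hf : Measurable f) :
    ∫ z, ind (f z) ∂ν = ν.real {z | f z = true} := by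
  have : (fun z => ind (f z)) = Set.indicator {z | f z = true} 1 := by
    funext z
    simp [ind, Set.indicator]
  rw [this, integral_indicator_one]
  exact hf (measurableSet_singleton true)

variable {Z : Type*} [MeasurableSpace Z] {ν : Measure Z} [IsProbabilityMeasure ν] {n : ℕ}

lemma TraceMeasurable.of_fintype {F : Set (Z → Bool)} (h : TraceMeasurable F ν) {ι : Type*}
    [Fintype ι] (v : ι → Bool) :
    NullMeasurableSet {z : ι → Z | ∃ f ∈ F, ∀ i, f (z i) = v i} (Measure.pi fun _ => ν) := by
  classical
  let e := Fintype.equivFin ι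
  have h1 := (h (Fintype.card ι) fun i => v (e.symm i)).preimage
    (measurePreserving_comp_equiv ν e.symm).quasiMeasurePreserving
  convert h1 using 1
  ext z
  simp only [Set.mem_ofPred_eq, Set.mem_preimage]
  refine exists_congr fun f => and_congr_right fun _ => ?_
  exact ⟨fun h i => h _, fun h i => by simpa using h (e i)⟩

lemma ind_sq (b : Bool) : ind b ^ 2 = ind b := by cases b <;> simp [ind]

lemma ind_nonneg (b : Bool) : 0 ≤ ind b := by cases b <;> simp [ind]

lemma ind_le_one (b : Bool) : ind b ≤ 1 := by cases b <;> simp [ind]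

/-- A lower deviation bound for a single function. -/
lemma half_le_measure_sum_ind {f : Z → Bool} (hf : Measurable f) (hn : 1 ≤ n) {t : ℝ} (ht : 0 < t)
    (hnt : 2 * ν.real {z | f z = true} ≤ n * t ^ 2) :
    1 / 2 ≤ (Measure.pi fun _ : Fin n => ν)
      {z | n * (ν.real {z | f z = true} - t) ≤ ∑ i, ind (f (z i))} := by
  set p := ν.real {z | f z = true} with hp
  set μ : Measure (Fin n → Z) := Measure.pi fun _ : Fin n => ν with hμ
  have hn0 : (0 : ℝ) < n := by exact_mod_cast hn
  have hmeas := measurable_ind hf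
  let Y : Fin n → (Fin n → Z) → ℝ := fun i z => ind (f (z i))
  have hYm : ∀ i, Measurable (Y i) := fun i => hmeas.comp (measurable_pi_apply i)
  have hY2 : ∀ i, MemLp (Y i) 2 μ := fun i => by
    refine MemLp.of_bound (hYm i).aestronglyMeasurable 1 (ae_of_all _ fun z => ?_)
    rw [Real.norm_eq_abs, abs_of_nonneg (ind_nonneg _)]
    exact ind_le_one _
  have hEY : ∀ i, ∫ z, Y i z ∂μ = p := fun i => by
    have h2 : ∫ z, Y i z ∂μ
        = ∫ z, ind (f z) ∂((Measure.pi fun _ : Fin n => ν).map (Function.eval i)) := by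
      rw [integral_map (measurable_pi_apply i).aemeasurable hmeas.aestronglyMeasurable]
    rw [h2, (measurePreserving_eval (fun _ : Fin n => ν) i).map_eq, integral_ind hf]
  have hVY : ∀ i, variance (Y i) μ ≤ p := fun i => by
    refine (variance_le_expectation_sq (hYm i).aestronglyMeasurable).trans_eq ?_
    rw [← hEY i]
    congr 1
    funext z
    exact ind_sq _
  have hindep : iIndepFun Y μ := iIndepFun_pi fun i => hmeas.aemeasurable
  have hVX : variance (∑ i, Y i) μ ≤ n * p := by
    rw [IndepFun.variance_sum (fun i _ => hY2 i) fun i _ j _ hij => hindep.indepFun hij]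
    calc _ ≤ ∑ _i : Fin n, p := sum_le_sum fun i _ => hVY i
      _ = n * p := by simp
  have hEX : ∫ z, (∑ i, Y i) z ∂μ = n * p := by
    simp only [Finset.sum_apply]
    rw [integral_finsetSum _ fun i _ => (hY2 i).integrable (by norm_num)]
    simp [hEY]
  have hX2 : MemLp (∑ i, Y i) 2 μ := memLp_finsetSum' _ fun i _ => hY2 i
  have hcheb := meas_ge_le_variance_div_sq hX2 (c := n * t) (by positivity)
  rw [hEX] at hcheb
  have hbad : μ {z | n * t ≤ |(∑ i, Y i) z - n * p|} ≤ 1 / 2 := by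
    refine hcheb.trans ?_
    have : (1 / 2 : ℝ≥0∞) = ENNReal.ofReal (1 / 2) := by
      rw [ENNReal.ofReal_div_of_pos (by norm_num)]; simp
    rw [this]
    apply ENNReal.ofReal_le_ofReal
    rw [div_le_div_iff₀ (by positivity) (by norm_num)]
    nlinarith
  have hcov : (Set.univ : Set (Fin n → Z)) ⊆
      {z | n * (p - t) ≤ ∑ i, ind (f (z i))} ∪ {z | n * t ≤ |(∑ i, Y i) z - n * p|} := by
    intro z _
    by_contra hcon
    simp only [Set.mem_union, Set.mem_ofPred_eq, not_or, not_le] at hcon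
    obtain ⟨h1, h2⟩ := hcon
    have h3 := (abs_lt.1 h2).1
    simp only [Finset.sum_apply, Y] at h3
    linarith
  have h1 : (1 : ℝ≥0∞) ≤ μ {z | n * (p - t) ≤ ∑ i, ind (f (z i))} + 1 / 2 := by
    calc (1 : ℝ≥0∞) = μ Set.univ := by simp
      _ ≤ _ := measure_mono hcov
      _ ≤ _ := measure_union_le _ _
      _ ≤ _ := by gcongr
  have h2 : (1 : ℝ≥0∞) = 1 / 2 + 1 / 2 := by simp [ENNReal.inv_two_add_inv_two]
  exact (ENNReal.add_le_add_iff_right (by simp : (1 / 2 : ℝ≥0∞) ≠ ∞)).1 (h2 ▸ h1)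

/-- Swap the two copies of the coordinate `i` if `s i = false`. -/
def swapFun (s : Fin n → Bool) : Fin n ⊕ Fin n → Fin n ⊕ Fin n
  | .inl i => if s i then .inl i else .inr i
  | .inr i => if s i then .inr i else .inl i

lemma swapFun_involutive (s : Fin n → Bool) : Function.Involutive (swapFun s) := by
  rintro (i | i) <;> cases h : s i <;> simp [swapFun, h]

/-- Exchanging the two copies of a coordinate flips the sign of its contribution; the weight is
unaffected. Thus swaps of the double sample become the random signs of the chaining bound. -/
lemma halfDiff_swap (s : Fin n → Bool) (f : Fin n ⊕ Fin n → Bool) :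
    ∑ i, halfDiff (fun j => f (swapFun s j)) i = signedDiff s f := by
  refine sum_congr rfl fun i _ => ?_
  cases h : s i <;> simp [halfDiff, swapFun, h, pm]

lemma weight_swap (s : Fin n → Bool) (f : Fin n ⊕ Fin n → Bool) :
    weight (fun j => f (swapFun s j)) = weight f :=
  Fintype.sum_equiv (swapFun_involutive s).toPerm _ _ fun _ => rfl

/-- `F` has at most `(e m / d) ^ (7 d)` labelings of `m ≥ d` points. -/
def PolyTraces {Z : Type*} (F : Set (Z → Bool)) (d : ℕ) : Prop :=
  ∀ (m : ℕ) (z : Fin m → Z), d ≤ m →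
    ((traces F z).ncard : ℝ) ≤ (Real.exp 1 * m / d) ^ (7 * d)

lemma PolyTraces.hasGrowth {Z : Type*} {F : Set (Z → Bool)} {d : ℕ} (hG : PolyTraces F d) {κ : Type*} [Finite κ]
    (z : κ → Z) : HasGrowth (Set.toFinite (traces F z)).toFinset d := by
  intro m j hm
  have : traces ((Set.toFinite (traces F z)).toFinset : Set (κ → Bool)) j
      = traces F fun i => z (j i) := by
    rw [Set.Finite.coe_toFinset, traces, traces, traces, Set.image_image]
  rw [this]
  exact hG m _ hm

/-- The bound for a double sample. -/
lemma measure_double_sample_le {F : Set (Z → Bool)} {d : ℕ} (hd : 1 ≤ d) (hn : 1 ≤ n)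
    (hTr : TraceMeasurable F ν) (hG : PolyTraces F d)
    {α ε δ : ℝ} (hα : 0 ≤ α) (hε : 0 < ε) (hδ : 0 < δ) (hδ1 : δ ≤ 1)
    (hL : 10000000 * (d * Real.log (2 + α / ε) + Real.log (1 / δ)) ≤ n * (ε * (α + ε))) :
    NullMeasurableSet {z : Fin n ⊕ Fin n → Z | ∃ f ∈ F, α / 16 * weight (fun j => f (z j)) + ε / 4 * n
        < ∑ i, halfDiff (fun j => f (z j)) i} (Measure.pi fun _ => ν) ∧
    (Measure.pi fun _ => ν) {z : Fin n ⊕ Fin n → Z | ∃ f ∈ F, α / 16 * weight (fun j => f (z j)) + ε / 4 * n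
        < ∑ i, halfDiff (fun j => f (z j)) i} ≤ ENNReal.ofReal (δ / 4) := by
  classical
  set B := {z : Fin n ⊕ Fin n → Z | ∃ f ∈ F, α / 16 * weight (fun j => f (z j)) + ε / 4 * n
        < ∑ i, halfDiff (fun j => f (z j)) i} with hB
  set μ : Measure (Fin n ⊕ Fin n → Z) := Measure.pi fun _ => ν with hμ
  have hBm : NullMeasurableSet B μ := by
    -- The event depends only on which labelings of the double sample are realized, so it is a
    -- finite union of the events in the measurability proviso.
    have : B = ⋃ v ∈ {v : Fin n ⊕ Fin n → Bool | α / 16 * weight v + ε / 4 * n < ∑ i, halfDiff v i},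
        {z | ∃ f ∈ F, ∀ j, f (z j) = v j} := by
      ext z
      simp only [hB, Set.mem_ofPred_eq, Set.mem_iUnion, exists_prop]
      constructor
      · rintro ⟨f, hf, h⟩
        exact ⟨fun j => f (z j), h, f, hf, fun j => rfl⟩
      · rintro ⟨v, h, f, hf, hfv⟩
        have : v = fun j => f (z j) := funext fun j => (hfv j).symm
        subst this
        exact ⟨f, hf, h⟩
    rw [this]
    exact NullMeasurableSet.biUnion (Set.to_countable _) fun v _ => hTr.of_fintype v
  refine ⟨hBm, ?_⟩
  have hmp : ∀ s : Fin n → Bool, MeasurePreserving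
      (fun (z : Fin n ⊕ Fin n → Z) j => z (swapFun s j)) μ μ :=
    fun s => measurePreserving_comp_equiv ν (swapFun_involutive s).toPerm
  have hpre : ∀ s : Fin n → Bool, NullMeasurableSet
      ((fun (z : Fin n ⊕ Fin n → Z) j => z (swapFun s j)) ⁻¹' B) μ :=
    fun s => hBm.preimage (hmp s).quasiMeasurePreserving
  -- For a fixed double sample this is a purely combinatorial count over swaps. Integrating it
  -- bounds the measure of `B`, because every swap preserves the product measure.
  have hcount : ∀ z : Fin n ⊕ Fin n → Z,
      ∑ s : Fin n → Bool, Set.indicator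
        ((fun (z : Fin n ⊕ Fin n → Z) j => z (swapFun s j)) ⁻¹' B) (fun _ => (1 : ℝ≥0∞)) z
      ≤ 2 ^ n * ENNReal.ofReal (δ / 4) := by
    intro z
    have h1 := (hG.hasGrowth z).card_signs_le hd hn hα hε hδ hδ1 hL
    have h2 : ∑ s : Fin n → Bool, Set.indicator
        ((fun (z : Fin n ⊕ Fin n → Z) j => z (swapFun s j)) ⁻¹' B) (fun _ => (1 : ℝ≥0∞)) z
        = ((univ.filter fun s : Fin n → Bool => ∃ f ∈ (Set.toFinite (traces F z)).toFinset,
          α / 16 * weight f + ε / 4 * n < signedDiff s f).card : ℝ≥0∞) := by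
      rw [card_filter, Nat.cast_sum]
      refine sum_congr rfl fun s _ => ?_
      rw [Set.indicator_apply]
      have hiff : z ∈ ((fun (z : Fin n ⊕ Fin n → Z) j => z (swapFun s j)) ⁻¹' B) ↔
          ∃ f ∈ (Set.toFinite (traces F z)).toFinset,
            α / 16 * weight f + ε / 4 * n < signedDiff s f := by
        simp only [Set.mem_preimage, hB, Set.mem_ofPred_eq, Set.Finite.mem_toFinset, traces,
          Set.mem_image, exists_exists_and_eq_and]
        refine exists_congr fun f => and_congr_right fun _ => ?_
        rw [weight_swap s fun j => f (z j), halfDiff_swap s fun j => f (z j)]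
      simp only [hiff]
      split_ifs <;> simp
    rw [h2]
    have h3 : (2 : ℝ≥0∞) ^ n * ENNReal.ofReal (δ / 4) = ENNReal.ofReal (δ / 4 * 2 ^ n) := by
      rw [mul_comm, ENNReal.ofReal_mul (by positivity), ENNReal.ofReal_pow (by norm_num)]
      simp
    rw [h3, ← ENNReal.ofReal_natCast]
    exact ENNReal.ofReal_le_ofReal h1
  have hfinal : (2 : ℝ≥0∞) ^ n * μ B ≤ 2 ^ n * ENNReal.ofReal (δ / 4) := by
    calc (2 : ℝ≥0∞) ^ n * μ B = ∑ s : Fin n → Bool, μ B := by simp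
      _ = ∑ s : Fin n → Bool, ∫⁻ z, Set.indicator
          ((fun (z : Fin n ⊕ Fin n → Z) j => z (swapFun s j)) ⁻¹' B) (fun _ => (1 : ℝ≥0∞)) z ∂μ := by
        refine sum_congr rfl fun s _ => ?_
        rw [lintegral_indicator_const₀ (hpre s), one_mul, (hmp s).measure_preimage hBm]
      _ = ∫⁻ z, ∑ s : Fin n → Bool, Set.indicator
          ((fun (z : Fin n ⊕ Fin n → Z) j => z (swapFun s j)) ⁻¹' B) (fun _ => (1 : ℝ≥0∞)) z ∂μ := by
        rw [lintegral_finsetSum' _ fun s _ => aemeasurable_const.indicator₀ (hpre s)]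
      _ ≤ ∫⁻ _z, 2 ^ n * ENNReal.ofReal (δ / 4) ∂μ := lintegral_mono hcount
      _ = 2 ^ n * ENNReal.ofReal (δ / 4) := by simp
  exact (ENNReal.mul_le_mul_iff_right (by simp) (by simp)).1 hfinal

/-- One-sided relative uniform convergence with the optimal sample size. -/
theorem measure_exists_deviation_le {F : Set (Z → Bool)} {d : ℕ} (hd : 1 ≤ d) (hn : 1 ≤ n)
    (hF : ∀ f ∈ F, Measurable f) (hTr : TraceMeasurable F ν) (hG : PolyTraces F d)
    {α ε δ : ℝ} (hα : 0 ≤ α) (hα1 : α ≤ 1) (hε : 0 < ε) (hδ : 0 < δ) (hδ1 : δ ≤ 1)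
    (hL : 10000000 * (d * Real.log (2 + α / ε) + Real.log (1 / δ)) ≤ n * (ε * (α + ε))) :
    (Measure.pi fun _ : Fin n => ν) {z | ∃ f ∈ F,
      (1 + α) * ∑ i, ind (f (z i)) + ε * n < ν.real {z | f z = true} * n}
      ≤ ENNReal.ofReal (δ / 2) := by
  obtain ⟨hBm, hBle⟩ := measure_double_sample_le (ν := ν) hd hn hTr hG hα hε hδ hδ1 hL
  set B := {z : Fin n ⊕ Fin n → Z | ∃ f ∈ F, α / 16 * weight (fun j => f (z j)) + ε / 4 * n
        < ∑ i, halfDiff (fun j => f (z j)) i} with hB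
  set μ : Measure (Fin n → Z) := Measure.pi fun _ => ν with hμ
  have hn0 : (0 : ℝ) < n := by exact_mod_cast hn
  let e := MeasurableEquiv.sumPiEquivProdPi fun _ : Fin n ⊕ Fin n => Z
  have hmp : MeasurePreserving e.symm (μ.prod μ) (Measure.pi fun _ => ν) :=
    measurePreserving_sumPiEquivProdPi_symm fun _ : Fin n ⊕ Fin n => ν
  -- Tonelli and Markov are applied to a measurable hull of the double-sample event. The deviation
  -- event of the single sample is only contained in a measurable set; its own measurability is
  -- never needed.
  set Bt := toMeasurable (Measure.pi fun _ => ν) B with hBt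
  have hBtm : MeasurableSet Bt := measurableSet_toMeasurable _ _
  set G := e.symm ⁻¹' Bt with hGdef
  have hGm : MeasurableSet G := e.symm.measurable hBtm
  have hGle : (μ.prod μ) G ≤ ENNReal.ofReal (δ / 4) := by
    rw [hGdef, hmp.measure_preimage hBtm.nullMeasurableSet, hBt, measure_toMeasurable]
    exact hBle
  have hsub : {z : Fin n → Z | ∃ f ∈ F,
      (1 + α) * ∑ i, ind (f (z i)) + ε * n < ν.real {z | f z = true} * n}
      ⊆ {z | 1 / 2 ≤ μ (Prod.mk z ⁻¹' G)} := by
    rintro z ⟨f, hf, hz⟩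
    set p := ν.real {z | f z = true} with hp
    have hp0 : 0 ≤ p := measureReal_nonneg
    have hp1 : p ≤ 1 := measureReal_le_one
    -- The tolerance for the second sample. Chebyshev needs `128 p ≤ n (α p + ε) ^ 2`, which follows
    -- from `p ε (α + ε) ≤ (α p + ε) ^ 2`, valid as `p ≤ 1`.
    have ht : 0 < (α * p + ε) / 8 := by positivity
    have hL2 : 128 ≤ n * (ε * (α + ε)) := by
      have h1 := Real.log_two_gt_d9
      have hx : 0 ≤ α / ε := by positivity
      have h2 := Real.log_le_log (by norm_num) (show (2 : ℝ) ≤ 2 + α / ε by linarith)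
      have h3 : (1 : ℝ) ≤ d := by exact_mod_cast hd
      have h4 : 0 ≤ Real.log (1 / δ) := Real.log_nonneg (by rw [le_div_iff₀ hδ]; linarith)
      nlinarith
    have h1 := half_le_measure_sum_ind (n := n) (hF f hf) hn ht (by
      have h5 : p * (ε * (α + ε)) ≤ (α * p + ε) ^ 2 := by
        have : 0 ≤ α * p * ε := by positivity
        nlinarith [sq_nonneg (α * p), sq_nonneg ε]
      have h6 : 128 * p ≤ n * (p * (ε * (α + ε))) := by nlinarith
      have h7 : n * (p * (ε * (α + ε))) ≤ n * (α * p + ε) ^ 2 := by gcongr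
      rw [← hp]
      nlinarith)
    refine h1.trans (measure_mono fun z' hz' => ?_)
    simp only [Set.mem_ofPred_eq] at hz'
    rw [← hp] at hz'
    refine subset_toMeasurable _ _ ⟨f, hf, ?_⟩
    have hw : weight (fun j => f (e.symm (z, z') j))
        = ∑ i, ind (f (z i)) + ∑ i, ind (f (z' i)) := by
      rw [weight, Fintype.sum_sum_type]; rfl
    have hh : ∑ i, halfDiff (fun j => f (e.symm (z, z') j)) i
        = ∑ i, ind (f (z' i)) - ∑ i, ind (f (z i)) := by
      rw [← sum_sub_distrib]; rfl
    rw [hw, hh]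
    set P := ∑ i, ind (f (z i)) with hP
    set P' := ∑ i, ind (f (z' i)) with hP'
    have hP0 : 0 ≤ P := sum_nonneg fun i _ => ind_nonneg _
    have hpε : ε * n < p * n := by nlinarith
    have h8 : (1 + α / 16) * P ≤ (1 - 15 * α / 32) * ((p - ε) * n) := by
      -- The difference of the two sides is `15 α (1 - α) / 32`.
      have h9 : (1 + α / 16) ≤ (1 - 15 * α / 32) * (1 + α) := by nlinarith
      calc (1 + α / 16) * P ≤ (1 - 15 * α / 32) * (1 + α) * P := by gcongr
        _ = (1 - 15 * α / 32) * ((1 + α) * P) := by ring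
        _ ≤ _ := by
          apply mul_le_mul_of_nonneg_left _ (by linarith)
          linarith
    have h10 : (1 - α / 16) * (n * (p - (α * p + ε) / 8)) ≤ (1 - α / 16) * P' := by
      apply mul_le_mul_of_nonneg_left hz' (by linarith)
    have h11 : (1 - 3 * α / 16) * (p * n) - ε / 8 * n ≤ (1 - α / 16) * (n * (p - (α * p + ε) / 8)) := by
      have : 0 ≤ α * α * p * n := by positivity
      have : 0 ≤ α * ε * n := by positivity
      nlinarith
    have h12 : 0 ≤ α * (p * n) := by positivity
    have h13 : α * (ε * n) ≤ 1 * (ε * n) := by gcongr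
    have h14 : 0 < ε * n := by positivity
    nlinarith
  calc μ _ ≤ μ {z | 1 / 2 ≤ μ (Prod.mk z ⁻¹' G)} := measure_mono hsub
    _ = 2 * (1 / 2 * μ {z | 1 / 2 ≤ μ (Prod.mk z ⁻¹' G)}) := by
        rw [← mul_assoc, one_div, ENNReal.mul_inv_cancel (by simp) (by simp), one_mul]
    _ ≤ 2 * ∫⁻ z, μ (Prod.mk z ⁻¹' G) ∂μ := by
        gcongr
        exact mul_meas_ge_le_lintegral (measurable_measure_prodMk_left hGm) _
    _ = 2 * (μ.prod μ) G := by rw [Measure.prod_apply hGm]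
    _ ≤ 2 * ENNReal.ofReal (δ / 4) := by gcongr
    _ = ENNReal.ofReal (δ / 2) := by
        have : (2 : ℝ≥0∞) = ENNReal.ofReal 2 := by simp
        rw [this, ← ENNReal.ofReal_mul (by norm_num)]
        congr 1; ring

end UniformConvergence

/-! ### The function `g` -/

section GMaj

lemma pm_mul_self (b : Bool) : pm b * pm b = 1 := by cases b <;> simp [pm]

lemma pm_mem (b : Bool) : pm b ∈ Set.Icc (-1 : ℝ) 1 := by cases b <;> norm_num [pm]

/-- `𝔼 [sign (a + z₁ + ⋯ + z_k)]`. -/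
noncomputable def offsetMaj (k : ℕ) (t a : ℝ) : ℝ :=
  ∑ z : Fin k → Bool, (∏ i, (1 + t * pm (z i)) / 2) * (if 0 ≤ a + ∑ i, pm (z i) then 1 else -1)

lemma offsetMaj_zero (t a : ℝ) : offsetMaj 0 t a = if 0 ≤ a then 1 else -1 := by
  simp [offsetMaj]

/-- Conditioning on the first label. The recursion evaluates the seven-fold vote as a polynomial
without expanding all 128 sign patterns. -/
lemma offsetMaj_succ (k : ℕ) (t a : ℝ) :
    offsetMaj (k + 1) t a
      = (1 + t) / 2 * offsetMaj k t (a + 1) + (1 - t) / 2 * offsetMaj k t (a - 1) := by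
  unfold offsetMaj
  rw [← (Fin.consEquiv fun _ : Fin (k + 1) => Bool).sum_comp, Fintype.sum_prod_type]
  simp only [Fintype.univ_bool, mem_singleton, Bool.true_eq_false, not_false_eq_true,
    sum_insert, sum_singleton, Fin.consEquiv_apply, Fin.prod_univ_succ, Fin.sum_univ_succ,
    Fin.cons_zero, Fin.cons_succ, mul_sum]
  congr 1
  · refine sum_congr rfl fun z _ => ?_
    have h1 : pm true = 1 := by simp [pm]
    rw [h1, mul_one, mul_assoc]
    simp only [add_assoc]
  · refine sum_congr rfl fun z _ => ?_
    have h1 : pm false = -1 := by simp [pm]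
    rw [h1, mul_neg_one, mul_assoc, ← sub_eq_add_neg]
    simp only [← add_assoc, ← sub_eq_add_neg]

lemma majMean_seven (t : ℝ) :
    majMean 7 t = (35 * t - 35 * t ^ 3 + 21 * t ^ 5 - 5 * t ^ 7) / 16 := by
  have h : majMean 7 t = offsetMaj 7 t 0 := by simp [majMean, offsetMaj]
  rw [h]
  simp only [offsetMaj_succ, offsetMaj_zero]
  norm_num
  ring

lemma gMaj_eq (t : ℝ) :
    gMaj t = (38 * t - 35 * t ^ 3 + 21 * t ^ 5 - 5 * t ^ 7) / 19 := by
  rw [gMaj, majMean_seven]; ring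

lemma gMaj_mul_pm (t : ℝ) (b : Bool) : gMaj (t * pm b) = gMaj t * pm b := by
  cases b <;> (simp [pm, gMaj_eq]; try ring)

lemma hasDerivAt_gMaj (t : ℝ) :
    HasDerivAt gMaj ((38 - 105 * t ^ 2 + 105 * t ^ 4 - 35 * t ^ 6) / 19) t := by
  have h : gMaj = fun t => (38 * t - 35 * t ^ 3 + 21 * t ^ 5 - 5 * t ^ 7) / 19 := funext gMaj_eq
  rw [h]
  have h1 := hasDerivAt_id' t
  have := ((((h1.const_mul 38).sub ((h1.pow 3).const_mul 35)).add ((h1.pow 5).const_mul 21)).sub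
    ((h1.pow 7).const_mul 5)).div_const 19
  exact this.congr_deriv (by norm_num; ring)

/-- The derivative is `(35 (1 - t ^ 2) ^ 3 + 3) / 19`. Monotonicity of `g` is convexity of the
potential. -/
lemma monotoneOn_gMaj : MonotoneOn gMaj (Set.Icc (-1) 1) := by
  refine monotoneOn_of_deriv_nonneg (convex_Icc _ _)
    (fun t _ => (hasDerivAt_gMaj t).continuousAt.continuousWithinAt)
    (fun t _ => (hasDerivAt_gMaj t).differentiableAt.differentiableWithinAt) fun t ht => ?_
  rw [interior_Icc, Set.mem_Ioo] at ht
  rw [(hasDerivAt_gMaj t).deriv]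
  have h1 : 0 ≤ 1 - t ^ 2 := by nlinarith
  have h2 : 0 ≤ (1 - t ^ 2) ^ 3 := by positivity
  apply div_nonneg _ (by norm_num)
  nlinarith

/-- The slope of `g` is largest at 0, where it equals 2; the weights `16/19` and `3/19` are tuned to
this value. The bound on the slope is smoothness of the potential. -/
lemma monotoneOn_two_mul_sub_gMaj : MonotoneOn (fun t => 2 * t - gMaj t) (Set.Icc (-1) 1) := by
  have hd : ∀ t, HasDerivAt (fun t => 2 * t - gMaj t)
      (2 * 1 - (38 - 105 * t ^ 2 + 105 * t ^ 4 - 35 * t ^ 6) / 19) t :=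
    fun t => ((hasDerivAt_id' t).const_mul 2).sub (hasDerivAt_gMaj t)
  refine monotoneOn_of_deriv_nonneg (convex_Icc _ _)
    (fun t _ => (hd t).continuousAt.continuousWithinAt)
    (fun t _ => (hd t).differentiableAt.differentiableWithinAt) fun t ht => ?_
  rw [interior_Icc, Set.mem_Ioo] at ht
  rw [(hd t).deriv]
  have h1 : 0 ≤ 1 - t ^ 2 := by nlinarith
  have h2 : 0 ≤ t ^ 2 := sq_nonneg t
  have h3 : 0 ≤ t ^ 2 * ((1 - t ^ 2) ^ 2 * 35 + 35 * (1 - t ^ 2) + 35) := by positivity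
  nlinarith

lemma gMaj_mem {t : ℝ} (ht : t ∈ Set.Icc (-1 : ℝ) 1) : gMaj t ∈ Set.Icc (-1 : ℝ) 1 := by
  have h1 : gMaj 1 = 1 := by rw [gMaj_eq]; norm_num
  have h2 : gMaj (-1) = -1 := by rw [gMaj_eq]; norm_num
  constructor
  · rw [← h2]; exact monotoneOn_gMaj (by norm_num) ht ht.1
  · rw [← h1]; exact monotoneOn_gMaj ht (by norm_num) ht.2

/-- Both sides vanish at 0, and since the inequality holds on both sides of 0 it forces `g' 0 = 2`;
this explains the factor `t ^ 2` below. There is also equality at `t = 1`, and the remaining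
cofactor is nonnegative on the interval. -/
lemma mul_two_sub_gMaj_le {t : ℝ} (ht : t ∈ Set.Icc (-1 : ℝ) 1) : t * (2 - gMaj t) ≤ gMaj t := by
  obtain ⟨h1, h2⟩ := ht
  have key : gMaj t - t * (2 - gMaj t) = t ^ 2 * ((1 - t) *
      (38 + 3 * t - 32 * t ^ 2 - 11 * t ^ 3 + 10 * t ^ 4 + 5 * t ^ 5)) / 19 := by
    rw [gMaj_eq]; ring
  have hpos : 0 ≤ 38 + 3 * t - 32 * t ^ 2 - 11 * t ^ 3 + 10 * t ^ 4 + 5 * t ^ 5 := by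
    have e : 38 + 3 * t - 32 * t ^ 2 - 11 * t ^ 3 + 10 * t ^ 4 + 5 * t ^ 5
        = 10 * (1 - t ^ 2) ^ 2 + 12 * (1 - t ^ 2) + 16 + 3 * t - 11 * t ^ 3 + 5 * t ^ 5 := by ring
    have hs : 0 ≤ 1 - t ^ 2 := by nlinarith
    have hs1 : 1 - t ^ 2 ≤ 1 := by nlinarith [sq_nonneg t]
    have e2 : 3 * t - 11 * t ^ 3 + 5 * t ^ 5 = t * (-3 + (1 - t ^ 2) + 5 * (1 - t ^ 2) ^ 2) := by ring
    have h3 : |t * (-3 + (1 - t ^ 2) + 5 * (1 - t ^ 2) ^ 2)| ≤ 1 * (3 + 1 + 5) := by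
      rw [abs_mul]
      apply mul_le_mul (abs_le.2 ⟨h1, h2⟩) _ (abs_nonneg _) (by norm_num)
      rw [abs_le]
      constructor <;> nlinarith
    have h4 := (abs_le.1 h3).1
    have h5 : 0 ≤ 10 * (1 - t ^ 2) ^ 2 := by positivity
    linarith
  have : 0 ≤ gMaj t - t * (2 - gMaj t) := by
    rw [key]
    have : 0 ≤ 1 - t := by linarith
    positivity
  linarith

/-- The potential: a primitive of `g(t) - 2`. -/
noncomputable def primG (t : ℝ) : ℝ :=
  (19 * t ^ 2 - 35 / 4 * t ^ 4 + 21 / 6 * t ^ 6 - 5 / 8 * t ^ 8) / 19 - 2 * t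

lemma hasDerivAt_primG (t : ℝ) : HasDerivAt primG (gMaj t - 2) t := by
  have h1 := hasDerivAt_id' t
  have := (((((h1.pow 2).const_mul 19).sub ((h1.pow 4).const_mul (35 / 4))).add
    ((h1.pow 6).const_mul (21 / 6))).sub ((h1.pow 8).const_mul (5 / 8))).div_const 19 |>.sub
    (h1.const_mul 2)
  have h2 := this.congr_deriv (show _ = gMaj t - 2 by rw [gMaj_eq]; norm_num; ring)
  exact h2

/-- Mean value theorem. It is applied to the potential for convexity, and to `t ^ 2` minus the
potential for smoothness. -/
lemma tangent_le_of_monotoneOn {f f' : ℝ → ℝ} {l u : ℝ} (hf : ∀ t, HasDerivAt f (f' t) t)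
    (hm : MonotoneOn f' (Set.Icc l u)) {a b : ℝ} (ha : a ∈ Set.Icc l u) (hb : b ∈ Set.Icc l u) :
    f a + f' a * (b - a) ≤ f b := by
  rcases lt_trichotomy a b with h | h | h
  · obtain ⟨ξ, hξ, he⟩ := exists_hasDerivAt_eq_slope f f' h
      (fun t _ => (hf t).continuousAt.continuousWithinAt) fun t _ => hf t
    have h1 := hm ha ⟨ha.1.trans hξ.1.le, hξ.2.le.trans hb.2⟩ hξ.1.le
    have h2 : 0 < b - a := by linarith
    rw [he, le_div_iff₀ h2] at h1
    linarith
  · subst h; simp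
  · obtain ⟨ξ, hξ, he⟩ := exists_hasDerivAt_eq_slope f f' h
      (fun t _ => (hf t).continuousAt.continuousWithinAt) fun t _ => hf t
    have h1 := hm ⟨hb.1.trans hξ.1.le, hξ.2.le.trans ha.2⟩ ha hξ.2.le
    have h2 : 0 < a - b := by linarith
    rw [he, div_le_iff₀ h2] at h1
    linarith

lemma primG_sub_le {a b : ℝ} (ha : a ∈ Set.Icc (-1 : ℝ) 1) (hb : b ∈ Set.Icc (-1 : ℝ) 1) :
    primG a - primG b ≤ (2 - gMaj a) * (b - a) := by
  have := tangent_le_of_monotoneOn hasDerivAt_primG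
    (fun x hx y hy hxy => sub_le_sub_right (monotoneOn_gMaj hx hy hxy) 2) ha hb
  linarith

lemma primG_le_quadratic {a b : ℝ} (ha : a ∈ Set.Icc (-1 : ℝ) 1) (hb : b ∈ Set.Icc (-1 : ℝ) 1) :
    primG b ≤ primG a - (2 - gMaj a) * (b - a) + (b - a) ^ 2 := by
  have hd : ∀ t, HasDerivAt (fun t => t ^ 2 - primG t) ((2 * t - gMaj t) + 2) t := by
    intro t
    have := ((hasDerivAt_id' t).pow 2).sub (hasDerivAt_primG t)
    exact this.congr_deriv (by norm_num; ring)
  have := tangent_le_of_monotoneOn hd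
    (fun x hx y hy hxy => add_le_add_left (monotoneOn_two_mul_sub_gMaj hx hy hxy) 2) ha hb
  linarith

end GMaj

/-! ### The iterates of the learner -/

section Iterates

variable {X : Type*} {n : ℕ} {C : Set (X → Bool)} {S : Fin n → X × Bool} {ε : ℝ}

lemma LearnIter.one_le {t : ℕ} {μ : X → ℝ} (h : LearnIter C S ε t μ) : 1 ≤ t := by
  cases h <;> omega

lemma LearnIter.exists_mixture {t : ℕ} {μ : X → ℝ} (h : LearnIter C S ε t μ) :
    ∃ (N : ℕ) (w : Fin N → ℝ) (c : Fin N → X → Bool), (∀ i, 0 ≤ w i) ∧ ∑ i, w i = 1 ∧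
      (∀ i, c i ∈ C) ∧ ∀ x, μ x = ∑ i, w i * pm (c i x) := by
  induction h with
  | init c hc => exact ⟨1, fun _ => 1, fun _ => c, by simp, by simp, by simpa, by simp⟩
  | step t μ c hμ hc _ ih =>
    obtain ⟨N, w, f, hw, hw1, hf, hfx⟩ := ih
    have ht : (1 : ℝ) ≤ t := by exact_mod_cast hμ.one_le
    have h1 : 2 / ((t : ℝ) + 2) ≤ 1 := by rw [div_le_one (by linarith)]; linarith
    refine ⟨N + 1, Fin.cons (2 / ((t : ℝ) + 2)) fun i => (1 - 2 / ((t : ℝ) + 2)) * w i,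
      Fin.cons c f, ?_, ?_, ?_, ?_⟩
    · refine Fin.cases ?_ fun i => ?_
      · simp only [Fin.cons_zero]; positivity
      · simp only [Fin.cons_succ]; exact mul_nonneg (by linarith) (hw i)
    · rw [Fin.sum_univ_succ]
      simp only [Fin.cons_zero, Fin.cons_succ, ← mul_sum, hw1]
      ring
    · refine Fin.cases ?_ fun i => ?_
      · simpa using hc.1
      · simpa using hf i
    · intro x
      rw [Fin.sum_univ_succ]
      simp only [Fin.cons_zero, Fin.cons_succ, mul_assoc, ← mul_sum, ← hfx]
      ring

lemma sum_weights_mem {ι : Type*} [Fintype ι] {w a : ι → ℝ} (hw : ∀ i, 0 ≤ w i)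
    (hw1 : ∑ i, w i = 1) (ha : ∀ i, a i ∈ Set.Icc (-1 : ℝ) 1) :
    ∑ i, w i * a i ∈ Set.Icc (-1 : ℝ) 1 := by
  constructor
  · calc (-1 : ℝ) = ∑ i, w i * (-1) := by rw [← sum_mul, hw1]; ring
      _ ≤ _ := sum_le_sum fun i _ => mul_le_mul_of_nonneg_left (ha i).1 (hw i)
  · calc ∑ i, w i * a i ≤ ∑ i, w i * 1 :=
          sum_le_sum fun i _ => mul_le_mul_of_nonneg_left (ha i).2 (hw i)
      _ = 1 := by rw [← sum_mul, hw1]; ring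

lemma LearnIter.mem_Icc {t : ℕ} {μ : X → ℝ} (h : LearnIter C S ε t μ) (x : X) :
    μ x ∈ Set.Icc (-1 : ℝ) 1 := by
  obtain ⟨N, w, c, hw, hw1, -, hμ⟩ := h.exists_mixture
  rw [hμ x]
  exact sum_weights_mem hw hw1 fun i => pm_mem _

lemma mul_pm_mem {a : ℝ} (ha : a ∈ Set.Icc (-1 : ℝ) 1) (b : Bool) : a * pm b ∈ Set.Icc (-1 : ℝ) 1 := by
  obtain ⟨h1, h2⟩ := ha
  cases b <;> simp [pm] <;> constructor <;> linarith

/-- The average of the potential over the dataset. -/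
noncomputable def pot (S : Fin n → X × Bool) (μ : X → ℝ) : ℝ :=
  (∑ i, primG (μ (S i).1 * pm (S i).2)) / n

/-- The negative of the derivative of the potential at `μ` in direction `f`. -/
noncomputable def lin (S : Fin n → X × Bool) (μ f : X → ℝ) : ℝ :=
  (∑ i, f (S i).1 * pm (S i).2 * (2 - gMaj (μ (S i).1 * pm (S i).2))) / n

/-- The subtracted term does not involve `c` because `g` is odd and labels are signs. So maximizing
the loss over `c` is maximizing the linear functional of Frank–Wolfe. -/
lemma loss_eq_lin (S : Fin n → X × Bool) (μ : X → ℝ) (c : X → Bool) :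
    loss S c (gMaj ∘ μ) = lin S μ (fun x => pm (c x))
      - (∑ i, gMaj (μ (S i).1 * pm (S i).2)) / n := by
  rw [loss, lin, ← sub_div, ← sum_sub_distrib]
  congr 1
  refine sum_congr rfl fun i _ => ?_
  rw [gMaj_mul_pm, Function.comp_apply]

lemma loss_le_gap {μ : X → ℝ} (hμ : ∀ x, μ x ∈ Set.Icc (-1 : ℝ) 1) (c : X → Bool) :
    loss S c (gMaj ∘ μ) ≤ lin S μ (fun x => pm (c x)) - lin S μ μ := by
  rw [loss_eq_lin]
  apply sub_le_sub_left
  rw [lin]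
  gcongr with i
  exact mul_two_sub_gMaj_le (mul_pm_mem (hμ _) _)

lemma pot_sub_le {μ f : X → ℝ} (hμ : ∀ x, μ x ∈ Set.Icc (-1 : ℝ) 1)
    (hf : ∀ x, f x ∈ Set.Icc (-1 : ℝ) 1) : pot S μ - pot S f ≤ lin S μ f - lin S μ μ := by
  rw [pot, pot, lin, lin, ← sub_div, ← sub_div, ← sum_sub_distrib, ← sum_sub_distrib]
  refine div_le_div_of_nonneg_right (sum_le_sum fun i _ => ?_) (Nat.cast_nonneg n)
  have := primG_sub_le (mul_pm_mem (hμ (S i).1) (S i).2) (mul_pm_mem (hf (S i).1) (S i).2)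
  linarith

/-- Smoothness along the segment from `μ` to `c`; the 4 is the squared diameter of `[-1, 1]`. -/
lemma pot_step_le {μ : X → ℝ} (hμ : ∀ x, μ x ∈ Set.Icc (-1 : ℝ) 1) (c : X → Bool) {γ : ℝ}
    (h0 : 0 ≤ γ) (h1 : γ ≤ 1) :
    pot S (fun x => (1 - γ) * μ x + γ * pm (c x))
      ≤ pot S μ - γ * (lin S μ (fun x => pm (c x)) - lin S μ μ) + 4 * γ ^ 2 := by
  rcases Nat.eq_zero_or_pos n with rfl | hn
  · simp only [pot, lin, univ_eq_empty, sum_empty, zero_div, sub_zero, mul_zero, zero_add]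
    positivity
  have hn0 : (0 : ℝ) < n := by exact_mod_cast hn
  have hsum : ∑ i, primG (((1 - γ) * μ (S i).1 + γ * pm (c (S i).1)) * pm (S i).2)
      ≤ ∑ i, (primG (μ (S i).1 * pm (S i).2) - γ * (pm (c (S i).1) * pm (S i).2 *
        (2 - gMaj (μ (S i).1 * pm (S i).2)) - μ (S i).1 * pm (S i).2 *
        (2 - gMaj (μ (S i).1 * pm (S i).2))) + 4 * γ ^ 2) := by
    refine sum_le_sum fun i _ => ?_
    have hm := mul_pm_mem (hμ (S i).1) (S i).2
    have hc := mul_pm_mem (pm_mem (c (S i).1)) (S i).2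
    set m := μ (S i).1 * pm (S i).2
    set u := pm (c (S i).1) * pm (S i).2
    have e : ((1 - γ) * μ (S i).1 + γ * pm (c (S i).1)) * pm (S i).2 = (1 - γ) * m + γ * u := by
      simp only [m, u]; ring
    rw [e]
    have hb : (1 - γ) * m + γ * u ∈ Set.Icc (-1 : ℝ) 1 := by
      obtain ⟨h3, h4⟩ := hm
      obtain ⟨h5, h6⟩ := hc
      constructor <;> nlinarith
    have h := primG_le_quadratic hm hb
    have h2 : ((1 - γ) * m + γ * u - m) ^ 2 ≤ 4 * γ ^ 2 := by
      have : (u - m) ^ 2 ≤ 4 := by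
        obtain ⟨h3, h4⟩ := hm
        obtain ⟨h5, h6⟩ := hc
        nlinarith
      calc _ = γ ^ 2 * (u - m) ^ 2 := by ring
        _ ≤ γ ^ 2 * 4 := by gcongr
        _ = _ := by ring
    linarith
  rw [sum_add_distrib, sum_sub_distrib, ← mul_sum, sum_sub_distrib, sum_const, card_univ,
    Fintype.card_fin, nsmul_eq_mul] at hsum
  have h2 := div_le_div_of_nonneg_right hsum hn0.le
  refine h2.trans_eq ?_
  simp only [pot, lin]
  field_simp

/-- Linearity carries near-optimality from concepts to their mixtures. The competitor is another
iterate, so no minimizer of the potential has to exist. -/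
lemma ApproxMax.lin_le {μ f : X → ℝ} {c : X → Bool} (hc : ApproxMax C S ε (gMaj ∘ μ) c) {t : ℕ}
    (hf : LearnIter C S ε t f) : lin S μ f ≤ lin S μ (fun x => pm (c x)) + ε / 20 := by
  obtain ⟨N, w, a, hw, hw1, ha, hfx⟩ := hf.exists_mixture
  have h1 : ∀ i, lin S μ (fun x => pm (a i x)) ≤ lin S μ (fun x => pm (c x)) + ε / 20 := by
    intro i
    have := hc.2 (a i) (ha i)
    rw [loss_eq_lin, loss_eq_lin] at this
    linarith
  have h2 : lin S μ f = ∑ i, w i * lin S μ fun x => pm (a i x) := by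
    simp only [lin, mul_div_assoc', mul_sum, ← sum_div]
    rw [sum_comm]
    congr 1
    refine sum_congr rfl fun j _ => ?_
    rw [hfx, sum_mul, sum_mul]
    exact sum_congr rfl fun i _ => by ring
  rw [h2]
  calc _ ≤ ∑ i, w i * (lin S μ (fun x => pm (c x)) + ε / 20) :=
        sum_le_sum fun i _ => mul_le_mul_of_nonneg_left (h1 i) (hw i)
    _ = _ := by rw [← sum_mul, hw1, one_mul]

lemma LearnIter.exists_trajectory {N : ℕ} {m : X → ℝ} (h : LearnIter C S ε N m) :
    ∃ (μ : ℕ → X → ℝ) (c : ℕ → X → Bool), μ N = m ∧ ∀ t, 1 ≤ t → t < N →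
      LearnIter C S ε t (μ t) ∧ ApproxMax C S ε (gMaj ∘ μ t) (c t) ∧
      19 / 20 * ε < loss S (c t) (gMaj ∘ μ t) ∧
      μ (t + 1) = fun x => (1 - 2 / ((t : ℝ) + 2)) * μ t x + 2 / ((t : ℝ) + 2) * pm (c t x) := by
  induction h with
  | init c hc => exact ⟨fun _ x => pm (c x), fun _ => c, rfl, fun t h1 h2 => by omega⟩
  | step N m c hm hc hl ih =>
    obtain ⟨μ, f, hN, ht⟩ := ih
    refine ⟨fun s => if s ≤ N then μ s else
        fun x => (1 - 2 / ((N : ℝ) + 2)) * m x + 2 / ((N : ℝ) + 2) * pm (c x),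
      fun s => if s < N then f s else c, by simp, fun t h1 h2 => ?_⟩
    rcases Nat.lt_succ_iff_lt_or_eq.1 h2 with h3 | rfl
    · have := ht t h1 h3
      simp only [h3.le, h3, if_true, Nat.succ_le_of_lt h3]
      exact this
    · simp only [le_refl, if_true, lt_irrefl, if_false, hN, Nat.not_succ_le_self]
      exact ⟨hm, hc, hl, trivial⟩

/-- The learner stops after `O(1 / ε)` iterations. -/
theorem LearnIter.le_div {N : ℕ} {m : X → ℝ} (h : LearnIter C S ε N m) (hε : 0 < ε) (hε1 : ε ≤ 1) :
    (N : ℝ) ≤ 76 / ε := by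
  rw [le_div_iff₀ hε]
  rcases Nat.lt_or_ge N 4 with h4 | h4
  · have : (N : ℝ) ≤ 3 := by exact_mod_cast (by omega : N ≤ 3)
    nlinarith
  obtain ⟨μ, c, -, ht⟩ := h.exists_trajectory
  -- The first half of the run, up to `T`, makes the potential small relative to its value at `E = 2
  -- T + 2`; the steps from `T` to `E` would then lower it too far if all gaps were large.
  obtain ⟨T, hT1, hT2, hT3⟩ : ∃ T, 1 ≤ T ∧ 2 * T + 2 < N + 1 ∧ N ≤ 2 * T + 3 :=
    ⟨(N - 2) / 2, by omega, by omega, by omega⟩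
  set E := 2 * T + 2 with hE
  have hTpos : (1 : ℝ) ≤ T := by exact_mod_cast hT1
  -- the last iterate considered
  have hEμ : LearnIter C S ε E (μ E) := by
    rcases Nat.lt_or_ge E N with h1 | h1
    · exact (ht E (by omega) h1).1
    · obtain ⟨h5, h6, h7, h8⟩ := ht (E - 1) (by omega) (by omega)
      have h9 := LearnIter.step _ _ _ h5 h6 h7
      rw [← h8] at h9
      rwa [show E - 1 + 1 = E by omega] at h9
  have hstep : ∀ t, 1 ≤ t → t < E → ∃ G : ℝ, 19 / 20 * ε ≤ G ∧ pot S (μ t) - pot S (μ E) ≤ G + ε / 20 ∧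
      pot S (μ (t + 1)) ≤ pot S (μ t) - 2 / ((t : ℝ) + 2) * G + 4 * (2 / ((t : ℝ) + 2)) ^ 2 := by
    intro t h1 h2
    obtain ⟨h5, h6, h7, h8⟩ := ht t h1 (by omega)
    refine ⟨lin S (μ t) (fun x => pm (c t x)) - lin S (μ t) (μ t), ?_, ?_, ?_⟩
    · exact h7.le.trans (loss_le_gap h5.mem_Icc _)
    · have h10 := pot_sub_le (S := S) h5.mem_Icc hEμ.mem_Icc
      have h11 := h6.lin_le hEμ
      linarith
    · rw [h8]
      have ht0 : (1 : ℝ) ≤ t := by exact_mod_cast h1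
      exact pot_step_le h5.mem_Icc _ (by positivity) (by rw [div_le_one (by linarith)]; linarith)
  -- The `O(1 / t)` rate with `γ = 2 / (t + 2)`, up to the oracle error `ε / 20`, measured against
  -- iterate `E`. At `t = 1` the allowance `18 / 3` is the crude bound `6`.
  have hprimal : ∀ t, 1 ≤ t → t ≤ T → pot S (μ t) - pot S (μ E) ≤ ε / 20 + 18 / ((t : ℝ) + 2) := by
    intro t h1
    induction t, h1 using Nat.le_induction with
    | base =>
      intro _
      have h5 := (ht 1 le_rfl (by omega)).1
      have h10 := pot_sub_le (S := S) h5.mem_Icc hEμ.mem_Icc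
      have h11 : lin S (μ 1) (μ E) - lin S (μ 1) (μ 1) ≤ 6 := by
        rw [lin, lin, ← sub_div, ← sum_sub_distrib]
        rcases Nat.eq_zero_or_pos n with rfl | hn
        · simp
        have hn0 : (0 : ℝ) < n := by exact_mod_cast hn
        rw [div_le_iff₀ hn0]
        calc _ ≤ ∑ i : Fin n, (6 : ℝ) := by
              refine sum_le_sum fun i _ => ?_
              have ha := mul_pm_mem (h5.mem_Icc (S i).1) (S i).2
              have hb := mul_pm_mem (hEμ.mem_Icc (S i).1) (S i).2
              have hg := gMaj_mem ha
              obtain ⟨a1, a2⟩ := ha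
              obtain ⟨b1, b2⟩ := hb
              obtain ⟨g1, g2⟩ := hg
              nlinarith
          _ = _ := by simp; ring
      norm_num
      linarith
    | succ t h1 ih =>
      intro h2
      have ih := ih (by omega)
      obtain ⟨G, hG1, hG2, hG3⟩ := hstep t h1 (by omega)
      have ht0 : (1 : ℝ) ≤ t := by exact_mod_cast h1
      set γ := 2 / ((t : ℝ) + 2) with hγ
      have hγ0 : 0 ≤ γ := by positivity
      have hγ1 : 0 ≤ 1 - γ := by
        rw [sub_nonneg, hγ, div_le_one (by linarith)]; linarith
      have h3 : γ * (pot S (μ t) - pot S (μ E) - ε / 20) ≤ γ * G := by gcongr; linarith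
      have h4 : (1 - γ) * (pot S (μ t) - pot S (μ E)) ≤ (1 - γ) * (ε / 20 + 18 / ((t : ℝ) + 2)) := by
        gcongr
      have h5 : (1 - γ) * (18 / ((t : ℝ) + 2)) + 4 * γ ^ 2 ≤ 18 / ((t : ℝ) + 1 + 2) := by
        rw [hγ]
        have e : (1 - 2 / ((t : ℝ) + 2)) * (18 / ((t : ℝ) + 2)) + 4 * (2 / ((t : ℝ) + 2)) ^ 2
            = (18 * t + 16) / (t + 2) ^ 2 := by
          field_simp
          ring
        rw [e, div_le_div_iff₀ (by positivity) (by positivity)]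
        nlinarith
      push_cast
      linarith
  -- In the second half `1 / (T + 2) ≤ γ ≤ 2 / (T + 2)`, so each step gains at least `γ` times the
  -- gap minus `16 / (T + 2) ^ 2`.
  have hdec : ∀ j, j ≤ T + 2 → pot S (μ (T + j)) ≤ pot S (μ T)
      - j * (19 / 20 * ε / (T + 2) - 16 / ((T : ℝ) + 2) ^ 2) := by
    intro j
    induction j with
    | zero => intro _; simp
    | succ j ih =>
      intro hj
      have ih := ih (by omega)
      obtain ⟨G, hG1, -, hG3⟩ := hstep (T + j) (by omega) (by omega)
      have hjT : (j : ℝ) ≤ T + 1 := by exact_mod_cast (by omega : j ≤ T + 1)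
      have hj0 : (0 : ℝ) ≤ j := by positivity
      have hγ1 : 1 / ((T : ℝ) + 2) ≤ 2 / (((T + j : ℕ) : ℝ) + 2) := by
        rw [div_le_div_iff₀ (by positivity) (by positivity)]
        push_cast; nlinarith
      have hγ2 : 2 / (((T + j : ℕ) : ℝ) + 2) ≤ 2 / ((T : ℝ) + 2) := by
        gcongr; linarith
      set γ := 2 / (((T + j : ℕ) : ℝ) + 2) with hγ
      have hγ0 : 0 ≤ γ := by positivity
      have h3 : 1 / ((T : ℝ) + 2) * (19 / 20 * ε) ≤ γ * G := by gcongr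
      have h4 : 4 * γ ^ 2 ≤ 4 * (2 / ((T : ℝ) + 2)) ^ 2 := by gcongr
      have h5 : 4 * (2 / ((T : ℝ) + 2)) ^ 2 = 16 / ((T : ℝ) + 2) ^ 2 := by
        rw [div_pow]; ring
      have h6 : 1 / ((T : ℝ) + 2) * (19 / 20 * ε) = 19 / 20 * ε / (T + 2) := by ring
      rw [← add_assoc]
      push_cast at ih ⊢
      linarith
  have h1 := hdec (T + 2) le_rfl
  have h2 := hprimal T hT1 le_rfl
  have e1 : T + (T + 2) = E := by omega
  rw [e1] at h1
  have e2 : ((T + 2 : ℕ) : ℝ) * (19 / 20 * ε / (T + 2) - 16 / ((T : ℝ) + 2) ^ 2)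
      = 19 / 20 * ε - 16 / ((T : ℝ) + 2) := by
    push_cast
    field_simp
  rw [e2] at h1
  have h3 : 18 / 20 * ε ≤ 34 / ((T : ℝ) + 2) := by
    have : 34 / ((T : ℝ) + 2) = 16 / ((T : ℝ) + 2) + 18 / ((T : ℝ) + 2) := by ring
    linarith
  rw [le_div_iff₀ (by positivity)] at h3
  have h5 : (N : ℝ) ≤ 2 * T + 3 := by exact_mod_cast hT3
  nlinarith

end Iterates

/-! ### Majority votes -/

section MajorityVotes

variable {X : Type*}

/-- The majority vote of `7` labels. -/
noncomputable def majVote (v : Fin 7 → Bool) : Bool := by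
  classical exact decide (0 ≤ ∑ i, pm (v i))

lemma pm_majVote (v : Fin 7 → Bool) : pm (majVote v) = if 0 ≤ ∑ i, pm (v i) then 1 else -1 := by
  unfold majVote pm
  split_ifs <;> simp_all

lemma majVote_const (b : Bool) : majVote (fun _ => b) = b := by
  cases b <;> simp [majVote, pm]

/-- A label with mean `∑ w_i a_i` arises by drawing an index from `w` and taking its label. Seven
independent draws make `M₇` the average majority vote over index tuples. -/
lemma majMean_mixture {N : ℕ} (w : Fin N → ℝ) (hw : ∑ i, w i = 1) (a : Fin N → Bool) :
    majMean 7 (∑ i, w i * pm (a i))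
      = ∑ τ : Fin 7 → Fin N, (∏ j, w (τ j)) * pm (majVote fun j => a (τ j)) := by
  classical
  have h1 : ∀ b : Bool, (1 + (∑ i, w i * pm (a i)) * pm b) / 2
      = ∑ i, w i * (if a i = b then 1 else 0) := by
    intro b
    rw [sum_mul]
    nth_rw 1 [← hw]
    rw [← sum_add_distrib, sum_div]
    refine sum_congr rfl fun i _ => ?_
    cases a i <;> cases b <;> simp [pm]
  simp only [majMean, h1]
  simp_rw [Finset.prod_univ_sum, Fintype.piFinset_univ, sum_mul]
  rw [sum_comm]
  refine sum_congr rfl fun τ _ => ?_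
  rw [sum_eq_single fun j => a (τ j)]
  · simp [pm_majVote]
  · intro z _ hz
    obtain ⟨j, hj⟩ := Function.ne_iff.1 hz
    have : ∏ j, w (τ j) * (if a (τ j) = z j then (1 : ℝ) else 0) = 0 :=
      prod_eq_zero (mem_univ j) (by rw [if_neg (fun h => hj h.symm), mul_zero])
    rw [this, zero_mul]
  · simp

/-- The mean function `g ∘ μ` is a mixture of majority votes of `7` concepts. -/
lemma gMaj_mixture {N : ℕ} {w : Fin N → ℝ} (hw : ∀ i, 0 ≤ w i) (hw1 : ∑ i, w i = 1)
    (c : Fin N → X → Bool) :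
    ∃ u : (Fin 7 → Fin N) ⊕ Fin N → ℝ, (∀ k, 0 ≤ u k) ∧ ∑ k, u k = 1 ∧
      ∀ x, gMaj (∑ i, w i * pm (c i x)) = ∑ k, u k *
        pm (majVote fun j => c (Sum.elim (fun τ => τ j) (fun i => i) k) x) := by
  -- The linear part of `g` fits the same form: the index `Sum.inr i` stands for a vote of seven
  -- copies of concept `i`.
  refine ⟨Sum.elim (fun τ => 16 / 19 * ∏ j, w (τ j)) fun i => 3 / 19 * w i, ?_, ?_, ?_⟩
  · rintro (τ | i)
    · exact mul_nonneg (by norm_num) (prod_nonneg fun j _ => hw _)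
    · exact mul_nonneg (by norm_num) (hw i)
  · have : ∑ τ : Fin 7 → Fin N, ∏ j, w (τ j) = 1 := by
      have := Finset.prod_univ_sum (fun _ : Fin 7 => (univ : Finset (Fin N))) fun _ i => w i
      rw [Fintype.piFinset_univ] at this
      rw [← this]
      simp [hw1]
    rw [Fintype.sum_sum_type]
    simp only [Sum.elim_inl, Sum.elim_inr, ← mul_sum, this, hw1]
    norm_num
  · intro x
    rw [gMaj, majMean_mixture w hw1, Fintype.sum_sum_type]
    simp only [Sum.elim_inl, Sum.elim_inr, majVote_const, mul_assoc, ← mul_sum]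

/-- The probability that the randomized hypothesis with mean function `h` errs at the point `x`. -/
noncomputable def pointErr (h : X → ℝ) (c : X → Bool) (x : X) : ℝ := (1 - h x * pm (c x)) / 2

lemma pointErr_mem {h : X → ℝ} {c : X → Bool} {x : X} (hx : h x ∈ Set.Icc (-1 : ℝ) 1) :
    0 ≤ pointErr h c x ∧ pointErr h c x ≤ 1 := by
  have := mul_pm_mem hx (c x)
  unfold pointErr
  exact ⟨by linarith [this.2], by linarith [this.1]⟩

lemma rad_real_ne {t : ℝ} (ht : t ∈ Set.Icc (-1 : ℝ) 1) (b : Bool) :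
    (rad t).real {y | y ≠ b} = (1 - t * pm b) / 2 := by
  have h01 : (1 + t) / 2 ∈ Set.Icc (0 : ℝ) 1 := ⟨by linarith [ht.1], by linarith [ht.2]⟩
  have hp : ((Set.projIcc (0 : ℝ) 1 zero_le_one ((1 + t) / 2) : unitInterval) : ℝ) = (1 + t) / 2 := by
    rw [Set.projIcc_of_mem _ h01]
  have hm : MeasurableSet {y : Bool | y ≠ b} := .of_discrete
  unfold rad
  rw [← integral_indicator_one hm, integral_bernoulliMeasure, hp]
  cases b <;> simp [pm]
  ring

lemma error_eq_integral [MeasurableSpace X] (D : Measure X) {h : X → ℝ} (c : X → Bool)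
    (hh : ∀ x, h x ∈ Set.Icc (-1 : ℝ) 1) : error D h c = ∫ x, pointErr h c x ∂D := by
  unfold error pointErr
  exact integral_congr_ae (ae_of_all _ fun x => rad_real_ne (hh x) (c x))

lemma LearnIter.isHypothesis [MeasurableSpace X] {C : Set (X → Bool)} (hC : ∀ c ∈ C, Measurable c)
    {n : ℕ} {S : Fin n → X × Bool} {ε : ℝ} {t : ℕ} {μ : X → ℝ} (h : LearnIter C S ε t μ) :
    IsHypothesis (gMaj ∘ μ) := by
  refine ⟨?_, fun x => gMaj_mem (h.mem_Icc x)⟩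
  obtain ⟨N, w, c, -, -, hc, hμ⟩ := h.exists_mixture
  have hm : Measurable μ := by
    rw [show μ = fun x => ∑ i, w i * pm (c i x) from funext hμ]
    exact Finset.measurable_sum _ fun i _ =>
      ((measurable_of_finite pm).comp (hC _ (hc i))).const_mul _
  have hg : Measurable gMaj := by
    rw [show gMaj = fun t => (38 * t - 35 * t ^ 3 + 21 * t ^ 5 - 5 * t ^ 7) / 19 from funext gMaj_eq]
    fun_prop
  exact hg.comp hm

variable {Z : Type*}

/-- The indicators of the errors of majority votes of `7` concepts on the examples selected by `b`. -/
def majErrors (C : Set (X → Bool)) (c : X → Bool) (π : Z → X) (b : Z → Bool) : Set (Z → Bool) :=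
  {f | ∃ a : Fin 7 → X → Bool, (∀ j, a j ∈ C) ∧
    f = fun z => b z && (majVote (fun j => a j (π z)) ^^ c (π z))}

variable {C : Set (X → Bool)} {c : X → Bool} {π : Z → X} {b : Z → Bool}

/-- A labeling by errors of a vote is determined by the labelings of the seven voters, so the
Sauer–Shelah bound is raised to the seventh power. -/
lemma polyTraces_majErrors {d : ℕ} (h : HasVCDim C d) (hd : 1 ≤ d) :
    PolyTraces (majErrors C c π b) d := by
  classical
  intro m z hm
  have h1 := h.ncard_traces_le hd hm fun i => π (z i)
  set T := (Set.toFinite (traces C fun i => π (z i))).toFinset with hT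
  have hTc : (traces C fun i => π (z i)).ncard = T.card :=
    Set.ncard_eq_toFinset_card _ (Set.toFinite _)
  rw [hTc] at h1
  have hsub : traces (majErrors C c π b) z ⊆
      (((Fintype.piFinset fun _ : Fin 7 => T).image fun u i =>
        (b (z i) && (majVote (fun j => u j i) ^^ c (π (z i)))) : Finset (Fin m → Bool)) :
          Set (Fin m → Bool)) := by
    rintro _ ⟨f, ⟨a, ha, rfl⟩, rfl⟩
    rw [mem_coe, mem_image]
    refine ⟨fun j i => a j (π (z i)), ?_, rfl⟩
    rw [Fintype.mem_piFinset]
    intro j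
    rw [hT, Set.Finite.mem_toFinset]
    exact ⟨a j, ha j, rfl⟩
  have h2 : (traces (majErrors C c π b) z).ncard ≤ T.card ^ 7 := by
    refine (Set.ncard_le_ncard hsub (Finset.finite_toSet _)).trans ?_
    rw [Set.ncard_coe_finset]
    refine card_image_le.trans ?_
    rw [Fintype.card_piFinset]
    simp
  calc ((traces (majErrors C c π b) z).ncard : ℝ) ≤ (T.card : ℝ) ^ 7 := by exact_mod_cast h2
    _ ≤ ((Real.exp 1 * m / d) ^ d) ^ 7 := by gcongr
    _ = _ := by rw [← pow_mul, mul_comm d]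

variable [MeasurableSpace X] [MeasurableSpace Z]

lemma measurable_majErrors (hC : ∀ c ∈ C, Measurable c) (hc : Measurable c) (hπ : Measurable π)
    (hb : Measurable b) : ∀ f ∈ majErrors C c π b, Measurable f := by
  rintro _ ⟨a, ha, rfl⟩
  have h1 : Measurable fun z => (b z, c (π z), fun j => a j (π z)) :=
    hb.prodMk ((hc.comp hπ).prodMk (measurable_pi_lambda _ fun j => (hC _ (ha j)).comp hπ))
  exact (measurable_of_finite fun q : Bool × Bool × (Fin 7 → Bool) =>
    (q.1 && (majVote q.2.2 ^^ q.2.1))).comp h1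

/-- Fixing the labelings of the seven voters splits the event into finitely many pieces, each an
intersection of trace events of `C` with a measurable condition on `b` and `c`. -/
lemma traceMeasurable_majErrors {D : Measure X} {ν : Measure Z} [IsProbabilityMeasure D]
    [IsProbabilityMeasure ν] (hTr : TraceMeasurable C D) (hc : Measurable c)
    (hπ : MeasurePreserving π ν D) (hb : Measurable b) : TraceMeasurable (majErrors C c π b) ν := by
  intro m v
  have hpi : MeasurePreserving (fun (z : Fin m → Z) i => π (z i)) (Measure.pi fun _ => ν)
      (Measure.pi fun _ => D) := measurePreserving_pi (fun _ => ν) (fun _ => D) fun _ => hπ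
  have : {z : Fin m → Z | ∃ f ∈ majErrors C c π b, ∀ i, f (z i) = v i}
      = ⋃ u : Fin 7 → Fin m → Bool,
        (⋂ j, (fun (z : Fin m → Z) i => π (z i)) ⁻¹' {x | ∃ a ∈ C, ∀ i, a (x i) = u j i}) ∩
        {z | ∀ i, (b (z i) && (majVote (fun j => u j i) ^^ c (π (z i)))) = v i} := by
    ext z
    simp only [majErrors, Set.mem_ofPred_eq, Set.mem_iUnion, Set.mem_inter_iff, Set.mem_iInter,
      Set.mem_preimage]
    constructor
    · rintro ⟨_, ⟨a, ha, rfl⟩, hv⟩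
      exact ⟨fun j i => a j (π (z i)), fun j => ⟨a j, ha j, fun i => rfl⟩, hv⟩
    · rintro ⟨u, hu, hv⟩
      choose a ha hau using hu
      refine ⟨_, ⟨a, ha, rfl⟩, fun i => ?_⟩
      simp only [hau]
      exact hv i
  rw [this]
  refine NullMeasurableSet.iUnion fun u => (NullMeasurableSet.iInter fun j => ?_).inter ?_
  · exact (hTr m (u j)).preimage hpi.quasiMeasurePreserving
  · apply MeasurableSet.nullMeasurableSet
    have h1 : Measurable fun (z : Fin m → Z) => fun i => (b (z i), c (π (z i))) :=
      measurable_pi_lambda _ fun i => (hb.comp (measurable_pi_apply i)).prodMk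
        ((hc.comp hπ.measurable).comp (measurable_pi_apply i))
    exact h1 (MeasurableSet.of_discrete (s := {q : Fin m → Bool × Bool |
      ∀ i, ((q i).1 && (majVote (fun j => u j i) ^^ (q i).2)) = v i}))

/-- Uniform convergence over majority votes extends to the hypotheses of the learner. -/
lemma integral_pointErr_le {ν : Measure Z} [IsProbabilityMeasure ν] (hC : ∀ c ∈ C, Measurable c)
    (hc : Measurable c) (hπ : Measurable π) (hb : Measurable b) {n : ℕ} {z : Fin n → Z} {α ε : ℝ}
    (hgood : ∀ f ∈ majErrors C c π b,
      ν.real {z | f z = true} * n ≤ (1 + α) * ∑ i, ind (f (z i)) + ε * n)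
    {m : ℕ} {S : Fin m → X × Bool} {ε' : ℝ} {t : ℕ} {μ : X → ℝ} (hμ : LearnIter C S ε' t μ) :
    (∫ z, ind (b z) * pointErr (gMaj ∘ μ) c (π z) ∂ν) * n
      ≤ (1 + α) * ∑ i, ind (b (z i)) * pointErr (gMaj ∘ μ) c (π (z i)) + ε * n := by
  obtain ⟨N, w, a, hw, hw1, ha, hμx⟩ := hμ.exists_mixture
  obtain ⟨u, hu, hu1, hux⟩ := gMaj_mixture hw hw1 a
  let F : (Fin 7 → Fin N) ⊕ Fin N → Z → Bool := fun k z =>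
    b z && (majVote (fun j => a (Sum.elim (fun τ => τ j) (fun i => i) k) (π z)) ^^ c (π z))
  have hF : ∀ k, F k ∈ majErrors C c π b := fun k => ⟨_, fun j => ha _, rfl⟩
  -- The error is affine in the mean function and the weights sum to 1, so the deviation bounds for
  -- the individual votes can be averaged.
  have hpt : ∀ z, ind (b z) * pointErr (gMaj ∘ μ) c (π z) = ∑ k, u k * ind (F k z) := by
    intro z
    have h1 : pointErr (gMaj ∘ μ) c (π z) = ∑ k, u k * ((1 -
        pm (majVote fun j => a (Sum.elim (fun τ => τ j) (fun i => i) k) (π z)) * pm (c (π z))) / 2) := by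
      rw [pointErr, Function.comp_apply, hμx, hux]
      nth_rw 1 [← hu1]
      rw [sum_mul, ← sum_sub_distrib, sum_div]
      exact sum_congr rfl fun k _ => by ring
    rw [h1, mul_sum]
    refine sum_congr rfl fun k _ => ?_
    simp only [F]
    cases b z <;> cases c (π z) <;>
      cases majVote fun j => a (Sum.elim (fun τ => τ j) (fun i => i) k) (π z) <;> simp [ind, pm]
  have hmeas := measurable_majErrors hC hc hπ hb
  have hint : ∀ k ∈ univ, Integrable (fun z => u k * ind (F k z)) ν := fun k _ => by
    refine Integrable.const_mul ?_ _
    refine Integrable.of_bound (measurable_ind (hmeas _ (hF k))).aestronglyMeasurable 1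
      (ae_of_all _ fun z => ?_)
    rw [Real.norm_eq_abs, abs_of_nonneg (ind_nonneg _)]
    exact ind_le_one _
  simp only [hpt]
  rw [integral_finsetSum _ hint, sum_mul]
  simp only [integral_const_mul]
  calc ∑ k, u k * (∫ z, ind (F k z) ∂ν) * n
      ≤ ∑ k, u k * ((1 + α) * ∑ i, ind (F k (z i)) + ε * n) := by
        refine sum_le_sum fun k _ => ?_
        rw [integral_ind (hmeas _ (hF k)), mul_assoc]
        exact mul_le_mul_of_nonneg_left (hgood _ (hF k)) (hu k)
    _ = (1 + α) * ∑ i, ∑ k, u k * ind (F k (z i)) + ε * n := by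
        simp only [mul_add, sum_add_distrib]
        rw [← sum_mul, hu1, one_mul, sum_comm, mul_sum]
        congr 1
        refine sum_congr rfl fun k _ => ?_
        rw [← mul_sum]; ring

end MajorityVotes

/-! ### Consequences of the stopping condition -/

section Stopping

variable {X : Type*} {n : ℕ} {C : Set (X → Bool)} {S : Fin n → X × Bool} {ε : ℝ}

/-- The examples outside `J` that are labeled by a concept `c` with small loss are fitted. -/
lemma sum_pointErr_compl_le {h : X → ℝ} (hh : ∀ x, h x ∈ Set.Icc (-1 : ℝ) 1) {c : X → Bool}
    (hc : loss S c h ≤ ε) (hn : 1 ≤ n) {x : Fin n → X} (J : Finset (Fin n))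
    (hJ : ∀ i ∉ J, S i = (x i, c (x i))) :
    ∑ i ∈ Jᶜ, pointErr h c (x i) ≤ J.card / 2 + ε / 4 * n := by
  have hn0 : (0 : ℝ) < n := by exact_mod_cast hn
  rw [loss, div_le_iff₀ hn0, ← sum_add_sum_compl J] at hc
  have h1 : ∑ i ∈ Jᶜ, (pm (c (S i).1) * pm (S i).2 * (2 - h (S i).1 * pm (S i).2)
      - h (S i).1 * pm (S i).2) = ∑ i ∈ Jᶜ, 4 * pointErr h c (x i) := by
    refine sum_congr rfl fun i hi => ?_
    rw [hJ i (mem_compl.1 hi)]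
    simp only [pointErr, pm_mul_self]
    ring
  -- If `c` agrees with the label, the term is `2 - 2 h y ≥ 0`. If it disagrees, the contributions
  -- of `h` cancel and the term is exactly `-2`.
  have h2 : ∑ i ∈ J, (-2 : ℝ) ≤ ∑ i ∈ J, (pm (c (S i).1) * pm (S i).2 * (2 - h (S i).1 * pm (S i).2)
      - h (S i).1 * pm (S i).2) := by
    refine sum_le_sum fun i _ => ?_
    have h3 := mul_pm_mem (hh (S i).1) (S i).2
    obtain ⟨h4, h5⟩ := h3
    have h6 : pm (c (S i).1) * pm (S i).2 = 1 ∨ pm (c (S i).1) * pm (S i).2 = -1 := by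
      cases c (S i).1 <;> cases (S i).2 <;> simp [pm]
    rcases h6 with h6 | h6 <;> rw [h6] <;> linarith
  rw [h1, ← mul_sum] at hc
  rw [sum_const, nsmul_eq_mul] at h2
  linarith

lemma loss_le_of_mem_learnMal {h : X → ℝ} (hh : h ∈ learnMal C ε S) {c : X → Bool} (hc : c ∈ C) :
    ∃ t μ, LearnIter C S ε t μ ∧ h = gMaj ∘ μ ∧ loss S c h ≤ ε := by
  obtain ⟨t, μ, c', h1, h2, h3, rfl⟩ := hh
  refine ⟨t, μ, h1, rfl, ?_⟩
  have := h2.2 c hc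
  linarith

end Stopping

/-! ### The number of corrupted examples and the law of sequential samples -/

section Tails

variable {Ω : Type*} [MeasurableSpace Ω]

/-- Chernoff's bound, for a variable whose exponential moments are at most those of `Bin (n, η)`. -/
lemma measure_lt_le_of_mgf {P : Measure Ω} [IsProbabilityMeasure P] {N : Ω → ℝ} {n : ℕ} {η α ε : ℝ}
    (hη : 0 ≤ η) (hη1 : η ≤ 1) (hα : 0 ≤ α) (hα1 : α ≤ 1) (hε : 0 < ε) (hε1 : ε ≤ 1)
    (hint : ∀ t, Integrable (fun ω => Real.exp (t * N ω)) P)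
    (hmgf : ∀ t, mgf N P t ≤ (1 + η * (Real.exp t - 1)) ^ n) :
    P {ω | (1 + α) * (η * n) + ε * n < N ω} ≤ ENNReal.ofReal (Real.exp (-(n * (ε * (α + ε)) / 4))) := by
  -- With `exp t - 1 ≤ t + t ^ 2` the exponent becomes `n t (η (t - α) - ε)`, and this `t` keeps the
  -- bracket at most `-ε / 2` for every `η ≤ 1`.
  set t := (α + ε) / 2 with ht
  have ht0 : 0 ≤ t := by positivity
  have ht1 : t ≤ 1 := by rw [ht]; linarith
  have h1 := measure_ge_le_exp_mul_mgf ((1 + α) * (η * n) + ε * n) ht0 (hint t)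
  have hexp : Real.exp t - 1 ≤ t + t ^ 2 := by
    have := Real.abs_exp_sub_one_sub_id_le (x := t) (by rw [abs_of_nonneg ht0]; exact ht1)
    linarith [(abs_le.1 this).2]
  have hexp0 : 0 ≤ Real.exp t - 1 := by linarith [Real.add_one_le_exp t]
  have h2 : (1 + η * (Real.exp t - 1)) ^ n ≤ Real.exp (n * (η * (t + t ^ 2))) := by
    rw [Real.exp_nat_mul]
    gcongr
    calc 1 + η * (Real.exp t - 1) ≤ η * (t + t ^ 2) + 1 := by
          rw [add_comm]; gcongr
      _ ≤ _ := Real.add_one_le_exp _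
  have h3 : P.real {ω | (1 + α) * (η * n) + ε * n ≤ N ω} ≤ Real.exp (-(n * (ε * (α + ε)) / 4)) := by
    calc _ ≤ _ := h1
      _ ≤ Real.exp (-t * ((1 + α) * (η * n) + ε * n)) * Real.exp (n * (η * (t + t ^ 2))) := by
          gcongr
          exact (hmgf t).trans h2
      _ = Real.exp (n * t * (η * (t - α) - ε)) := by
          rw [← Real.exp_add]; congr 1; ring
      _ ≤ _ := by
          apply Real.exp_le_exp.2
          have h4 : η * (t - α) - ε ≤ -(ε / 2) := by
            rcases le_total t α with h | h
            · have : η * (t - α) ≤ 0 := mul_nonpos_of_nonneg_of_nonpos hη (by linarith)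
              linarith
            · have : η * (t - α) ≤ 1 * (t - α) := by
                apply mul_le_mul_of_nonneg_right hη1; linarith
              rw [ht] at this ⊢
              linarith
          have h5 : 0 ≤ (n : ℝ) * t := by positivity
          calc n * t * (η * (t - α) - ε) ≤ n * t * (-(ε / 2)) := by gcongr
            _ = _ := by rw [ht]; ring
  calc P {ω | (1 + α) * (η * n) + ε * n < N ω}
      ≤ P {ω | (1 + α) * (η * n) + ε * n ≤ N ω} := by
        refine measure_mono fun ω hω => ?_
        simp only [Set.mem_ofPred_eq] at hω ⊢
        exact hω.le
    _ = ENNReal.ofReal (P.real {ω | (1 + α) * (η * n) + ε * n ≤ N ω}) := by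
        rw [ofReal_measureReal]
    _ ≤ _ := ENNReal.ofReal_le_ofReal h3

lemma mgf_binomial (n : ℕ) (η : unitInterval) (t : ℝ) :
    mgf (fun k : ℕ => (k : ℝ)) (binomial n η) t = (1 + (η : ℝ) * (Real.exp t - 1)) ^ n := by
  rw [mgf, integral_binomial]
  have : 1 + (η : ℝ) * (Real.exp t - 1) = η * Real.exp t + (1 - η) := by ring
  rw [this, add_pow, ← Nat.range_succ_eq_Iic]
  refine sum_congr rfl fun k _ => ?_
  rw [smul_eq_mul, mul_pow, ← Real.exp_nat_mul, mul_comm t]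
  ring

lemma mgf_count_pi_bernoulli (n : ℕ) (η : unitInterval) (t : ℝ) :
    mgf (fun v : Fin n → Bool => ∑ i, ind (v i))
      (Measure.pi fun _ => bernoulliMeasure true false η) t = (1 + (η : ℝ) * (Real.exp t - 1)) ^ n := by
  rw [mgf]
  simp_rw [mul_sum, Real.exp_sum]
  rw [integral_fintype_prod_eq_prod (f := fun _ b => Real.exp (t * ind b))]
  simp only [integral_bernoulliMeasure, prod_const, card_univ, Fintype.card_fin]
  congr 1
  simp [ind]
  ring

/-- Examples that are independent of the past are independent. -/
lemma map_eq_pi_of_indep {Z : Type*} [MeasurableSpace Z] {P : Measure Ω} [IsProbabilityMeasure P]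
    {ν : Measure Z} [IsProbabilityMeasure ν] {n : ℕ}
    (F : Filtration ℕ (inferInstance : MeasurableSpace Ω)) {Y : Fin n → Ω → Z}
    (hY : ∀ i : Fin n, Measurable[F (i.val + 1)] (Y i)) (hlaw : ∀ i, P.map (Y i) = ν)
    (hind : ∀ i : Fin n, Indep (MeasurableSpace.comap (Y i) inferInstance) (F i.val) P) :
    P.map (fun ω i => Y i ω) = Measure.pi fun _ => ν := by
  have hYm : ∀ i, Measurable (Y i) := fun i => (hY i).mono (F.le _) le_rfl
  refine (Measure.pi_eq fun s hs => ?_).symm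
  have hm : Measurable fun ω i => Y i ω := measurable_pi_lambda _ hYm
  rw [Measure.map_apply hm (MeasurableSet.univ_pi hs)]
  -- Events about the coordinates below `k` belong to `F k`, from which coordinate `k` is
  -- independent; so the product splits off one factor at a time.
  have key : ∀ k ≤ n, P {ω | ∀ i : Fin n, i.val < k → Y i ω ∈ s i}
      = ∏ i ∈ univ.filter fun i : Fin n => i.val < k, ν (s i) := by
    intro k
    induction k with
    | zero => intro _; simp
    | succ k ih =>
      intro hk
      have ih := ih (by omega)
      let i₀ : Fin n := ⟨k, hk⟩
      have h1 : {ω | ∀ i : Fin n, i.val < k + 1 → Y i ω ∈ s i}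
          = (Y i₀ ⁻¹' s i₀) ∩ {ω | ∀ i : Fin n, i.val < k → Y i ω ∈ s i} := by
        ext ω
        simp only [Set.mem_ofPred_eq, Set.mem_inter_iff, Set.mem_preimage]
        constructor
        · exact fun h => ⟨h i₀ (by simp [i₀]), fun i hi => h i (by omega)⟩
        · rintro ⟨h2, h3⟩ i hi
          rcases Nat.lt_succ_iff_lt_or_eq.1 hi with h4 | h4
          · exact h3 i h4
          · have : i = i₀ := Fin.ext h4
            rw [this]; exact h2
      have h2 : MeasurableSet[F k] {ω | ∀ i : Fin n, i.val < k → Y i ω ∈ s i} := by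
        have : {ω | ∀ i : Fin n, i.val < k → Y i ω ∈ s i}
            = ⋂ i : Fin n, ⋂ _ : i.val < k, Y i ⁻¹' s i := by
          ext ω; simp
        rw [this]
        refine MeasurableSet.iInter fun i => MeasurableSet.iInter fun hi => ?_
        exact F.mono (show i.val + 1 ≤ k by omega) _ (hY i (hs i))
      have h3 := (Indep_iff _ _ P).1 (hind i₀) (Y i₀ ⁻¹' s i₀) _ ⟨s i₀, hs i₀, rfl⟩ h2
      have h4 : (univ.filter fun i : Fin n => i.val < k + 1)
          = insert i₀ (univ.filter fun i : Fin n => i.val < k) := by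
        ext i
        simp only [mem_filter, mem_univ, true_and, mem_insert, i₀, Fin.ext_iff]
        omega
      rw [h1, h3, ih, ← Measure.map_apply (hYm i₀) (hs i₀), hlaw, h4, prod_insert (by simp [i₀])]
  have h1 := key n le_rfl
  have h2 : (fun ω i => Y i ω) ⁻¹' Set.univ.pi s = {ω | ∀ i : Fin n, i.val < n → Y i ω ∈ s i} := by
    ext ω; simp
  rw [h2, h1]
  simp

end Tails

/-! ### Learning with noise -/

section LearningWithNoise

variable {X : Type*} [MeasurableSpace X] {n : ℕ} {C : Set (X → Bool)} {d : ℕ}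

/-- Two concepts that differ at a point would shatter it. Dimension 0 is treated separately because
the growth bound divides by `d`. -/
lemma HasVCDim.eq_of_zero {X : Type*} {C : Set (X → Bool)} (h : HasVCDim C 0) {c c' : X → Bool}
    (hc : c ∈ C) (hc' : c' ∈ C) : c = c' := by
  by_contra hne
  obtain ⟨x, hx⟩ := Function.ne_iff.1 hne
  have h1 : (1 : ℕ) ≤ 0 := h.2 ⟨{x}, card_singleton x, fun f => by
    by_cases hf : c x = f x
    · exact ⟨c, hc, by simpa using hf⟩
    · refine ⟨c', hc', ?_⟩
      simp only [mem_singleton, forall_eq]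
      cases h1 : c x <;> cases h2 : c' x <;> cases h3 : f x <;> simp_all⟩
  omega

/-- Over a class with a single concept the learner makes no error. -/
lemma isHypothesis_of_vcDim_zero (h : HasVCDim C 0) (hC : ∀ c ∈ C, Measurable c) {c : X → Bool}
    (hc : c ∈ C) (D : Measure X) {ε τ : ℝ} (hτ : 0 ≤ τ) {S : Fin n → X × Bool} {f : X → ℝ}
    (hf : f ∈ learnMal C ε S) : IsHypothesis f ∧ error D f c ≤ τ := by
  obtain ⟨t, μ, hμ, rfl, -⟩ := loss_le_of_mem_learnMal hf hc
  have hyp := hμ.isHypothesis hC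
  refine ⟨hyp, ?_⟩
  rw [error_eq_integral D c hyp.2]
  obtain ⟨N, w, a, hw, hw1, ha, hμx⟩ := hμ.exists_mixture
  have : ∀ x, pointErr (gMaj ∘ μ) c x = 0 := by
    intro x
    have h1 : μ x = pm (c x) := by
      rw [hμx]
      simp only [fun i => h.eq_of_zero (ha i) hc]
      rw [← sum_mul, hw1, one_mul]
    have h2 : gMaj 1 = 1 := by rw [gMaj_eq]; norm_num
    have h3 := gMaj_mul_pm 1 (c x)
    rw [one_mul, h2, one_mul] at h3
    rw [pointErr, Function.comp_apply, h1, h3, pm_mul_self]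
    norm_num
  simpa [this] using hτ

/-- The requirements on the sample size, with the constants that are used below. -/
lemma sample_size {α ε δ : ℝ} (hd : 1 ≤ d) (hα : 0 ≤ α) (hε : 0 < ε) (hδ : 0 < δ) (hδ1 : δ < 1)
    (hn : 8000000000 * ((d * Real.log (2 + α / ε) + Real.log (1 / δ)) / (ε * (α + ε))) ≤ n) :
    1 ≤ n ∧
    10000000 * (d * Real.log (2 + α / 4 / (ε / 16)) + Real.log (1 / δ))
      ≤ n * (ε / 16 * (α / 4 + ε / 16)) ∧
    ENNReal.ofReal (Real.exp (-(n * (ε / 16 * (α / 4 + ε / 16)) / 4))) ≤ ENNReal.ofReal (δ / 2) := by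
  have hx : 0 ≤ α / ε := by positivity
  have hd1 : (1 : ℝ) ≤ d := by exact_mod_cast hd
  have hl : 0 < Real.log (1 / δ) := Real.log_pos (by rw [lt_div_iff₀ hδ]; linarith)
  have hΛ : (1 : ℝ) / 2 ≤ Real.log (2 + α / ε) := by
    have h1 := Real.log_two_gt_d9
    have := Real.log_le_log (by norm_num) (show (2 : ℝ) ≤ 2 + α / ε by linarith)
    linarith
  have hΛ3 : Real.log (2 + α / 4 / (ε / 16)) ≤ 3 * Real.log (2 + α / ε) := by
    have e : (3 : ℝ) * Real.log (2 + α / ε) = Real.log ((2 + α / ε) ^ 3) := by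
      rw [Real.log_pow]; norm_num
    rw [e]
    apply Real.log_le_log (by positivity)
    have : α / 4 / (ε / 16) = 4 * (α / ε) := by field_simp; norm_num
    rw [this]
    nlinarith [pow_nonneg hx 3, sq_nonneg (α / ε)]
  have hpos : 0 < ε * (α + ε) := by positivity
  rw [mul_div_assoc', div_le_iff₀ hpos] at hn
  have hD : (1 : ℝ) / 2 ≤ d * Real.log (2 + α / ε) := by nlinarith
  have h16 : (n : ℝ) * (ε * (α + ε)) / 256 ≤ n * (ε / 16 * (α / 4 + ε / 16)) := by
    have : 0 ≤ (n : ℝ) * (ε * α) := by positivity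
    nlinarith
  have h2 : d * Real.log (2 + α / 4 / (ε / 16)) ≤ d * (3 * Real.log (2 + α / ε)) := by gcongr
  refine ⟨?_, by linarith, ?_⟩
  · by_contra hcon
    have : n = 0 := by omega
    subst this
    simp only [Nat.cast_zero, zero_mul] at hn
    linarith
  · apply ENNReal.ofReal_le_ofReal
    calc Real.exp (-(n * (ε / 16 * (α / 4 + ε / 16)) / 4)) ≤ Real.exp (Real.log δ + -1) := by
          apply Real.exp_le_exp.2
          rw [one_div, Real.log_inv] at *
          linarith
      _ = δ * (Real.exp 1)⁻¹ := by rw [Real.exp_add, Real.exp_log hδ, Real.exp_neg]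
      _ ≤ δ * 2⁻¹ := by
          gcongr
          linarith [Real.add_one_le_exp (1 : ℝ)]
      _ = _ := by ring

lemma ofReal_half_add_half {δ : ℝ} (hδ : 0 < δ) :
    ENNReal.ofReal (δ / 2) + ENNReal.ofReal (δ / 2) = ENNReal.ofReal δ := by
  rw [← ENNReal.ofReal_add (by positivity) (by positivity)]
  congr 1; ring

lemma measure_preimage_le_of_map_eq {Ω Z : Type*} [MeasurableSpace Ω] [MeasurableSpace Z]
    {P : Measure Ω} {ν : Measure Z} {Y : Ω → Z} (hY : Measurable Y) (h : P.map Y = ν) (A : Set Z) :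
    P (Y ⁻¹' A) ≤ ν A := by
  rw [← h]
  exact Measure.le_map_apply hY.aemeasurable A

/-- Uniform convergence is applied to the clean sample `x`, which is i.i.d. whatever the adversary
does. On its points outside `J` the error is at most `|J| / 2` by the stopping rule, and on the
points in `J` at most `|J|`. The two factors `1 + α / 4`, from uniform convergence and from
Chernoff's bound on `|J|`, combine to at most `3/2 + α`. -/
theorem learnsNasty.{w} (hvc : HasVCDim C d) (hC : ∀ c ∈ C, Measurable c) {α ε δ ε' : ℝ}
    (hα : 0 ≤ α) (hα1 : α < 1) (hε : 0 < ε) (hε1 : ε < 1) (hδ : 0 < δ) (hδ1 : δ < 1) (hε' : ε' ≤ ε / 8)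
    (hn : 8000000000 * ((d * Real.log (2 + α / ε) + Real.log (1 / δ)) / (ε * (α + ε))) ≤ n)
    (η : unitInterval) :
    LearnsNasty.{_, w} C (learnMal (n := n) C ε') η ((3 / 2 + α) * η + ε) δ := by
  intro c hc D _ hTr Ω _ P _ x J S hS
  have hη0 : (0 : ℝ) ≤ η := η.2.1
  have hη1 : (η : ℝ) ≤ 1 := η.2.2
  rcases Nat.eq_zero_or_pos d with rfl | hd
  · have : {ω | ∃ h ∈ learnMal C ε' (S ω), ¬ (IsHypothesis h ∧ error D h c ≤ (3 / 2 + α) * η + ε)}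
        = ∅ := by
      rw [Set.eq_empty_iff_forall_notMem]
      rintro ω ⟨h, hh, hcon⟩
      exact hcon (isHypothesis_of_vcDim_zero hvc hC hc D (by positivity) hh)
    rw [this]
    simp
  obtain ⟨hn1, hn2, hn3⟩ := sample_size hd hα hε hδ hδ1 hn
  have hn0 : (0 : ℝ) < n := by exact_mod_cast hn1
  let F := majErrors C c (id : X → X) fun _ => true
  let A : Set (Fin n → X) := {z | ∃ f ∈ F,
    (1 + α / 4) * ∑ i, ind (f (z i)) + ε / 16 * n < D.real {z | f z = true} * n}
  have hA : P (x ⁻¹' A) ≤ ENNReal.ofReal (δ / 2) :=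
    (measure_preimage_le_of_map_eq hS.measurable_x hS.law_x A).trans
      (measure_exists_deviation_le hd hn1
        (measurable_majErrors hC (hC c hc) measurable_id measurable_const)
        (traceMeasurable_majErrors hTr (hC c hc) (MeasurePreserving.id D) measurable_const)
        (polyTraces_majErrors hvc hd) (by positivity) (by linarith) (by positivity) hδ hδ1.le hn2)
  have hB : P {ω | (1 + α / 4) * (η * n) + ε / 16 * n < ((J ω).card : ℝ)} ≤ ENNReal.ofReal (δ / 2) := by
    have h1 := measure_lt_le_of_mgf (P := binomial n η) (N := fun k : ℕ => (k : ℝ)) (n := n)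
      (η := η) (α := α / 4) (ε := ε / 16) hη0 hη1 (by positivity) (by linarith) (by positivity)
      (by linarith) (fun t => integrable_binomial _) fun t => (mgf_binomial n η t).le
    exact (measure_preimage_le_of_map_eq hS.measurable_card hS.law_card _).trans (h1.trans hn3)
  calc _ ≤ P (x ⁻¹' A ∪ {ω | (1 + α / 4) * (η * n) + ε / 16 * n < ((J ω).card : ℝ)}) := by
        refine measure_mono fun ω hω => ?_
        by_contra hcon
        simp only [Set.mem_union, Set.mem_preimage, A, Set.mem_ofPred_eq, not_or, not_lt,
          not_exists, not_and] at hcon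
        obtain ⟨hgood, hJ⟩ := hcon
        obtain ⟨h, hh, hbad⟩ := hω
        apply hbad
        obtain ⟨t, μ, hμ, rfl, hloss⟩ := loss_le_of_mem_learnMal hh hc
        have hyp := hμ.isHypothesis hC
        refine ⟨hyp, ?_⟩
        rw [error_eq_integral D c hyp.2]
        have h1 := integral_pointErr_le (ν := D) (π := id) (b := fun _ => true) hC (hC c hc)
          measurable_id measurable_const hgood hμ
        simp only [ind, if_true, one_mul, id] at h1
        set e := ∫ x, pointErr (gMaj ∘ μ) c x ∂D with he
        have h2 := sum_pointErr_compl_le hyp.2 hloss hn1 (J ω) (hS.clean ω)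
        have h3 : ∑ i ∈ J ω, pointErr (gMaj ∘ μ) c (x ω i) ≤ (J ω).card := by
          calc _ ≤ ∑ _i ∈ J ω, (1 : ℝ) := sum_le_sum fun i _ => (pointErr_mem (hyp.2 _)).2
            _ = _ := by simp
        rw [← sum_add_sum_compl (J ω)] at h1
        have h4 : (1 + α / 4) * (∑ i ∈ J ω, pointErr (gMaj ∘ μ) c (x ω i)
            + ∑ i ∈ (J ω)ᶜ, pointErr (gMaj ∘ μ) c (x ω i))
            ≤ (1 + α / 4) * (3 / 2 * ((1 + α / 4) * (η * n) + ε / 16 * n) + ε / 32 * n) := by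
          have : ε' / 4 * n ≤ ε / 32 * n := mul_le_mul_of_nonneg_right (by linarith) hn0.le
          exact mul_le_mul_of_nonneg_left (by linarith) (by positivity)
        have h5 : e * n ≤ ((3 / 2 + α) * η + ε) * n := by
          have hηn : 0 ≤ η * (n : ℝ) := by positivity
          have hεn : 0 ≤ ε * (n : ℝ) := by positivity
          have h6 : (1 + α / 4) * (3 / 2 * ((1 + α / 4) * (η * n))) ≤ (3 / 2 + α) * (η * n) := by
            have : (1 + α / 4) * (3 / 2 * (1 + α / 4)) ≤ 3 / 2 + α := by nlinarith
            calc _ = (1 + α / 4) * (3 / 2 * (1 + α / 4)) * (η * n) := by ring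
              _ ≤ _ := by gcongr
          have h7 : α * (ε * n) ≤ 1 * (ε * n) := by gcongr
          nlinarith
        exact le_of_mul_le_mul_right h5 hn0
    _ ≤ _ := measure_union_le _ _
    _ ≤ ENNReal.ofReal (δ / 2) + ENNReal.ofReal (δ / 2) := add_le_add hA hB
    _ = _ := ofReal_half_add_half hδ

/-- The dataset is not i.i.d., but the pairs of clean point and coin are. Uniform convergence for
the error indicators restricted to uncorrupted rounds controls `(1 - η)` times the error, and those
rounds are exactly the ones that the stopping rule controls. -/
theorem learnsMalicious.{w} (hvc : HasVCDim C d) (hC : ∀ c ∈ C, Measurable c) {α ε δ ε' : ℝ}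
    (hα : 0 ≤ α) (hα1 : α < 1) (hε : 0 < ε) (hε1 : ε < 1) (hδ : 0 < δ) (hδ1 : δ < 1) (hε' : ε' ≤ ε / 8)
    (hn : 8000000000 * ((d * Real.log (2 + α / ε) + Real.log (1 / δ)) / (ε * (α + ε))) ≤ n)
    (η : unitInterval) (hη : (η : ℝ) < 1) :
    LearnsMalicious.{_, w} C (learnMal (n := n) C ε') η (ε + (1 / 2 + α) * (η / (1 - η))) δ := by
  intro c hc D _ hTr Ω _ P _ Fl x B S hS
  have hη0 : (0 : ℝ) ≤ η := η.2.1
  have hη1 : (η : ℝ) ≤ 1 := η.2.2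
  have hη' : 0 < 1 - (η : ℝ) := by linarith
  rcases Nat.eq_zero_or_pos d with rfl | hd
  · have : {ω | ∃ h ∈ learnMal C ε' (S ω),
        ¬ (IsHypothesis h ∧ error D h c ≤ ε + (1 / 2 + α) * (η / (1 - η)))} = ∅ := by
      rw [Set.eq_empty_iff_forall_notMem]
      rintro ω ⟨h, hh, hcon⟩
      exact hcon (isHypothesis_of_vcDim_zero hvc hC hc D (by positivity) hh)
    rw [this]
    simp
  obtain ⟨hn1, hn2, hn3⟩ := sample_size hd hα hε hδ hδ1 hn
  have hn0 : (0 : ℝ) < n := by exact_mod_cast hn1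
  set β : Measure Bool := bernoulliMeasure true false η with hβ
  set ν : Measure (X × Bool) := D.prod β with hν
  let b : X × Bool → Bool := fun z => !z.2
  have hbm : Measurable b := (measurable_of_finite not).comp measurable_snd
  have hfst : MeasurePreserving Prod.fst ν D := measurePreserving_fst
  let Y : Ω → Fin n → X × Bool := fun ω i => (x ω i, B ω i)
  have hYF : ∀ i : Fin n, Measurable[Fl (i.val + 1)] fun ω => Y ω i := fun i =>
    (hS.measurable_x i).prodMk (hS.measurable_B i)
  have hY : Measurable Y := measurable_pi_lambda _ fun i => (hYF i).mono (Fl.le _) le_rfl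
  have hlaw : P.map Y = Measure.pi fun _ => ν := map_eq_pi_of_indep Fl hYF hS.law hS.indep
  let F := majErrors C c (Prod.fst : X × Bool → X) b
  let A : Set (Fin n → X × Bool) := {z | ∃ f ∈ F,
    (1 + α / 4) * ∑ i, ind (f (z i)) + ε / 16 * n < ν.real {z | f z = true} * n}
  have hA : P (Y ⁻¹' A) ≤ ENNReal.ofReal (δ / 2) :=
    (measure_preimage_le_of_map_eq hY hlaw A).trans
      (measure_exists_deviation_le hd hn1
        (measurable_majErrors hC (hC c hc) measurable_fst hbm)
        (traceMeasurable_majErrors hTr (hC c hc) hfst hbm)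
        (polyTraces_majErrors hvc hd) (by positivity) (by linarith) (by positivity) hδ hδ1.le hn2)
  have hB : P {ω | (1 + α / 4) * (η * n) + ε / 16 * n < ∑ i, ind (B ω i)}
      ≤ ENNReal.ofReal (δ / 2) := by
    have hm : Measurable fun ω i => B ω i :=
      measurable_pi_lambda _ fun i => (hS.measurable_B i).mono (Fl.le _) le_rfl
    have hlawB : P.map (fun ω i => B ω i) = Measure.pi fun _ => β := by
      have hsnd : MeasurePreserving (fun (z : Fin n → X × Bool) i => (z i).2)
          (Measure.pi fun _ => ν) (Measure.pi fun _ => β) :=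
        measurePreserving_pi (fun _ => ν) (fun _ => β) fun _ => measurePreserving_snd
      rw [← hsnd.map_eq, ← hlaw, Measure.map_map hsnd.measurable hY]
      rfl
    have h1 := measure_lt_le_of_mgf (P := Measure.pi fun _ : Fin n => β)
      (N := fun v : Fin n → Bool => ∑ i, ind (v i)) (n := n)
      (η := η) (α := α / 4) (ε := ε / 16) hη0 hη1 (by positivity) (by linarith) (by positivity)
      (by linarith) (fun t => .of_finite) fun t => (mgf_count_pi_bernoulli n η t).le
    exact (measure_preimage_le_of_map_eq hm hlawB _).trans (h1.trans hn3)
  calc _ ≤ P (Y ⁻¹' A ∪ {ω | (1 + α / 4) * (η * n) + ε / 16 * n < ∑ i, ind (B ω i)}) := by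
        refine measure_mono fun ω hω => ?_
        by_contra hcon
        simp only [Set.mem_union, Set.mem_preimage, A, Set.mem_ofPred_eq, not_or, not_lt,
          not_exists, not_and] at hcon
        obtain ⟨hgood, hJ⟩ := hcon
        obtain ⟨h, hh, hbad⟩ := hω
        apply hbad
        obtain ⟨t, μ, hμ, rfl, hloss⟩ := loss_le_of_mem_learnMal hh hc
        have hyp := hμ.isHypothesis hC
        refine ⟨hyp, ?_⟩
        rw [error_eq_integral D c hyp.2]
        have h1 := integral_pointErr_le (ν := ν) (π := Prod.fst) hC (hC c hc) measurable_fst hbm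
          hgood hμ
        have hprod : ∫ z, ind (b z) * pointErr (gMaj ∘ μ) c z.1 ∂ν
            = (1 - η) * ∫ x, pointErr (gMaj ∘ μ) c x ∂D := by
          have h2 := integral_prod_mul (μ := D) (ν := β) (fun x => pointErr (gMaj ∘ μ) c x)
            fun y => ind (!y)
          have h3 : ∫ y, ind (!y) ∂β = 1 - η := by
            rw [hβ, integral_bernoulliMeasure]; simp [ind]
          rw [h3, mul_comm] at h2
          rw [← h2]
          exact integral_congr_ae (ae_of_all _ fun z => mul_comm _ _)
        rw [hprod] at h1
        set e := ∫ x, pointErr (gMaj ∘ μ) c x ∂D with he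
        have he1 : e ≤ 1 := by
          have : ∀ x, ‖pointErr (gMaj ∘ μ) c x‖ ≤ 1 := fun x => by
            have := pointErr_mem (c := c) (hyp.2 x)
            rw [Real.norm_eq_abs, abs_of_nonneg this.1]
            exact this.2
          have h5 := norm_integral_le_of_norm_le_const (μ := D) (ae_of_all _ this)
          rw [probReal_univ, mul_one] at h5
          exact (le_abs_self _).trans h5
        -- For large `η` the claimed bound exceeds 1. Otherwise `ε (1 - η) ≥ ε / 3`, which leaves
        -- room for the additive errors after dividing by `1 - η`.
        rcases le_or_gt (2 / 3) (η : ℝ) with hη3 | hη3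
        · have h6 : 2 ≤ (η : ℝ) / (1 - η) := by rw [le_div_iff₀ hη']; linarith
          nlinarith
        set J : Finset (Fin n) := univ.filter fun i => B ω i = true with hJdef
        have hJc : ∑ i, ind (B ω i) = J.card := by
          rw [hJdef, card_filter]
          push_cast
          rfl
        have h2 := sum_pointErr_compl_le hyp.2 hloss hn1 J (x := fun i => x ω i) (fun i hi => by
          refine hS.clean ω i ?_
          simpa [hJdef] using hi)
        have h3 : ∑ i, ind (b (Y ω i)) * pointErr (gMaj ∘ μ) c (Y ω i).1
            = ∑ i ∈ Jᶜ, pointErr (gMaj ∘ μ) c (x ω i) := by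
          have : Jᶜ = univ.filter fun i => B ω i = false := by
            ext i; simp [hJdef]
          rw [this, sum_filter]
          refine sum_congr rfl fun i _ => ?_
          simp only [b, Y]
          cases B ω i <;> simp [ind]
        rw [h3] at h1
        rw [hJc] at hJ
        have h4 : (1 + α / 4) * ∑ i ∈ Jᶜ, pointErr (gMaj ∘ μ) c (x ω i)
            ≤ (1 + α / 4) * (1 / 2 * ((1 + α / 4) * (η * n) + ε / 16 * n) + ε / 32 * n) := by
          have : ε' / 4 * n ≤ ε / 32 * n := mul_le_mul_of_nonneg_right (by linarith) hn0.le
          exact mul_le_mul_of_nonneg_left (by linarith) (by positivity)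
        have h5 : (1 - η) * e * n ≤ ((1 / 2 + α) * η + ε / 3) * n := by
          have hηn : 0 ≤ η * (n : ℝ) := by positivity
          have hεn : 0 ≤ ε * (n : ℝ) := by positivity
          have h6 : (1 + α / 4) * (1 / 2 * ((1 + α / 4) * (η * n))) ≤ (1 / 2 + α) * (η * n) := by
            have : (1 + α / 4) * (1 / 2 * (1 + α / 4)) ≤ 1 / 2 + α := by nlinarith
            calc _ = (1 + α / 4) * (1 / 2 * (1 + α / 4)) * (η * n) := by ring
              _ ≤ _ := by gcongr
          have h7 : α * (ε * n) ≤ 1 * (ε * n) := by gcongr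
          nlinarith
        have h6 := le_of_mul_le_mul_right h5 hn0
        have h7 : ε / 3 ≤ ε * (1 - η) := by nlinarith
        have h8 : (1 - η) * e ≤ (1 - η) * (ε + (1 / 2 + α) * (η / (1 - η))) := by
          have : (1 - (η : ℝ)) * (ε + (1 / 2 + α) * (η / (1 - η))) = ε * (1 - η) + (1 / 2 + α) * η := by
            field_simp
          rw [this]
          linarith
        exact le_of_mul_le_mul_left h8 hη'
    _ ≤ _ := measure_union_le _ _
    _ ≤ ENNReal.ofReal (δ / 2) + ENNReal.ofReal (δ / 2) := add_le_add hA hB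
    _ = _ := ofReal_half_add_half hδ

end LearningWithNoise

/-! ### Polynomial time bounds -/

section TimeBounds

/-- A bound on the value of an expression if the memory is bounded by `M`. -/
def Expr.valBound (M : ℕ) : Expr → ℕ
  | .const k => k
  | .read _ => M
  | .add a b => a.valBound M + b.valBound M
  | .sub a _ => a.valBound M
  | .mul a b => a.valBound M * b.valBound M
  | .div a _ => a.valBound M
  | .label _ => 1
  | .app _ _ => 1

/-- A bound on the cost of an expression if the memory is bounded by `M`. -/
def Expr.costBound (M : ℕ) (e : Expr) : ℕ :=
  1 + e.valBound M + match e with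
    | .const _ => 0
    | .read a => a.costBound M
    | .add a b => a.costBound M + b.costBound M
    | .sub a b => a.costBound M + b.costBound M
    | .mul a b => a.costBound M + b.costBound M
    | .div a b => a.costBound M + b.costBound M
    | .label a => a.costBound M
    | .app a b => a.costBound M + b.costBound M

/-- A bound on the running time of a program if the memory is bounded by `M` and every loop is
repeated at most `M` times. -/
def Prog.timeBound (M : ℕ) : Prog → ℕ
  | .skip => 1
  | .assign a v => 1 + a.costBound M + v.costBound M
  | .push i b => 1 + i.costBound M + b.costBound M
  | .erm => 1
  | .emit k w => 1 + k.costBound M + w.costBound M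
  | .seq p q => 1 + p.timeBound M + q.timeBound M
  | .ite e p q => 1 + e.costBound M + (p.timeBound M + q.timeBound M)
  | .loop e p => (M + 1) * (1 + e.costBound M + p.timeBound M)

/-- Functions with a polynomial upper bound. -/
def PolyBounded (f : ℕ → ℕ) : Prop := ∃ K : ℕ, ∀ M, f M ≤ K * (M + 1) ^ K

lemma PolyBounded.mono {f g : ℕ → ℕ} (hg : PolyBounded g) (h : ∀ M, f M ≤ g M) : PolyBounded f := by
  obtain ⟨K, hK⟩ := hg
  exact ⟨K, fun M => (h M).trans (hK M)⟩

lemma polyBounded_const (k : ℕ) : PolyBounded fun _ => k :=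
  ⟨k, fun M => Nat.le_mul_of_pos_right _ (by positivity)⟩

lemma polyBounded_id : PolyBounded fun M => M := ⟨1, fun M => by simp⟩

lemma PolyBounded.add {f g : ℕ → ℕ} (hf : PolyBounded f) (hg : PolyBounded g) :
    PolyBounded fun M => f M + g M := by
  obtain ⟨K, hK⟩ := hf
  obtain ⟨L, hL⟩ := hg
  refine ⟨K + L, fun M => ?_⟩
  calc f M + g M ≤ K * (M + 1) ^ K + L * (M + 1) ^ L := add_le_add (hK M) (hL M)
    _ ≤ K * (M + 1) ^ (K + L) + L * (M + 1) ^ (K + L) := by gcongr <;> omega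
    _ = _ := by ring

lemma PolyBounded.mul {f g : ℕ → ℕ} (hf : PolyBounded f) (hg : PolyBounded g) :
    PolyBounded fun M => f M * g M := by
  obtain ⟨K, hK⟩ := hf
  obtain ⟨L, hL⟩ := hg
  refine ⟨K + L + K * L, fun M => ?_⟩
  calc f M * g M ≤ K * (M + 1) ^ K * (L * (M + 1) ^ L) := Nat.mul_le_mul (hK M) (hL M)
    _ = K * L * (M + 1) ^ (K + L) := by ring
    _ ≤ (K + L + K * L) * (M + 1) ^ (K + L + K * L) :=
      Nat.mul_le_mul (Nat.le_add_left _ _)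
        (Nat.pow_le_pow_right (Nat.succ_pos M) (Nat.le_add_right _ _))

lemma PolyBounded.pow {f : ℕ → ℕ} (hf : PolyBounded f) (k : ℕ) : PolyBounded fun M => f M ^ k := by
  induction k with
  | zero => simpa using polyBounded_const 1
  | succ k ih => simpa only [pow_succ] using ih.mul hf

lemma PolyBounded.comp {f g : ℕ → ℕ} (hf : PolyBounded f) (hg : PolyBounded g) :
    PolyBounded fun M => f (g M) := by
  obtain ⟨K, hK⟩ := hf
  exact ((polyBounded_const K).mul ((hg.add (polyBounded_const 1)).pow K)).mono fun M => hK (g M)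

lemma Expr.polyBounded_valBound (e : Expr) : PolyBounded fun M => e.valBound M := by
  induction e with
  | const k => exact polyBounded_const k
  | read a _ => exact polyBounded_id
  | add a b iha ihb => exact iha.add ihb
  | sub a b iha _ => exact iha
  | mul a b iha ihb => exact iha.mul ihb
  | div a b iha _ => exact iha
  | label a _ => exact polyBounded_const 1
  | app a b _ _ => exact polyBounded_const 1

lemma Expr.polyBounded_costBound (e : Expr) : PolyBounded fun M => e.costBound M := by
  have h1 : ∀ e : Expr, PolyBounded fun M => 1 + e.valBound M := fun e =>
    (polyBounded_const 1).add e.polyBounded_valBound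
  induction e with
  | const k => exact h1 (.const k)
  | read a iha => exact (h1 (.read a)).add iha
  | add a b iha ihb => exact (h1 (.add a b)).add (iha.add ihb)
  | sub a b iha ihb => exact (h1 (.sub a b)).add (iha.add ihb)
  | mul a b iha ihb => exact (h1 (.mul a b)).add (iha.add ihb)
  | div a b iha ihb => exact (h1 (.div a b)).add (iha.add ihb)
  | label a iha => exact (h1 (.label a)).add iha
  | app a b iha ihb => exact (h1 (.app a b)).add (iha.add ihb)

lemma Prog.polyBounded_timeBound (p : Prog) : PolyBounded fun M => p.timeBound M := by
  have h1 := polyBounded_const 1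
  induction p with
  | skip => exact h1
  | assign a v => exact (h1.add a.polyBounded_costBound).add v.polyBounded_costBound
  | push a v => exact (h1.add a.polyBounded_costBound).add v.polyBounded_costBound
  | erm => exact h1
  | emit a v => exact (h1.add a.polyBounded_costBound).add v.polyBounded_costBound
  | seq p q hp hq => exact (h1.add hp).add hq
  | ite e p q hp hq => exact (h1.add e.polyBounded_costBound).add (hp.add hq)
  | loop e p hp =>
    exact (polyBounded_id.add h1).mul ((h1.add e.polyBounded_costBound).add hp)

end TimeBounds

/-! ### Verification of programs -/

section Verification

variable {X : Type*} {n : ℕ} {S : Fin n → X × Bool} {E : ℕ → List (X × Bool) → X → Bool} {M : ℕ}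

/-- All numbers in the memory are at most `M`. -/
def Config.BoundedBy (M : ℕ) (s : Config X) : Prop := ∀ a, s.mem a ≤ M

lemma Expr.val_le {s : Config X} (hs : s.BoundedBy M) (e : Expr) : e.val S s ≤ e.valBound M := by
  induction e with
  | const k => exact le_rfl
  | read a _ => exact hs _
  | add a b iha ihb => exact add_le_add iha ihb
  | sub a b iha _ => exact (Nat.sub_le _ _).trans iha
  | mul a b iha ihb => exact Nat.mul_le_mul iha ihb
  | div a b iha _ => exact (Nat.div_le_self _ _).trans iha
  | label a _ =>
    simp only [Expr.val, Expr.valBound]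
    split_ifs
    · exact Bool.toNat_le _
    · omega
  | app a b _ _ =>
    simp only [Expr.val, Expr.valBound]
    split_ifs
    · exact Bool.toNat_le _
    · omega

/-- Bit lengths are bounded by the values themselves. This is harmless, since the numbers in memory
will be polynomially bounded. -/
lemma Expr.cost_le {s : Config X} (hs : s.BoundedBy M) (e : Expr) :
    e.cost S s ≤ e.costBound M := by
  have h1 : ∀ e : Expr, 1 + (e.val S s).size ≤ 1 + e.valBound M := fun e => by
    have h2 : (e.val S s).size ≤ e.val S s := Nat.size_le.2 Nat.lt_two_pow_self
    have := Expr.val_le (S := S) hs e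
    omega
  induction e with
  | const k => exact add_le_add (h1 _) le_rfl
  | read a iha => exact add_le_add (h1 _) iha
  | add a b iha ihb => exact add_le_add (h1 _) (add_le_add iha ihb)
  | sub a b iha ihb => exact add_le_add (h1 _) (add_le_add iha ihb)
  | mul a b iha ihb => exact add_le_add (h1 _) (add_le_add iha ihb)
  | div a b iha ihb => exact add_le_add (h1 _) (add_le_add iha ihb)
  | label a iha => exact add_le_add (h1 _) iha
  | app a b iha ihb => exact add_le_add (h1 _) (add_le_add iha ihb)

/-- Started in `s`, the program halts within its time bound in a configuration that satisfies `Q`. -/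
def Runs (S : Fin n → X × Bool) (E : ℕ → List (X × Bool) → X → Bool) (M : ℕ) (p : Prog)
    (s : Config X) (Q : Config X → Prop) : Prop :=
  ∃ s' T, Exec S E p s s' T ∧ T ≤ p.timeBound M ∧ Q s'

lemma Runs.mono {p : Prog} {s : Config X} {Q Q' : Config X → Prop} (h : Runs S E M p s Q)
    (hQ : ∀ s', Q s' → Q' s') : Runs S E M p s Q' := by
  obtain ⟨s', T, h1, h2, h3⟩ := h
  exact ⟨s', T, h1, h2, hQ _ h3⟩

lemma Runs.assign {a v : Expr} {s : Config X} {Q : Config X → Prop} (hs : s.BoundedBy M)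
    (hQ : Q (s.write (a.val S s) (v.val S s))) : Runs S E M (.assign a v) s Q := by
  refine ⟨_, _, .assign a v s, ?_, hQ⟩
  have h1 := Expr.cost_le (S := S) hs a
  have h2 := Expr.cost_le (S := S) hs v
  simp only [Prog.timeBound]; omega

lemma Runs.push {i b : Expr} {s : Config X} {Q : Config X → Prop} (hs : s.BoundedBy M)
    (hQ : Q (s.pushQuery S (i.val S s) (decide (b.val S s ≠ 0)))) :
    Runs S E M (.push i b) s Q := by
  refine ⟨_, _, .push i b s, ?_, hQ⟩
  have h1 := Expr.cost_le (S := S) hs i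
  have h2 := Expr.cost_le (S := S) hs b
  simp only [Prog.timeBound]; omega

lemma Runs.erm {s : Config X} {Q : Config X → Prop} (hQ : Q (s.call E)) : Runs S E M .erm s Q :=
  ⟨_, _, .erm s, le_rfl, hQ⟩

lemma Runs.emit {k w : Expr} {s : Config X} {Q : Config X → Prop} (hs : s.BoundedBy M)
    (hQ : Q (s.emitOut (k.val S s) (w.val S s))) : Runs S E M (.emit k w) s Q := by
  refine ⟨_, _, .emit k w s, ?_, hQ⟩
  have h1 := Expr.cost_le (S := S) hs k
  have h2 := Expr.cost_le (S := S) hs w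
  simp only [Prog.timeBound]; omega

lemma Runs.seq {p q : Prog} {s : Config X} {Q : Config X → Prop}
    (h : Runs S E M p s fun s' => Runs S E M q s' Q) : Runs S E M (.seq p q) s Q := by
  obtain ⟨s₁, T₁, h1, h2, s₂, T₂, h3, h4, h5⟩ := h
  refine ⟨s₂, _, .seq p q _ _ _ _ _ h1 h3, ?_, h5⟩
  simp only [Prog.timeBound]; omega

lemma Runs.ite {e : Expr} {p q : Prog} {s : Config X} {Q : Config X → Prop} (hs : s.BoundedBy M)
    (h1 : e.val S s ≠ 0 → Runs S E M p s Q) (h2 : e.val S s = 0 → Runs S E M q s Q) :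
    Runs S E M (.ite e p q) s Q := by
  have hc := Expr.cost_le (S := S) hs e
  by_cases he : e.val S s = 0
  · obtain ⟨s', T, h3, h4, h5⟩ := h2 he
    refine ⟨s', _, .ite_false e p q _ _ _ he h3, ?_, h5⟩
    simp only [Prog.timeBound]; omega
  · obtain ⟨s', T, h3, h4, h5⟩ := h1 he
    refine ⟨s', _, .ite_true e p q _ _ _ he h3, ?_, h5⟩
    simp only [Prog.timeBound]; omega

/-- The rule for loops, with an invariant `I i` after `i` repetitions. -/
lemma Runs.loop {e : Expr} {p : Prog} {s : Config X} {Q : Config X → Prop}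
    (I : ℕ → Config X → Prop)
    (hI : ∀ i s, I i s → i ≤ M ∧ s.BoundedBy M ∧
      ((e.val S s = 0 ∧ Q s) ∨ (e.val S s ≠ 0 ∧ Runs S E M p s (I (i + 1)))))
    (h0 : I 0 s) : Runs S E M (.loop e p) s Q := by
  have key : ∀ k i s, k + i = M → I i s → ∃ s' T, Exec S E (.loop e p) s s' T ∧
      T ≤ (k + 1) * (1 + e.costBound M + p.timeBound M) ∧ Q s' := by
    intro k
    induction k with
    | zero =>
      intro i s hki hIs
      obtain ⟨-, h2, h3⟩ := hI i s hIs
      have hc := Expr.cost_le (S := S) h2 e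
      rcases h3 with ⟨h3, h4⟩ | ⟨-, s', T, -, -, h5⟩
      · exact ⟨s, _, .loop_done e p s h3, by omega, h4⟩
      -- Here `i = M`, and one more repetition would establish the invariant at `M + 1`, beyond its
      -- range.
      · have := (hI _ _ h5).1
        omega
    | succ k ih =>
      intro i s hki hIs
      obtain ⟨-, h2, h3⟩ := hI i s hIs
      have hc := Expr.cost_le (S := S) h2 e
      rcases h3 with ⟨h3, h4⟩ | ⟨h3, s', T, h4, h5, h6⟩
      · refine ⟨s, _, .loop_done e p s h3, ?_, h4⟩
        nlinarith
      · obtain ⟨s'', T', h7, h8, h9⟩ := ih (i + 1) s' (by omega) h6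
        refine ⟨s'', _, .loop_step e p _ _ _ _ _ h3 h4 h7, ?_, h9⟩
        nlinarith
  obtain ⟨s', T, h1, h2, h3⟩ := key M 0 s (by omega) h0
  exact ⟨s', T, h1, h2, h3⟩

lemma Config.BoundedBy.write {s : Config X} (hs : s.BoundedBy M) {a v : ℕ} (hv : v ≤ M) :
    (s.write a v).BoundedBy M := by
  intro b
  simp only [Config.write, Function.update_apply]
  split_ifs
  · exact hv
  · exact hs b

lemma Config.write_mem (s : Config X) (a v b : ℕ) :
    (s.write a v).mem b = if b = a then v else s.mem b := by
  simp [Config.write, Function.update_apply]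

end Verification

/-! ### The mixtures of the learner in integer arithmetic -/

section Arithmetic

variable {X : Type*} {n : ℕ}

/-- The mixture of the first `t` concepts, in which concept number `s` has a weight proportional to
`s + 1`. -/
noncomputable def mix (c : ℕ → X → Bool) (t : ℕ) (x : X) : ℝ :=
  (∑ s ∈ Finset.range t, (2 * ((s : ℝ) + 1)) * pm (c s x)) / (t * (t + 1))

lemma sum_weights (t : ℕ) : ∑ s ∈ Finset.range t, 2 * (s + 1) = t * (t + 1) := by
  induction t with
  | zero => rfl
  | succ t ih => rw [Finset.sum_range_succ, ih]; ring

lemma mix_one (c : ℕ → X → Bool) : mix c 1 = fun x => pm (c 0 x) := by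
  ext x; norm_num [mix]

/-- The factor `1 - 2 / (t + 2) = t / (t + 2)` is the ratio of consecutive normalizations `t (t +
1)` and `(t + 1) (t + 2)`. So the unnormalized integer weights `2 (s + 1)` never change. -/
lemma mix_succ (c : ℕ → X → Bool) {t : ℕ} (ht : 1 ≤ t) :
    mix c (t + 1) = fun x => (1 - 2 / ((t : ℝ) + 2)) * mix c t x + 2 / ((t : ℝ) + 2) * pm (c t x) := by
  ext x
  have : (0 : ℝ) < t := by exact_mod_cast ht
  simp only [mix, Finset.sum_range_succ]
  push_cast
  field_simp
  ring

lemma mix_congr {c c' : ℕ → X → Bool} {t : ℕ} (h : ∀ s < t, c s = c' s) : mix c t = mix c' t := by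
  ext x
  simp only [mix]
  congr 1
  exact Finset.sum_congr rfl fun s hs => by rw [h s (Finset.mem_range.1 hs)]

/-- The weight of those of the first `t` concepts that err on the example `e`. -/
def errWeight (c : ℕ → X → Bool) (t : ℕ) (e : X × Bool) : ℕ :=
  ∑ s ∈ Finset.range t, if c s e.1 = e.2 then 0 else 2 * (s + 1)

lemma errWeight_le (c : ℕ → X → Bool) (t : ℕ) (e : X × Bool) : errWeight c t e ≤ t * (t + 1) := by
  rw [← sum_weights]
  exact Finset.sum_le_sum fun s _ => by split_ifs <;> omega

lemma pm_mul_pm (a b : Bool) : pm a * pm b = if a = b then 1 else -1 := by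
  cases a <;> cases b <;> norm_num [pm]

lemma mix_mul_pm (c : ℕ → X → Bool) (t : ℕ) (e : X × Bool) :
    mix c t e.1 * pm e.2 =
      (((t * (t + 1) : ℕ) : ℝ) - 2 * errWeight c t e) / ((t * (t + 1) : ℕ) : ℝ) := by
  rw [mix, div_mul_eq_mul_div, ← sum_weights, errWeight]
  congr 1
  · push_cast
    rw [Finset.sum_mul, Finset.mul_sum, ← Finset.sum_sub_distrib]
    refine Finset.sum_congr rfl fun s _ => ?_
    rw [mul_assoc, pm_mul_pm]
    split_ifs <;> ring
  · rw [sum_weights]; push_cast; ring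

/-- The numerator of `1 - gMaj ((W - 2 N) / W)` over the denominator `gapDen W`. -/
def gapNum (W N : ℕ) : ℕ :=
  32 * N ^ 4 * (N ^ 3 + 7 * (W - N) * N ^ 2 + 21 * (W - N) ^ 2 * N + 35 * (W - N) ^ 3)
    + 6 * N * W ^ 6

/-- The common denominator of the values of `gMaj` at the multiples of `1 / W`. -/
def gapDen (W : ℕ) : ℕ := 19 * W ^ 7

/-- If each voter errs with probability `N / W`, then `1 - M₇` is twice the probability of at least
four errors among seven. This gives the four binomial terms in `gapNum`; the linear part of `g`
gives `6 N W ^ 6`. -/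
lemma gapNum_div {W N : ℕ} (hW : 0 < W) (hN : N ≤ W) :
    (gapNum W N : ℝ) / gapDen W = 1 - gMaj (((W : ℝ) - 2 * N) / W) := by
  have hW' : (0 : ℝ) < W := by exact_mod_cast hW
  rw [gMaj_eq, gapNum, gapDen]
  push_cast [Nat.cast_sub hN]
  field_simp
  ring

lemma gapNum_le {W N : ℕ} (hN : N ≤ W) : gapNum W N ≤ 2 * gapDen W := by
  obtain ⟨P, rfl⟩ := Nat.exists_eq_add_of_le hN
  rw [gapNum, gapDen, Nat.add_sub_cancel_left]
  have h1 : 32 * N ^ 4 * (N ^ 3 + 7 * P * N ^ 2 + 21 * P ^ 2 * N + 35 * P ^ 3)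
      ≤ 32 * (N + P) ^ 7 := by
    -- Adding the mirror image, at least four correct votes, completes the expansion of `(N + P) ^
    -- 7`.
    calc _ ≤ 32 * N ^ 4 * (N ^ 3 + 7 * P * N ^ 2 + 21 * P ^ 2 * N + 35 * P ^ 3)
        + 32 * P ^ 4 * (P ^ 3 + 7 * N * P ^ 2 + 21 * N ^ 2 * P + 35 * N ^ 3) := Nat.le_add_right _ _
      _ = _ := by ring
  have h2 : 6 * N * (N + P) ^ 6 ≤ 6 * (N + P) * (N + P) ^ 6 := by gcongr
  calc _ ≤ 32 * (N + P) ^ 7 + 6 * (N + P) * (N + P) ^ 6 := add_le_add h1 h2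
    _ = _ := by ring

lemma gMaj_mix_mul_pm (c : ℕ → X → Bool) {t : ℕ} (ht : 1 ≤ t) (e : X × Bool) :
    gMaj (mix c t e.1) * pm e.2 =
      1 - (gapNum (t * (t + 1)) (errWeight c t e) : ℝ) / gapDen (t * (t + 1)) := by
  rw [gapNum_div (by positivity) (errWeight_le c t e), ← mix_mul_pm c t, gMaj_mul_pm]
  ring

/-- The multiplicity of the example `e` in the dataset for the oracle. -/
def queryMult (q : ℕ) (c : ℕ → X → Bool) (t : ℕ) (e : X × Bool) : ℕ :=
  320 * q * (gapDen (t * (t + 1)) + gapNum (t * (t + 1)) (errWeight c t e)) / gapDen (t * (t + 1))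

lemma gapDen_pos {t : ℕ} (ht : 1 ≤ t) : 0 < gapDen (t * (t + 1)) := by
  unfold gapDen; positivity

lemma queryMult_le (q : ℕ) (c : ℕ → X → Bool) (t : ℕ) (e : X × Bool) :
    queryMult q c t e ≤ 960 * q := by
  have h1 := gapNum_le (errWeight_le c t e)
  refine Nat.div_le_of_le_mul ?_
  calc _ ≤ 320 * q * (gapDen (t * (t + 1)) + 2 * gapDen (t * (t + 1))) := by gcongr
    _ = _ := by ring

lemma abs_queryMult_sub_le {q : ℕ} (hq : 1 ≤ q) (c : ℕ → X → Bool) {t : ℕ} (ht : 1 ≤ t)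
    (e : X × Bool) :
    |2 - gMaj (mix c t e.1) * pm e.2 - (queryMult q c t e : ℝ) / (320 * q)| ≤ 1 / (320 * q) := by
  have hZ : (0 : ℝ) < gapDen (t * (t + 1)) := by exact_mod_cast gapDen_pos ht
  have hq' : (0 : ℝ) < 320 * q := by positivity
  have hval : 2 - gMaj (mix c t e.1) * pm e.2
      = (((320 * q * (gapDen (t * (t + 1)) + gapNum (t * (t + 1)) (errWeight c t e)) : ℕ) : ℝ)
        / gapDen (t * (t + 1))) / (320 * q) := by
    rw [gMaj_mix_mul_pm c ht]; push_cast; field_simp; ring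
  set a := 320 * q * (gapDen (t * (t + 1)) + gapNum (t * (t + 1)) (errWeight c t e))
  have h1 : (queryMult q c t e : ℝ) ≤ (a : ℝ) / gapDen (t * (t + 1)) := Nat.cast_div_le
  have h2 : (a : ℝ) / gapDen (t * (t + 1)) < queryMult q c t e + 1 := by
    rw [div_lt_iff₀ hZ]
    exact_mod_cast (Nat.div_lt_iff_lt_mul (gapDen_pos ht)).1 (Nat.lt_succ_self (queryMult q c t e))
  rw [hval, ← sub_div, abs_div, abs_of_pos hq', div_le_div_iff_of_pos_right hq', abs_le]
  constructor <;> linarith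

/-- The multiplicities are the weights `2 - g(μ) y` scaled by `320 q` and rounded down. Two concepts
differ by at most 2 on an example, so rounding costs `2 / (320 q)` on average, which is `1 / 20` of
the accuracy `1 / (8 q)`. -/
lemma approxMax_of_isERM {C : Set (X → Bool)} {S : Fin n → X × Bool} {q : ℕ} (hq : 1 ≤ q)
    {c : ℕ → X → Bool} {t : ℕ} (ht : 1 ≤ t) {Q : List (X × Bool)}
    (hQ : ∀ f : X × Bool → ℝ, (Q.map f).sum = ∑ i, queryMult q c t (S i) * f (S i))
    {h : X → Bool} (hh : IsERM C Q h) : ApproxMax C S (1 / (8 * q)) (gMaj ∘ mix c t) h := by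
  refine ⟨hh.1, fun c' hc' => ?_⟩
  have hq' : (0 : ℝ) < q := by exact_mod_cast hq
  have h1 := hh.2 c' hc'
  rw [hQ, hQ] at h1
  rcases Nat.eq_zero_or_pos n with rfl | hn
  · simp only [loss, Finset.univ_eq_empty, Finset.sum_empty, zero_div, zero_sub]
    have : (0 : ℝ) ≤ 1 / (8 * q) / 20 := by positivity
    linarith
  have hn' : (0 : ℝ) < n := by exact_mod_cast hn
  rw [sub_le_iff_le_add, loss, loss, div_le_iff₀ hn', add_mul, div_mul_cancel₀ _ hn'.ne']
  have h2 : ∑ i, ((pm (c' (S i).1) * pm (S i).2 - pm (h (S i).1) * pm (S i).2)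
      * (2 - gMaj (mix c t (S i).1) * pm (S i).2)) ≤
      ∑ i, ((pm (c' (S i).1) * pm (S i).2 - pm (h (S i).1) * pm (S i).2)
        * (queryMult q c t (S i) / (320 * q)) + 2 * (1 / (320 * q))) := by
    refine Finset.sum_le_sum fun i _ => ?_
    have h3 := abs_le.1 (abs_queryMult_sub_le hq c ht (S i))
    rw [pm_mul_pm, pm_mul_pm]
    have h4 : (0 : ℝ) ≤ 1 / (320 * q) := by positivity
    split_ifs <;> linarith [h3.1, h3.2]
  have h5 : ∑ i, ((pm (c' (S i).1) * pm (S i).2 - pm (h (S i).1) * pm (S i).2)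
        * (queryMult q c t (S i) / (320 * q)) + 2 * (1 / (320 * (q : ℝ))))
      ≤ n * (2 * (1 / (320 * q))) := by
    rw [Finset.sum_add_distrib, Finset.sum_const, Finset.card_univ, Fintype.card_fin, nsmul_eq_mul]
    have : ∑ i, (pm (c' (S i).1) * pm (S i).2 - pm (h (S i).1) * pm (S i).2)
        * (queryMult q c t (S i) / (320 * (q : ℝ))) =
        (∑ i, queryMult q c t (S i) * (pm (c' (S i).1) * pm (S i).2)
          - ∑ i, queryMult q c t (S i) * (pm (h (S i).1) * pm (S i).2)) / (320 * q) := by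
      rw [← Finset.sum_sub_distrib, Finset.sum_div]
      exact Finset.sum_congr rfl fun i _ => by ring
    have h6 : ∑ i, (pm (c' (S i).1) * pm (S i).2 - pm (h (S i).1) * pm (S i).2)
        * (queryMult q c t (S i) / (320 * (q : ℝ))) ≤ 0 := by
      rw [this]; exact div_nonpos_of_nonpos_of_nonneg (by linarith) (by positivity)
    linarith
  have h7 : ∑ i, ((pm (c' (S i).1) * pm (S i).2 - pm (h (S i).1) * pm (S i).2)
      * (2 - gMaj (mix c t (S i).1) * pm (S i).2)) =
      ∑ i, (pm (c' (S i).1) * pm (S i).2 * (2 - (gMaj ∘ mix c t) (S i).1 * pm (S i).2)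
        - (gMaj ∘ mix c t) (S i).1 * pm (S i).2) -
      ∑ i, (pm (h (S i).1) * pm (S i).2 * (2 - (gMaj ∘ mix c t) (S i).1 * pm (S i).2)
        - (gMaj ∘ mix c t) (S i).1 * pm (S i).2) := by
    rw [← Finset.sum_sub_distrib]
    exact Finset.sum_congr rfl fun i _ => by simp only [Function.comp]; ring
  have h8 : 1 / (8 * (q : ℝ)) / 20 * n = n * (2 * (1 / (320 * q))) := by field_simp; norm_num
  linarith

lemma loss_mix (S : Fin n → X × Bool) (c : ℕ → X → Bool) {t : ℕ} (ht : 1 ≤ t) (h : X → Bool) :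
    loss S h (gMaj ∘ mix c t) =
      (2 * ((∑ i, if h (S i).1 = (S i).2 then gapNum (t * (t + 1)) (errWeight c t (S i)) else 0 : ℕ) : ℝ)
        / gapDen (t * (t + 1)) - 2 * ((∑ i, if h (S i).1 = (S i).2 then 0 else 1 : ℕ) : ℝ)) / n := by
  rw [loss]
  congr 1
  push_cast
  rw [Finset.mul_sum, Finset.sum_div, Finset.mul_sum, ← Finset.sum_sub_distrib]
  refine Finset.sum_congr rfl fun i _ => ?_
  simp only [Function.comp]
  rw [gMaj_mix_mul_pm c ht, pm_mul_pm]
  split_ifs <;> ring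

/-- The stopping rule of the learner in integer arithmetic. -/
lemma loss_mix_le_iff (S : Fin n → X × Bool) (hn : 0 < n) (c : ℕ → X → Bool) {t : ℕ} (ht : 1 ≤ t)
    {q : ℕ} (hq : 1 ≤ q) (h : X → Bool) {a b : ℕ}
    (ha : a = ∑ i, if h (S i).1 = (S i).2 then gapNum (t * (t + 1)) (errWeight c t (S i)) else 0)
    (hb : b = ∑ i, if h (S i).1 = (S i).2 then 0 else 1) :
    loss S h (gMaj ∘ mix c t) ≤ 19 / 20 * (1 / (8 * q)) ↔
      320 * q * a ≤ 19 * n * gapDen (t * (t + 1)) + 320 * q * b * gapDen (t * (t + 1)) := by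
  rw [loss_mix S c ht, ← ha, ← hb]
  have hZ : (0 : ℝ) < gapDen (t * (t + 1)) := by exact_mod_cast gapDen_pos ht
  have hq' : (0 : ℝ) < q := by exact_mod_cast hq
  have hn' : (0 : ℝ) < n := by exact_mod_cast hn
  rw [← Nat.cast_le (α := ℝ), div_le_iff₀ hn', sub_le_iff_le_add, div_le_iff₀ hZ]
  push_cast
  have h1 : (19 / 20 * (1 / (8 * (q : ℝ))) * n + 2 * b) * gapDen (t * (t + 1)) * (160 * q)
      = 19 * n * gapDen (t * (t + 1)) + 320 * q * b * gapDen (t * (t + 1)) := by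
    field_simp; ring
  have h2 : 2 * (a : ℝ) * (160 * q) = 320 * q * a := by ring
  rw [← h1, ← h2, mul_le_mul_iff_left₀ (by positivity)]

end Arithmetic

/-! ### The program -/

section Program

/-- The content of register `k`. -/
def reg (k : ℕ) : Expr := .read (.const k)

/-- A power of an expression. -/
def Expr.pow (e : Expr) : ℕ → Expr
  | 0 => .const 1
  | k + 1 => .mul (e.pow k) e

/-- The absolute difference of two expressions. -/
def Expr.dist (a b : Expr) : Expr := .add (.sub a b) (.sub b a)

/-- Store a value in register `k`. -/
def Prog.set (k : ℕ) (e : Expr) : Prog := .assign (.const k) e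

/-- Increase register `k` by one. -/
def Prog.incr (k : ℕ) : Prog := .set k (.add (reg k) (.const 1))

/-- `gapNum`, with `W` in register 11 and `N` in register 6. -/
def gapNumExpr : Expr :=
  .add
    (.mul (.mul (.const 32) ((reg 6).pow 4))
      (.add (.add (.add ((reg 6).pow 3)
        (.mul (.mul (.const 7) (.sub (reg 11) (reg 6))) ((reg 6).pow 2)))
        (.mul (.mul (.const 21) ((Expr.sub (reg 11) (reg 6)).pow 2)) (reg 6)))
        (.mul (.const 35) ((Expr.sub (reg 11) (reg 6)).pow 3))))
    (.mul (.mul (.const 6) (reg 6)) ((reg 11).pow 6))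

/-- Compute `gapNum` for the example whose index is in register 4. -/
def gapProg : Prog :=
  .seq (.set 5 (.const 0)) <| .seq (.set 6 (.const 0)) <|
  .seq (.loop (.sub (reg 2) (reg 5))
    -- The distance between predicted and given label is 1 if the concept errs and 0 otherwise.
    (.seq (.set 6 (.add (reg 6) (.mul ((Expr.app (reg 5) (reg 4)).dist (.label (reg 4)))
      (.mul (.const 2) (.add (reg 5) (.const 1)))))) (.incr 5))) <|
  .set 7 gapNumExpr

/-- Assemble the dataset for the oracle. -/
def queryProg : Prog :=
  .seq (.set 4 (.const 0)) <|
  .loop (.sub (reg 0) (reg 4)) <|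
    .seq gapProg <|
    .seq (.set 8 (.div (.mul (.mul (.const 320) (reg 1)) (.add (reg 12) (reg 7))) (reg 12))) <|
    .seq (.loop (reg 8) (.seq (.push (reg 4) (.label (reg 4)))
      (.set 8 (.sub (reg 8) (.const 1))))) <|
    .incr 4

/-- Compute the two sums in the loss of the last concept. -/
def lossProg : Prog :=
  .seq (.set 4 (.const 0)) <| .seq (.set 9 (.const 0)) <| .seq (.set 10 (.const 0)) <|
  .loop (.sub (reg 0) (reg 4)) <|
    .seq gapProg <|
    .seq (.ite ((Expr.app (reg 2) (reg 4)).dist (.label (reg 4)))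
      (.incr 10) (.set 9 (.add (reg 9) (reg 7)))) <|
    .incr 4

/-- One iteration of the learner. -/
def iterProg : Prog :=
  .seq (.set 11 (.mul (reg 2) (.add (reg 2) (.const 1)))) <|
  .seq (.set 12 (.mul (.const 19) ((reg 11).pow 7))) <|
  .seq queryProg <| .seq .erm <| .seq lossProg <|
  -- Truncated subtraction: the condition is nonzero exactly if the loss exceeds the stopping
  -- threshold.
  .ite (.sub (.mul (.mul (.const 320) (reg 1)) (reg 9))
      (.add (.mul (.mul (.const 19) (reg 0)) (reg 12))
        (.mul (.mul (.mul (.const 320) (reg 1)) (reg 10)) (reg 12))))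
    (.incr 2) (.set 3 (.const 0))

/-- Output the concepts of the mixture with their weights. -/
def outputProg : Prog :=
  .seq (.set 5 (.const 0)) <|
  .loop (.sub (reg 2) (reg 5)) <|
    .seq (.emit (reg 5) (.mul (.const 2) (.add (reg 5) (.const 1)))) <| .incr 5

/-- The program of the learner. -/
def learnProg : Prog :=
  -- Registers 0 and 1 hold `n` and `q`, register 2 the iteration `t`, and register 3 is 1 while the
  -- learner runs. The oracle is called on the empty query, for which any member of `C` is an
  -- answer, to obtain the initial concept.
  .seq (.set 2 (.const 1)) <| .seq (.set 3 (.const 1)) <| .seq .erm <|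
  .seq (.loop (reg 3) iterProg) outputProg

end Program

/-! ### Correctness and running time of the program. -/

section Correctness

variable {X : Type*} {n : ℕ} {S : Fin n → X × Bool} {E : ℕ → List (X × Bool) → X → Bool} {M : ℕ}

lemma val_reg (s : Config X) (k : ℕ) : (reg k).val S s = s.mem k := rfl

lemma val_const (s : Config X) (k : ℕ) : (Expr.const k).val S s = k := rfl

lemma val_add (s : Config X) (a b : Expr) : (Expr.add a b).val S s = a.val S s + b.val S s := rfl

lemma val_sub (s : Config X) (a b : Expr) : (Expr.sub a b).val S s = a.val S s - b.val S s := rfl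

lemma val_mul (s : Config X) (a b : Expr) : (Expr.mul a b).val S s = a.val S s * b.val S s := rfl

lemma val_div (s : Config X) (a b : Expr) : (Expr.div a b).val S s = a.val S s / b.val S s := rfl

lemma val_pow (s : Config X) (e : Expr) (k : ℕ) : (e.pow k).val S s = e.val S s ^ k := by
  induction k with
  | zero => rfl
  | succ k ih => rw [Expr.pow, val_mul, ih, pow_succ]

lemma val_gapNumExpr (s : Config X) : gapNumExpr.val S s = gapNum (s.mem 11) (s.mem 6) := by
  simp only [gapNumExpr, val_add, val_sub, val_mul, val_pow, val_reg, val_const, gapNum]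

lemma val_label (s : Config X) {e : Expr} {i : Fin n} (he : e.val S s = i) :
    (Expr.label e).val S s = (S i).2.toNat := by
  simp [Expr.val, he]

/-- Concept number `s` of a list. -/
def nthConcept (l : List (X → Bool)) (s : ℕ) : X → Bool := l.getD s fun _ => true

lemma nthConcept_append {l : List (X → Bool)} {s : ℕ} (hs : s < l.length) (l' : List (X → Bool)) :
    nthConcept (l ++ l') s = nthConcept l s := by
  simp [nthConcept, List.getD_eq_getElem?_getD, List.getElem?_append_left hs]

lemma nthConcept_length (l : List (X → Bool)) (c : X → Bool) :
    nthConcept (l ++ [c]) l.length = c := by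
  simp [nthConcept, List.getD_eq_getElem?_getD]

lemma getElem_eq_nthConcept {l : List (X → Bool)} {s : ℕ} (hs : s < l.length) :
    l[s] = nthConcept l s := by
  simp [nthConcept, List.getD_eq_getElem?_getD, hs]

lemma val_dist_app_label (s : Config X) {a e : Expr} {i : Fin n} {k : ℕ} (ha : a.val S s = k)
    (hk : k < s.concepts.length) (he : e.val S s = i) :
    ((Expr.app a e).dist (.label e)).val S s =
      if nthConcept s.concepts k (S i).1 = (S i).2 then 0 else 1 := by
  have h1 : (Expr.app a e).val S s = (nthConcept s.concepts k (S i).1).toNat := by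
    simp [Expr.val, he, ha, hk, getElem_eq_nthConcept]
  rw [Expr.dist, val_add, val_sub, val_sub, val_label s he, h1]
  cases nthConcept s.concepts k (S i).1 <;> cases (S i).2 <;> rfl

/-- Apart from the query, `s` and `s'` differ at most in the registers in `A`. -/
structure Config.Frame (A : List ℕ) (s s' : Config X) : Prop where
  concepts : s'.concepts = s.concepts
  out : s'.out = s.out
  mem : ∀ a ∉ A, s'.mem a = s.mem a

lemma Config.Frame.refl (A : List ℕ) (s : Config X) : s.Frame A s := ⟨rfl, rfl, fun _ _ => rfl⟩

lemma Config.Frame.trans {A B : List ℕ} {s s' s'' : Config X} (h : s.Frame A s')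
    (h' : s'.Frame B s'') (hBA : B ⊆ A) : s.Frame A s'' :=
  ⟨h'.concepts.trans h.concepts, h'.out.trans h.out,
    fun a ha => (h'.mem a fun hb => ha (hBA hb)).trans (h.mem a ha)⟩

lemma Config.Frame.write {A : List ℕ} {s s' : Config X} (h : s.Frame A s') {a : ℕ} (ha : a ∈ A)
    (v : ℕ) : s.Frame A (s'.write a v) := by
  refine ⟨h.concepts, h.out, fun b hb => ?_⟩
  rw [Config.write_mem, if_neg (by rintro rfl; exact hb ha), h.mem b hb]

lemma Runs.set {k : ℕ} {e : Expr} {s : Config X} {Q : Config X → Prop} (hs : s.BoundedBy M)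
    (hQ : Q (s.write k (e.val S s))) : Runs S E M (.set k e) s Q := Runs.assign hs hQ

lemma Runs.incr {k : ℕ} {s : Config X} {Q : Config X → Prop} (hs : s.BoundedBy M)
    (hQ : Q (s.write k (s.mem k + 1))) : Runs S E M (.incr k) s Q := Runs.assign hs hQ

lemma runs_gapProg {s : Config X} (hs : s.BoundedBy M) {t : ℕ} (ht : s.mem 2 = t) (ht1 : 1 ≤ t)
    (htl : t ≤ s.concepts.length) {i : Fin n} (hi : s.mem 4 = i) (hW : s.mem 11 = t * (t + 1))
    (hM : 2 * gapDen (t * (t + 1)) ≤ M) :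
    Runs S E M gapProg s fun s' => s.Frame [5, 6, 7] s' ∧ s'.query = s.query ∧ s'.BoundedBy M ∧
      s'.mem 7 = gapNum (t * (t + 1)) (errWeight (nthConcept s.concepts) t (S i)) := by
  have hWM : t * (t + 1) ≤ M := hW ▸ hs 11
  have htM : t ≤ M := ht ▸ hs 2
  have hs1 : (s.write 5 0).BoundedBy M := hs.write (Nat.zero_le _)
  refine Runs.seq (Runs.set hs (Runs.seq (Runs.set hs1 (Runs.seq ?_))))
  refine Runs.mono (Runs.loop (Q := fun σ => s.Frame [5, 6, 7] σ ∧ σ.query = s.query ∧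
    σ.BoundedBy M ∧ σ.mem 6 = errWeight (nthConcept s.concepts) t (S i))
    (fun j σ => s.Frame [5, 6, 7] σ ∧ σ.query = s.query ∧ σ.BoundedBy M ∧ j ≤ t ∧ σ.mem 5 = j ∧
      σ.mem 6 = errWeight (nthConcept s.concepts) j (S i)) ?_ ?_) ?_
  · rintro j σ ⟨hF, hq, hb, hj, h5, h6⟩
    refine ⟨hj.trans htM, hb, ?_⟩
    have h2 : σ.mem 2 = t := (hF.mem 2 (by simp)).trans ht
    have h4 : σ.mem 4 = i := (hF.mem 4 (by simp)).trans hi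
    rcases hj.eq_or_lt with rfl | hlt
    · exact Or.inl ⟨by rw [val_sub, val_reg, val_reg, h2, h5, Nat.sub_self], hF, hq, hb, h6⟩
    refine Or.inr ⟨by rw [val_sub, val_reg, val_reg, h2, h5]; omega, ?_⟩
    have hval : (Expr.add (reg 6) (.mul ((Expr.app (reg 5) (reg 4)).dist (.label (reg 4)))
        (.mul (.const 2) (.add (reg 5) (.const 1))))).val S σ
        = errWeight (nthConcept s.concepts) (j + 1) (S i) := by
      rw [val_add, val_mul, val_dist_app_label σ (val_reg σ 5 |>.trans h5)
        (by rw [hF.concepts]; omega) (val_reg σ 4 |>.trans h4), val_mul, val_add, val_reg, val_reg,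
        val_const, val_const, h5, h6, hF.concepts, errWeight, errWeight, Finset.sum_range_succ]
      split_ifs <;> ring
    have hle : errWeight (nthConcept s.concepts) (j + 1) (S i) ≤ M :=
      ((errWeight_le _ _ _).trans (Nat.mul_le_mul hlt (by omega))).trans hWM
    have hb' := hb.write (a := 6) hle
    refine Runs.seq (Runs.set hb ?_)
    rw [hval]
    refine Runs.incr hb' ?_
    have h5' : (σ.write 6 (errWeight (nthConcept s.concepts) (j + 1) (S i))).mem 5 = j := by
      simp [Config.write_mem, h5]
    rw [h5']
    exact ⟨(hF.write (by simp) _).write (by simp) _, hq, hb'.write (by omega), hlt,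
      by simp [Config.write_mem], by simp [Config.write_mem]⟩
  · refine ⟨((Config.Frame.refl _ s).write (by simp) _).write (by simp) _, rfl,
      hs1.write (Nat.zero_le _), Nat.zero_le _, ?_, ?_⟩
    · simp [Config.write_mem, val_const]
    · simp [Config.write_mem, val_const, errWeight]
  · rintro σ ⟨hF, hq, hb, h6⟩
    have h11 : σ.mem 11 = t * (t + 1) := (hF.mem 11 (by simp)).trans hW
    refine Runs.set hb ?_
    rw [val_gapNumExpr, h11, h6]
    exact ⟨hF.write (by simp) _, hq, hb.write ((gapNum_le (errWeight_le _ _ _)).trans hM),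
      by simp [Config.write_mem]⟩

/-- The query is described only through its sums of arbitrary functions. This determines the ERM
objective and makes the order of the examples irrelevant. -/
lemma runs_queryProg {s : Config X} (hs : s.BoundedBy M) {t q : ℕ} (ht : s.mem 2 = t) (ht1 : 1 ≤ t)
    (htl : t ≤ s.concepts.length) (hn : s.mem 0 = n) (hq : s.mem 1 = q)
    (hW : s.mem 11 = t * (t + 1)) (hZ : s.mem 12 = gapDen (t * (t + 1)))
    (hM : 2 * gapDen (t * (t + 1)) ≤ M) (hqM : 960 * q ≤ M) (hQ : s.query = []) :
    Runs S E M queryProg s fun s' => s.Frame [4, 5, 6, 7, 8] s' ∧ s'.BoundedBy M ∧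
      ∀ f : X × Bool → ℝ, (s'.query.map f).sum =
        ∑ i, queryMult q (nthConcept s.concepts) t (S i) * f (S i) := by
  have hnM : n ≤ M := hn ▸ hs 0
  set F : (X × Bool → ℝ) → ℕ → ℝ := fun f j =>
    if h : j < n then queryMult q (nthConcept s.concepts) t (S ⟨j, h⟩) * f (S ⟨j, h⟩) else 0 with hFdef
  refine Runs.seq (Runs.set hs (Runs.loop (fun i σ => s.Frame [4, 5, 6, 7, 8] σ ∧ σ.BoundedBy M ∧
    i ≤ n ∧ σ.mem 4 = i ∧ ∀ f : X × Bool → ℝ, (σ.query.map f).sum = ∑ j ∈ Finset.range i, F f j) ?_ ?_))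
  · rintro i σ ⟨hF, hb, hi, h4, hf⟩
    refine ⟨hi.trans hnM, hb, ?_⟩
    have h0 : σ.mem 0 = n := (hF.mem 0 (by simp)).trans hn
    rcases hi.eq_or_lt with rfl | hlt
    · refine Or.inl ⟨by rw [val_sub, val_reg, val_reg, h0, h4, Nat.sub_self], hF, hb, fun f => ?_⟩
      rw [hf f, Finset.sum_range]
      exact Finset.sum_congr rfl fun j _ => by simp [hFdef]
    refine Or.inr ⟨by rw [val_sub, val_reg, val_reg, h0, h4]; omega, ?_⟩
    refine Runs.seq (Runs.mono (runs_gapProg hb ((hF.mem 2 (by simp)).trans ht) ht1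
      (by rw [hF.concepts]; exact htl) (i := ⟨i, hlt⟩) h4 ((hF.mem 11 (by simp)).trans hW) hM) ?_)
    rintro σ₁ ⟨hF₁, hq₁, hb₁, h7⟩
    have hF₁' : s.Frame [4, 5, 6, 7, 8] σ₁ := hF.trans hF₁ (by simp)
    have hval : (Expr.div (.mul (.mul (.const 320) (reg 1)) (.add (reg 12) (reg 7))) (reg 12)).val S σ₁
        = queryMult q (nthConcept s.concepts) t (S ⟨i, hlt⟩) := by
      rw [val_div, val_mul, val_mul, val_add, val_reg, val_reg, val_reg, val_const, h7,
        hF₁'.mem 12 (by simp), hF₁'.mem 1 (by simp), hZ, hq, hF.concepts, queryMult]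
    set k := queryMult q (nthConcept s.concepts) t (S ⟨i, hlt⟩) with hk
    have hkM : k ≤ M := (queryMult_le _ _ _ _).trans hqM
    refine Runs.seq (Runs.set hb₁ (Runs.seq ?_))
    rw [hval]
    have h4₁ : σ₁.mem 4 = i := (hF₁.mem 4 (by simp)).trans h4
    refine Runs.mono (Runs.loop (Q := fun τ => s.Frame [4, 5, 6, 7, 8] τ ∧ τ.BoundedBy M ∧
      τ.mem 4 = i ∧ ∀ f : X × Bool → ℝ, (τ.query.map f).sum = ∑ j ∈ Finset.range (i + 1), F f j)
      (fun j τ => s.Frame [4, 5, 6, 7, 8] τ ∧ τ.BoundedBy M ∧ τ.mem 4 = i ∧ j ≤ k ∧ τ.mem 8 = k - j ∧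
        ∀ f : X × Bool → ℝ, (τ.query.map f).sum =
          ∑ j ∈ Finset.range i, F f j + j * f (S ⟨i, hlt⟩)) ?_ ?_) ?_
    · rintro j τ ⟨hG, hc, g4, hj, g8, hg⟩
      refine ⟨hj.trans hkM, hc, ?_⟩
      rcases hj.eq_or_lt with rfl | hjk
      · refine Or.inl ⟨by rw [val_reg, g8, Nat.sub_self], hG, hc, g4, fun f => ?_⟩
        rw [hg f, Finset.sum_range_succ]
        simp [hFdef, hlt, hk]
      refine Or.inr ⟨by rw [val_reg, g8]; omega, ?_⟩
      have hpush : τ.pushQuery S ((reg 4).val S τ) (decide ((Expr.label (reg 4)).val S τ ≠ 0))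
          = { τ with query := τ.query ++ [S ⟨i, hlt⟩] } := by
        rw [val_label τ (i := ⟨i, hlt⟩) ((val_reg τ 4).trans g4), val_reg, g4, Config.pushQuery,
          dif_pos hlt]
        congr 3
        ext
        · rfl
        · cases (S ⟨i, hlt⟩).2 <;> rfl
      refine Runs.seq (Runs.push hc ?_)
      rw [hpush]
      refine Runs.set hc ?_
      have g8' : ({ τ with query := τ.query ++ [S ⟨i, hlt⟩] } : Config X).mem 8 = k - j := g8
      rw [val_sub, val_reg, val_const, g8']
      have hG' : s.Frame [4, 5, 6, 7, 8] { τ with query := τ.query ++ [S ⟨i, hlt⟩] } :=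
        ⟨hG.concepts, hG.out, hG.mem⟩
      refine ⟨hG'.write (by simp) _,
        Config.BoundedBy.write hc (by omega), by simpa [Config.write_mem] using g4, hjk,
        by rw [Config.write_mem, if_pos rfl]; omega, fun f => ?_⟩
      simp only [Config.write, List.map_append, List.sum_append, hg f, List.map_cons, List.map_nil,
        List.sum_singleton]
      push_cast
      ring
    · refine ⟨hF₁'.write (by simp) _, hb₁.write hkM, by simpa [Config.write_mem] using h4₁,
        Nat.zero_le _, by simp [Config.write_mem], fun f => ?_⟩
      simp [Config.write, hq₁, hf f]
    · rintro τ ⟨hG, hc, g4, hg⟩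
      refine Runs.incr hc ?_
      rw [g4]
      exact ⟨hG.write (by simp) _, hc.write (by omega), hlt, by simp [Config.write_mem], hg⟩
  · refine ⟨(Config.Frame.refl _ s).write (by simp) _, hs.write (Nat.zero_le _), Nat.zero_le _,
      by simp [Config.write_mem, val_const], fun f => ?_⟩
    simp [Config.write, hQ]

lemma runs_lossProg {s : Config X} (hs : s.BoundedBy M) {t : ℕ} (ht : s.mem 2 = t) (ht1 : 1 ≤ t)
    (htl : t < s.concepts.length) (hn : s.mem 0 = n) (hW : s.mem 11 = t * (t + 1))
    (hM : 2 * gapDen (t * (t + 1)) * (n + 1) ≤ M) :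
    Runs S E M lossProg s fun s' => s.Frame [4, 5, 6, 7, 9, 10] s' ∧ s'.query = s.query ∧
      s'.BoundedBy M ∧
      s'.mem 9 = (∑ i, if nthConcept s.concepts t (S i).1 = (S i).2 then
        gapNum (t * (t + 1)) (errWeight (nthConcept s.concepts) t (S i)) else 0) ∧
      s'.mem 10 = ∑ i, if nthConcept s.concepts t (S i).1 = (S i).2 then 0 else 1 := by
  have hnM : n ≤ M := hn ▸ hs 0
  have hM' : 2 * gapDen (t * (t + 1)) ≤ M := (Nat.le_mul_of_pos_right _ (by omega)).trans hM
  set F : ℕ → ℕ := fun j => if h : j < n then (if nthConcept s.concepts t (S ⟨j, h⟩).1 = (S ⟨j, h⟩).2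
    then gapNum (t * (t + 1)) (errWeight (nthConcept s.concepts) t (S ⟨j, h⟩)) else 0) else 0 with hFdef
  set G : ℕ → ℕ := fun j => if h : j < n then (if nthConcept s.concepts t (S ⟨j, h⟩).1 = (S ⟨j, h⟩).2
    then 0 else 1) else 0 with hGdef
  have hFle : ∀ i ≤ n, ∑ j ∈ Finset.range i, F j ≤ M := fun i hi => by
    have h1 : ∑ j ∈ Finset.range i, F j ≤ i * (2 * gapDen (t * (t + 1))) := by
      rw [← Finset.card_range i, ← smul_eq_mul, Finset.card_range]
      conv_rhs => rw [← Finset.card_range i]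
      refine Finset.sum_le_card_nsmul _ _ _ fun j _ => ?_
      simp only [hFdef]
      split_ifs
      · exact gapNum_le (errWeight_le _ _ _)
      all_goals exact Nat.zero_le _
    refine h1.trans (le_trans ?_ hM)
    rw [mul_comm]
    exact Nat.mul_le_mul_left _ (by omega)
  have hGle : ∀ i ≤ n, ∑ j ∈ Finset.range i, G j ≤ M := fun i hi => by
    have h1 : ∑ j ∈ Finset.range i, G j ≤ (Finset.range i).card • 1 := by
      refine Finset.sum_le_card_nsmul _ _ _ fun j _ => ?_
      simp only [hGdef]
      split_ifs <;> omega
    rw [Finset.card_range, smul_eq_mul, mul_one] at h1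
    omega
  have hb1 : (s.write 4 0).BoundedBy M := hs.write (Nat.zero_le _)
  have hb2 : ((s.write 4 0).write 9 0).BoundedBy M := hb1.write (Nat.zero_le _)
  have hb3 : (((s.write 4 0).write 9 0).write 10 0).BoundedBy M := hb2.write (Nat.zero_le _)
  refine Runs.seq (Runs.set hs (Runs.seq (Runs.set hb1 (Runs.seq (Runs.set hb2 (Runs.loop
    (fun i σ => s.Frame [4, 5, 6, 7, 9, 10] σ ∧ σ.query = s.query ∧ σ.BoundedBy M ∧
      i ≤ n ∧ σ.mem 4 = i ∧ σ.mem 9 = ∑ j ∈ Finset.range i, F j ∧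
      σ.mem 10 = ∑ j ∈ Finset.range i, G j) ?_ ?_))))))
  · rintro i σ ⟨hF, hQ, hb, hi, h4, h9, h10⟩
    refine ⟨hi.trans hnM, hb, ?_⟩
    have h0 : σ.mem 0 = n := (hF.mem 0 (by simp)).trans hn
    rcases hi.eq_or_lt with rfl | hlt
    · refine Or.inl ⟨by rw [val_sub, val_reg, val_reg, h0, h4, Nat.sub_self], hF, hQ, hb, ?_, ?_⟩
      · rw [h9, Finset.sum_range]
        exact Finset.sum_congr rfl fun j _ => by simp [hFdef]
      · rw [h10, Finset.sum_range]
        exact Finset.sum_congr rfl fun j _ => by simp [hGdef]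
    refine Or.inr ⟨by rw [val_sub, val_reg, val_reg, h0, h4]; omega, ?_⟩
    refine Runs.seq (Runs.mono (runs_gapProg hb ((hF.mem 2 (by simp)).trans ht) ht1
      (by rw [hF.concepts]; exact htl.le) (i := ⟨i, hlt⟩) h4 ((hF.mem 11 (by simp)).trans hW) hM') ?_)
    rintro σ₁ ⟨hF₁, hq₁, hb₁, h7⟩
    have hF₁' : s.Frame [4, 5, 6, 7, 9, 10] σ₁ := hF.trans hF₁ (by simp)
    have h4₁ : σ₁.mem 4 = i := (hF₁.mem 4 (by simp)).trans h4
    have h9₁ : σ₁.mem 9 = ∑ j ∈ Finset.range i, F j := (hF₁.mem 9 (by simp)).trans h9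
    have h10₁ : σ₁.mem 10 = ∑ j ∈ Finset.range i, G j := (hF₁.mem 10 (by simp)).trans h10
    have hval := val_dist_app_label (S := S) σ₁ (i := ⟨i, hlt⟩)
      ((val_reg σ₁ 2).trans ((hF₁'.mem 2 (by simp)).trans ht))
      (by rw [hF₁'.concepts]; exact htl) ((val_reg σ₁ 4).trans h4₁)
    rw [hF₁'.concepts] at hval
    refine Runs.seq (Runs.mono (Q := fun τ => s.Frame [4, 5, 6, 7, 9, 10] τ ∧ τ.query = s.query ∧
      τ.BoundedBy M ∧ τ.mem 4 = i ∧ τ.mem 9 = ∑ j ∈ Finset.range (i + 1), F j ∧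
      τ.mem 10 = ∑ j ∈ Finset.range (i + 1), G j) (Runs.ite hb₁ (fun he => ?_) fun he => ?_) ?_)
    · have hne : nthConcept s.concepts t (S ⟨i, hlt⟩).1 ≠ (S ⟨i, hlt⟩).2 := fun h => by
        rw [hval, if_pos h] at he; exact he rfl
      have hFi : F i = 0 := by simp [hFdef, hlt, hne]
      have hGi : G i = 1 := by simp [hGdef, hlt, hne]
      have hle := hGle (i + 1) hlt
      refine Runs.incr hb₁ ?_
      rw [Finset.sum_range_succ, hGi] at hle
      rw [Finset.sum_range_succ F, hFi, Finset.sum_range_succ G, hGi, h10₁]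
      exact ⟨hF₁'.write (by simp) _, hq₁.trans hQ, hb₁.write hle, by simp [Config.write_mem, h4₁],
        by simp [Config.write_mem, h9₁], by simp [Config.write_mem]⟩
    · have heq : nthConcept s.concepts t (S ⟨i, hlt⟩).1 = (S ⟨i, hlt⟩).2 := by
        by_contra h
        rw [hval, if_neg h] at he; exact one_ne_zero he
      have hFi : F i = gapNum (t * (t + 1)) (errWeight (nthConcept s.concepts) t (S ⟨i, hlt⟩)) := by
        simp [hFdef, hlt, heq]
      have hGi : G i = 0 := by simp [hGdef, hlt, heq]
      have hle := hFle (i + 1) hlt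
      refine Runs.set hb₁ ?_
      rw [val_add, val_reg, val_reg, h9₁, h7, hF.concepts, ← hFi, ← Finset.sum_range_succ]
      rw [Finset.sum_range_succ G, hGi]
      exact ⟨hF₁'.write (by simp) _, hq₁.trans hQ, hb₁.write hle, by simp [Config.write_mem, h4₁],
        by simp [Config.write_mem], by simp [Config.write_mem, h10₁]⟩
    · rintro τ ⟨hG, hQ', hc, g4, g9, g10⟩
      refine Runs.incr hc ?_
      rw [g4]
      exact ⟨hG.write (by simp) _, hQ', hc.write (by omega), hlt, by simp [Config.write_mem],
        by simp [Config.write_mem, g9], by simp [Config.write_mem, g10]⟩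
  · refine ⟨(((Config.Frame.refl _ s).write (by simp) _).write (by simp) _).write (by simp) _, rfl,
      hb3, Nat.zero_le _, ?_, ?_, ?_⟩ <;> simp [Config.write_mem, val_const]

variable {C : Set (X → Bool)} {q t : ℕ}

/-- The learner is about to start iteration `t`. -/
structure Config.Active (C : Set (X → Bool)) (S : Fin n → X × Bool) (q t : ℕ) (s : Config X) :
    Prop where
  flag : s.mem 3 = 1
  iter : s.mem 2 = t
  length : s.concepts.length = t
  learnIter : LearnIter C S (1 / (8 * q)) t (mix (nthConcept s.concepts) t)

/-- The learner has stopped in iteration `t`. -/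
structure Config.Stopped (C : Set (X → Bool)) (S : Fin n → X × Bool) (q t : ℕ) (s : Config X) :
    Prop where
  flag : s.mem 3 = 0
  iter : s.mem 2 = t
  length : s.concepts.length = t + 1
  learnIter : LearnIter C S (1 / (8 * q)) t (mix (nthConcept s.concepts) t)
  approxMax : ApproxMax C S (1 / (8 * q)) (gMaj ∘ mix (nthConcept s.concepts) t)
    (nthConcept s.concepts t)
  loss_le : loss S (nthConcept s.concepts t) (gMaj ∘ mix (nthConcept s.concepts) t)
    ≤ 19 / 20 * (1 / (8 * q))

/-- What holds between two iterations. -/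
structure Config.Regular (n q M : ℕ) (s : Config X) : Prop where
  size : s.mem 0 = n
  accuracy : s.mem 1 = q
  query : s.query = []
  out : s.out = []
  boundedBy : s.BoundedBy M

/-- The initial concept has index 0, so the concept found in iteration `t` has index `t`. If the run
continues, it becomes the newest term of the mixture. If the run stops, it stays in the list outside
the mixture of the first `t`, as the witness for stopping. -/
lemma runs_iterProg {s : Config X} (hE : IsERMOracle C E) (hn : 0 < n) (hq : 1 ≤ q)
    (hs : s.Regular n q M) (ha : s.Active C S q t)
    (hM : 2 * gapDen (t * (t + 1)) * (n + 1) ≤ M) (hqM : 960 * q ≤ M) :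
    Runs S E M iterProg s fun s' => s'.Regular n q M ∧
      (s'.Active C S q (t + 1) ∨ s'.Stopped C S q t) := by
  have ht1 : 1 ≤ t := ha.learnIter.one_le
  have hM' : 2 * gapDen (t * (t + 1)) ≤ M := (Nat.le_mul_of_pos_right _ (by omega)).trans hM
  have hWZ : t * (t + 1) ≤ gapDen (t * (t + 1)) := by
    unfold gapDen
    exact (Nat.le_self_pow (by norm_num) _).trans (Nat.le_mul_of_pos_left _ (by norm_num))
  have htW : t + 1 ≤ t * (t + 1) := Nat.le_mul_of_pos_left _ ht1
  have hb1 : (s.write 11 (t * (t + 1))).BoundedBy M := hs.boundedBy.write (by omega)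
  refine Runs.seq (Runs.set hs.boundedBy (Runs.seq ?_))
  rw [val_mul, val_add, val_reg, val_const, ha.iter]
  refine Runs.set hb1 (Runs.seq ?_)
  rw [val_mul, val_pow, val_const, val_reg, Config.write_mem, if_pos rfl]
  change Runs S E M queryProg ((s.write 11 (t * (t + 1))).write 12 (gapDen (t * (t + 1)))) _
  have hb2 : ((s.write 11 (t * (t + 1))).write 12 (gapDen (t * (t + 1)))).BoundedBy M :=
    hb1.write (by omega)
  have hF0 : s.Frame [11, 12] ((s.write 11 (t * (t + 1))).write 12 (gapDen (t * (t + 1)))) :=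
    ((Config.Frame.refl _ s).write (by simp) _).write (by simp) _
  have h11 : ((s.write 11 (t * (t + 1))).write 12 (gapDen (t * (t + 1)))).mem 11 = t * (t + 1) := by
    simp [Config.write_mem]
  have h12 : ((s.write 11 (t * (t + 1))).write 12 (gapDen (t * (t + 1)))).mem 12
      = gapDen (t * (t + 1)) := by simp [Config.write_mem]
  have hquery : ((s.write 11 (t * (t + 1))).write 12 (gapDen (t * (t + 1)))).query = [] := hs.query
  generalize (s.write 11 (t * (t + 1))).write 12 (gapDen (t * (t + 1))) = σ₀ at *
  refine Runs.mono (runs_queryProg (q := q) hb2 ((hF0.mem 2 (by simp)).trans ha.iter) ht1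
    (by rw [hF0.concepts, ha.length]) ((hF0.mem 0 (by simp)).trans hs.size)
    ((hF0.mem 1 (by simp)).trans hs.accuracy) h11 h12 hM' hqM hquery) ?_
  rintro σ ⟨hF, hb, hQ⟩
  rw [hF0.concepts] at hQ
  set h := E σ.concepts.length σ.query with hh
  have happ := approxMax_of_isERM hq ht1 hQ (hE σ.concepts.length σ.query)
  rw [← hh] at happ
  refine Runs.seq (Runs.erm (Runs.seq ?_))
  have hcall : (σ.call E).concepts = s.concepts ++ [h] := by
    rw [Config.call, ← hh, hF.concepts, hF0.concepts]
  have hF1 : ∀ a ∉ [4, 5, 6, 7, 8, 11, 12], (σ.call E).mem a = s.mem a := fun a ha' => by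
    simp only [List.mem_cons, List.not_mem_nil, or_false, not_or] at ha'
    exact (hF.mem a (by simp [ha'])).trans (hF0.mem a (by simp [ha']))
  have hbc : (σ.call E).BoundedBy M := hb
  have h11c : (σ.call E).mem 11 = t * (t + 1) := (hF.mem 11 (by simp)).trans h11
  have h12c : (σ.call E).mem 12 = gapDen (t * (t + 1)) := (hF.mem 12 (by simp)).trans h12
  have hqc : (σ.call E).query = [] := rfl
  have houtc : (σ.call E).out = [] := hF.out.trans (hF0.out.trans hs.out)
  generalize σ.call E = σ₁ at *
  -- Appending the new concept does not affect the mixture of the earlier ones.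
  have hmix : mix (nthConcept s.concepts) t = mix (nthConcept σ₁.concepts) t :=
    mix_congr fun j hj => by rw [hcall, nthConcept_append (by rw [ha.length]; exact hj)]
  have hnth : nthConcept σ₁.concepts t = h := by
    rw [hcall, ← ha.length, nthConcept_length]
  have hlen : σ₁.concepts.length = t + 1 := by rw [hcall, List.length_append, ha.length]; rfl
  have hiter := ha.learnIter
  rw [hmix] at happ hiter
  rw [← hnth] at happ
  refine Runs.mono (runs_lossProg (t := t) hbc ((hF1 2 (by simp)).trans ha.iter) ht1
    (by rw [hlen]; omega) ((hF1 0 (by simp)).trans hs.size) h11c hM) ?_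
  rintro τ ⟨hG, hQτ, hbτ, h9, h10⟩
  have hrule := loss_mix_le_iff S hn (nthConcept σ₁.concepts) ht1 hq _ h9 h10
  have hm : ∀ a ∉ [4, 5, 6, 7, 8, 9, 10, 11, 12], τ.mem a = s.mem a := fun a ha' => by
    simp only [List.mem_cons, List.not_mem_nil, or_false, not_or] at ha'
    exact (hG.mem a (by simp [ha'])).trans (hF1 a (by simp [ha']))
  have h0 := (hm 0 (by simp)).trans hs.size
  have h1 := (hm 1 (by simp)).trans hs.accuracy
  have h2 := (hm 2 (by simp)).trans ha.iter
  have h3 := (hm 3 (by simp)).trans ha.flag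
  have hval : (Expr.sub (.mul (.mul (.const 320) (reg 1)) (reg 9))
      (.add (.mul (.mul (.const 19) (reg 0)) (reg 12))
        (.mul (.mul (.mul (.const 320) (reg 1)) (reg 10)) (reg 12)))).val S τ =
      320 * q * τ.mem 9 -
        (19 * n * gapDen (t * (t + 1)) + 320 * q * τ.mem 10 * gapDen (t * (t + 1))) := by
    simp only [val_sub, val_add, val_mul, val_reg, val_const, h0, h1,
      (hG.mem 12 (by simp)).trans h12c]
  have hQτ' := hQτ.trans hqc
  have houtτ := hG.out.trans houtc
  refine Runs.ite hbτ (fun he => ?_) fun he => ?_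
  · rw [hval, ne_eq, Nat.sub_eq_zero_iff_le, ← hrule, not_le] at he
    refine Runs.incr hbτ ?_
    rw [h2]
    refine ⟨⟨by simp [Config.write_mem, h0], by simp [Config.write_mem, h1], hQτ', houtτ,
      hbτ.write (by omega)⟩, Or.inl ⟨by simp [Config.write_mem, h3], by simp [Config.write_mem], ?_, ?_⟩⟩
    · exact (congrArg List.length hG.concepts).trans hlen
    · change LearnIter C S _ _ (mix (nthConcept τ.concepts) (t + 1))
      rw [hG.concepts, mix_succ _ ht1]
      exact .step t _ _ hiter happ he
  · rw [hval, Nat.sub_eq_zero_iff_le, ← hrule] at he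
    refine Runs.set hbτ ?_
    rw [val_const]
    refine ⟨⟨by simp [Config.write_mem, h0], by simp [Config.write_mem, h1], hQτ', houtτ,
      hbτ.write (by omega)⟩, Or.inr ⟨by simp [Config.write_mem], by simp [Config.write_mem, h2],
        (congrArg List.length hG.concepts).trans hlen, ?_, ?_, ?_⟩⟩
    all_goals simp only [Config.write, hG.concepts]
    exacts [hiter, happ, he]

lemma runs_outputProg {s : Config X} (hs : s.BoundedBy M) (ht : s.mem 2 = t)
    (htl : t ≤ s.concepts.length) (hout : s.out = []) (ht1 : 1 ≤ t) :
    Runs S E M outputProg s fun s' => s'.concepts = s.concepts ∧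
      s'.mixture = mix (nthConcept s.concepts) t := by
  have htM : t ≤ M := ht ▸ hs 2
  refine Runs.seq (Runs.set hs (Runs.mono (Runs.loop (Q := fun σ => σ.concepts = s.concepts ∧
    ∀ F : (X → Bool) × ℕ → ℝ, (σ.out.map F).sum
      = ∑ j ∈ Finset.range t, F (nthConcept s.concepts j, 2 * (j + 1)))
    (fun i σ => σ.concepts = s.concepts ∧ σ.BoundedBy M ∧ i ≤ t ∧ σ.mem 2 = t ∧ σ.mem 5 = i ∧
      ∀ F : (X → Bool) × ℕ → ℝ, (σ.out.map F).sum
        = ∑ j ∈ Finset.range i, F (nthConcept s.concepts j, 2 * (j + 1))) ?_ ?_) ?_))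
  · rintro i σ ⟨hc, hb, hi, h2, h5, hF⟩
    refine ⟨hi.trans htM, hb, ?_⟩
    rcases hi.eq_or_lt with rfl | hlt
    · exact Or.inl ⟨by rw [val_sub, val_reg, val_reg, h2, h5, Nat.sub_self], hc, hF⟩
    refine Or.inr ⟨by rw [val_sub, val_reg, val_reg, h2, h5]; omega, Runs.seq (Runs.emit hb ?_)⟩
    have hlen : i < σ.concepts.length := by rw [hc]; omega
    have hemit : σ.emitOut ((reg 5).val S σ)
        ((Expr.mul (.const 2) (.add (reg 5) (.const 1))).val S σ) =
        { σ with out := σ.out ++ [(nthConcept s.concepts i, 2 * (i + 1))] } := by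
      rw [val_mul, val_add, val_reg, val_const, val_const, h5, Config.emitOut, dif_pos hlen,
        getElem_eq_nthConcept, hc]
    rw [hemit]
    refine Runs.incr hb ?_
    have h5' : ({ σ with out := σ.out ++ [(nthConcept s.concepts i, 2 * (i + 1))] } : Config X).mem 5
      = i := h5
    rw [h5']
    refine ⟨hc, Config.BoundedBy.write hb (by omega), hlt, by simpa [Config.write_mem] using h2,
      by simp [Config.write_mem], fun F => ?_⟩
    simp [Config.write, hF, Finset.sum_range_succ]
  · exact ⟨rfl, hs.write (Nat.zero_le _), Nat.zero_le _, by simpa [Config.write_mem] using ht,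
      by simp [Config.write_mem, val_const], fun F => by simp [Config.write, hout]⟩
  · rintro σ ⟨hc, hF⟩
    refine ⟨hc, funext fun x => ?_⟩
    rw [Config.mixture, hF, hF, mix]
    have h1 := congrArg (Nat.cast (R := ℝ)) (sum_weights t)
    push_cast at h1 ⊢
    rw [h1]

/-- A bound on the numbers in the memory. -/
def memBound (v : ℕ) : ℕ :=
  960 * v + 2 * (19 * (608 * v * (608 * v + 1)) ^ 7) * (v + 1) + 1

lemma polyBounded_memBound : PolyBounded memBound := by
  have h1 := (polyBounded_const 608).mul polyBounded_id
  exact (((polyBounded_const 960).mul polyBounded_id).add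
    (((polyBounded_const 2).mul ((polyBounded_const 19).mul
      ((h1.mul (h1.add (polyBounded_const 1))).pow 7))).mul
        (polyBounded_id.add (polyBounded_const 1)))).add (polyBounded_const 1)

/-- The bound `76 / ε'` on the iterations at accuracy `ε' = 1 / (8 q)`. -/
lemma LearnIter.le_nat {μ : X → ℝ} (hq : 1 ≤ q) (h : LearnIter C S (1 / (8 * q)) t μ) :
    t ≤ 608 * q := by
  have hq' : (1 : ℝ) ≤ q := by exact_mod_cast hq
  have h1 := h.le_div (by positivity) (by rw [div_le_one (by positivity)]; linarith)
  rw [div_div_eq_mul_div, div_one] at h1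
  have h2 : (t : ℝ) ≤ 608 * q := by linarith
  exact_mod_cast h2

/-- The program has no explicit iteration limit. After `i` repetitions it is about to start
iteration `i + 1` or has stopped in iteration `i`; either way the state certifies a `LearnIter`,
whose length is bounded. This bound yields termination, the memory bound and the number of oracle
calls. -/
theorem runs_learnProg (hE : IsERMOracle C E) (hn : 0 < n) (hq : 1 ≤ q) :
    Runs S E (memBound (n + q)) learnProg (Config.start X n q) fun s =>
      gMaj ∘ s.mixture ∈ learnMal C (1 / (8 * q)) S ∧ s.concepts.length ≤ 608 * q + 1 := by
  set M := memBound (n + q) with hMdef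
  have hM0 : 960 * (n + q) + 1 ≤ M := by rw [hMdef, memBound]; omega
  have hM : ∀ t ≤ 608 * q, 2 * gapDen (t * (t + 1)) * (n + 1) ≤ M := fun t ht => by
    have h1 : t ≤ 608 * (n + q) := by omega
    have h2 : t * (t + 1) ≤ 608 * (n + q) * (608 * (n + q) + 1) :=
      Nat.mul_le_mul h1 (Nat.succ_le_succ h1)
    have h3 : 2 * gapDen (t * (t + 1)) * (n + 1) ≤
        2 * (19 * (608 * (n + q) * (608 * (n + q) + 1)) ^ 7) * (n + q + 1) :=
      Nat.mul_le_mul (Nat.mul_le_mul_left _ (Nat.mul_le_mul_left _ (Nat.pow_le_pow_left h2 7)))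
        (by omega)
    rw [hMdef, memBound]; omega
  have hb0 : (Config.start X n q).BoundedBy M := fun a => by
    simp only [Config.start]; split_ifs <;> omega
  have hb1 : ((Config.start X n q).write 2 1).BoundedBy M := hb0.write (by omega)
  have hb2 : (((Config.start X n q).write 2 1).write 3 1).BoundedBy M := hb1.write (by omega)
  refine Runs.seq (Runs.set hb0 (Runs.seq (Runs.set hb1 (Runs.seq (Runs.erm (Runs.seq ?_))))))
  simp only [val_const]
  refine Runs.mono (Runs.loop (Q := fun s => ∃ t, s.Regular n q M ∧ s.Stopped C S q t)
    (fun i s => s.Regular n q M ∧ (s.Active C S q (i + 1) ∨ s.Stopped C S q i)) ?_ ?_) ?_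
  · rintro i s ⟨hr, ha | hs⟩
    · have h1 := ha.learnIter.le_nat hq
      refine ⟨by omega, hr.boundedBy, Or.inr ⟨by rw [val_reg, ha.flag]; exact one_ne_zero, ?_⟩⟩
      exact runs_iterProg hE hn hq hr ha (hM _ h1) (by omega)
    · have h1 := hs.learnIter.le_nat hq
      exact ⟨by omega, hr.boundedBy, Or.inl ⟨by rw [val_reg, hs.flag], i, hr, hs⟩⟩
  · refine ⟨⟨by simp [Config.call, Config.write_mem, Config.start],
      by simp [Config.call, Config.write_mem, Config.start], rfl, rfl, hb2⟩, Or.inl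
      ⟨by simp [Config.call, Config.write_mem], by simp [Config.call, Config.write_mem], rfl, ?_⟩⟩
    rw [zero_add, mix_one]
    exact .init _ (hE 0 []).1
  · rintro s ⟨t, hr, hs⟩
    refine Runs.mono (runs_outputProg hr.boundedBy hs.iter (by rw [hs.length]; omega) hr.out
      hs.learnIter.one_le) ?_
    rintro s' ⟨hc, hm⟩
    have h1 := hs.learnIter.le_nat hq
    exact ⟨⟨t, _, _, hs.learnIter, hs.approxMax, hs.loss_le, by rw [hm]⟩,
      by rw [hc, hs.length]; omega⟩

end Correctness

end RobustLearning

/-! ### Choice of the constants and the main theorem. -/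

theorem mainTheorem2 :
    ∃ (A K : ℕ) (p : RobustLearning.Prog), 0 < A ∧
      ∀ (X : Type u) [MeasurableSpace X] (C : Set (X → Bool)) (d : ℕ),
        RobustLearning.HasVCDim C d → (∀ c ∈ C, Measurable c) →
      ∀ ε δ α : ℝ, 0 < ε → ε < 1 → 0 < δ → δ < 1 → 0 ≤ α → α < 1 →
      ∀ n : ℕ,
        (K : ℝ) * ((d * Real.log (2 + α / ε) + Real.log (1 / δ)) / (ε * (α + ε))) ≤ n →
        -- the learner also learns with malicious noise
        (∀ η : unitInterval, (η : ℝ) < 1 →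
          RobustLearning.LearnsMalicious.{u, v} C
            (RobustLearning.learnMal (n := n) C (1 / (A * ⌈1 / ε⌉₊)))
            η (ε + (1 / 2 + α) * ((η : ℝ) / (1 - η))) δ) ∧
        -- the same learner learns with nasty noise
        (∀ η : unitInterval,
          RobustLearning.LearnsNasty.{u, v} C
            (RobustLearning.learnMal (n := n) C (1 / (A * ⌈1 / ε⌉₊)))
            η ((3 / 2 + α) * η + ε) δ) ∧
        -- it is implemented by the program `p`, efficiently and with few calls to the oracle
        ∀ (S : Fin n → X × Bool) (E : ℕ → List (X × Bool) → X → Bool),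
          RobustLearning.IsERMOracle C E →
          ∃ (s : RobustLearning.Config X) (T : ℕ),
            RobustLearning.Exec S E p (RobustLearning.Config.start X n ⌈1 / ε⌉₊) s T ∧
            RobustLearning.gMaj ∘ s.mixture ∈
              RobustLearning.learnMal C (1 / (A * ⌈1 / ε⌉₊)) S ∧
            (s.concepts.length : ℝ) ≤ K / ε ∧
            (T : ℝ) ≤ K * (n + 1 / ε) ^ K := by
  obtain ⟨K₁, hK₁⟩ := RobustLearning.learnProg.polyBounded_timeBound.comp
    RobustLearning.polyBounded_memBound
  -- `A = 8` makes the accuracy at most `ε / 8`. The three summands of `K` serve the sample size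
  -- (and the oracle calls), the factor `3 ^ K₁` from `n + q + 1 ≤ 3 (n + 1 / ε)`, and the exponent
  -- of the time bound.
  refine ⟨8, 8000000000 + K₁ * 3 ^ K₁ + K₁, RobustLearning.learnProg, by norm_num, ?_⟩
  intro X _ C d hvc hC ε δ α hε hε1 hδ hδ1 hα hα1 n hn
  set K := 8000000000 + K₁ * 3 ^ K₁ + K₁ with hK
  have hKℝ : (8000000000 : ℝ) ≤ K := by exact_mod_cast (by omega : 8000000000 ≤ K)
  have hεinv : 1 < 1 / ε := by rwa [lt_div_iff₀ hε, one_mul]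
  set q := ⌈1 / ε⌉₊ with hq
  have hq1 : 1 / ε ≤ q := Nat.le_ceil _
  have hq2 : (q : ℝ) < 1 / ε + 1 := Nat.ceil_lt_add_one (by positivity)
  have hqpos : 1 ≤ q := by exact_mod_cast (hεinv.trans_le hq1).le
  have hlogδ : 0 < Real.log (1 / δ) := Real.log_pos (by rwa [lt_div_iff₀ hδ, one_mul])
  have hlogα : 0 ≤ Real.log (2 + α / ε) :=
    Real.log_nonneg (by have : 0 ≤ α / ε := by positivity
                        linarith)
  have hfrac : 0 < (d * Real.log (2 + α / ε) + Real.log (1 / δ)) / (ε * (α + ε)) := by positivity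
  have hn' := (mul_le_mul_of_nonneg_right hKℝ hfrac.le).trans hn
  have hnpos : 0 < n := by
    have : (0 : ℝ) < n := lt_of_lt_of_le (by positivity) hn'
    exact_mod_cast this
  have hε' : 1 / (((8 : ℕ) : ℝ) * q) ≤ ε / 8 := by
    rw [div_le_iff₀ hε] at hq1
    rw [div_le_div_iff₀ (by positivity) (by norm_num)]
    push_cast
    linarith
  refine ⟨fun η hη => RobustLearning.learnsMalicious hvc hC hα hα1 hε hε1 hδ hδ1 hε' hn' η hη,
    fun η => RobustLearning.learnsNasty hvc hC hα hα1 hε hε1 hδ hδ1 hε' hn' η, fun S E hE => ?_⟩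
  obtain ⟨s, T, hexec, hT, hmem, hlen⟩ :=
    RobustLearning.runs_learnProg (S := S) hE hnpos hqpos
  refine ⟨s, T, hexec, by exact_mod_cast hmem, ?_, ?_⟩
  · have h1 : (s.concepts.length : ℝ) ≤ 608 * q + 1 := by exact_mod_cast hlen
    calc (s.concepts.length : ℝ) ≤ 8000000000 * (1 / ε) := by linarith
      _ ≤ K * (1 / ε) := by gcongr
      _ = K / ε := by ring
  · have h1 : (T : ℝ) ≤ K₁ * ((n : ℝ) + q + 1) ^ K₁ := by exact_mod_cast hT.trans (hK₁ (n + q))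
    have hbase : 1 ≤ (n : ℝ) + 1 / ε := by
      have : (0 : ℝ) ≤ n := Nat.cast_nonneg n
      linarith
    calc (T : ℝ) ≤ K₁ * ((n : ℝ) + q + 1) ^ K₁ := h1
      _ ≤ K₁ * (3 * ((n : ℝ) + 1 / ε)) ^ K₁ := by
          have : (n : ℝ) + q + 1 ≤ 3 * ((n : ℝ) + 1 / ε) := by
            have : (0 : ℝ) ≤ n := Nat.cast_nonneg n
            linarith
          gcongr
      _ = ((K₁ * 3 ^ K₁ : ℕ) : ℝ) * ((n : ℝ) + 1 / ε) ^ K₁ := by push_cast; rw [mul_pow]; ring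
      _ ≤ K * ((n : ℝ) + 1 / ε) ^ K := by
          have h2 : ((K₁ * 3 ^ K₁ : ℕ) : ℝ) ≤ K := by exact_mod_cast (by omega : K₁ * 3 ^ K₁ ≤ K)
          have h3 : ((n : ℝ) + 1 / ε) ^ K₁ ≤ ((n : ℝ) + 1 / ε) ^ K :=
            pow_le_pow_right₀ hbase (by omega)
          exact mul_le_mul h2 h3 (by positivity) (by positivity)
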